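/- Let $\mathbf k$ be a commutative ring (for instance a field of characteristic zero) and let $m$ be a natural number or $\infty$. All gradings are $\mathbb Z$-gradings and signs follow the Koszul rule. An $A(m)$-algebra is a graded $\mathbf k$-module $A$ with multilinear operations $\mu_k : A^{\otimes k}\to A$ of degree $k-2$ ($1\le k\le m$, $k<\infty$) such that, for all finite $1\le n\le m$ and homogeneous $a_1,\dots,a_n\in A$, $$\sum_{\lambda=0}^{n-1}\sum_{k=1}^{n-\lambda}(-1)^{k+\lambda+k\lambda+k(|a_1|+\cdots+|a_\lambda|)}\,\mu_{n-k+1}(a_1,\dots,a_\lambda,\mu_k(a_{\lambda+1},\dots,a_{\lambda+k}),a_{\lambda+k+1},\dots,a_n)=0 .$$ Morphisms are the degree $0$ linear maps commuting with all $\mu_k$. Let $T_m(n)$ be the set of planar rooted trees with $n$ input legs all of whose vertices have at least $1$ and at most $m$ input edges (the tree $|$ with no vertex belongs to $T_m(1)$), with $\deg T=\sum_{v}(\mathrm{val}(v)-2)$, where $\mathrm{val}(v)$ is the number of input edges of $v$. Let $\xi_k(T_1,\dots,T_k)$ be the tree obtained by grafting $T_1,\dots,T_k$ onto the inputs of the $k$-corolla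 $\xi_k$. The free graded non-$\Sigma$ operad on $\xi_1,\dots,\xi_m$ ($\xi_k$ for all finite $k \geq 1$ if $m=\infty$), $\xi_k$ of arity $k$ and degree $k-2$, has in arity $n$ the free $\mathbf k$-module on $T_m(n)$, the tree $\xi_k(T_1,\dots,T_k)$ representing the operadic composition $\gamma(\xi_k;T_1,\dots,T_k)$; thus $T\circ_i S$ is the tree obtained by grafting $S$ at the $i$-th leg of $T$, times $(-1)^{\deg S\cdot d}$, where $d$ is the sum of $\mathrm{val}(v)-2$ over those vertices $v$ of $T$ that follow the $i$-th leg in depth-first, left-to-right order. Let $A_m$ be the quotient of this operad by the operadic ideal generated by $$\Phi_n=\sum_{\lambda=0}^{n-1}\sum_{k=1}^{n-\lambda}(-1)^{\lambda(k+1)+k}\,\xi_{n-k+1}\circ_{\lambda+1}\xi_k,\qquad 1\le n\le m,\ n<\infty.$$ A tree is admissible if the input of every unary vertex is an input leg of the tree. Let $X$ be a graded $\mathbf k$-module. Then: 1. For every $n$, the classes of the admissible $n$-trees form a basis of the $\mathbf k$-module $A_m(n)$. Consequently there is exactly one family of maps $\Omega: T_m(n)\to \mathrm{Span}_{\mathbf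 k}\{\text{admissible } n\text{-trees}\}$ such that $\Omega(T)$ and $T$ have the same class in $A_m(n)$ for every $T$. 2. The module $\mathfrak A(X)=\bigoplus_{n\ge1}A_m(n)\otimes X^{\otimes n}$ is graded by $|T\otimes x_1\otimes\cdots\otimes x_n|=\deg T+|x_1|+\cdots+|x_n|$, and it carries exactly one $A(m)$-algebra structure with $$\mu_k(T_1\otimes v_1,\dots,T_k\otimes v_k)=(-1)^{\sum_{p<q}|v_p|\deg T_q}\;\Omega(\xi_k(T_1,\dots,T_k))\otimes(v_1\otimes\cdots\otimes v_k)$$ for all $1\le k\le m$, $k<\infty$, all admissible trees $T_j\in T_m(n_j)$, and all tensors $v_j\in X^{\otimes n_j}$ of homogeneous elements of $X$. 3. With this structure, $\mathfrak A(X)$ is the free $A(m)$-algebra on $X$, with unit $x\mapsto |\otimes x$: every degree $0$ linear map from $X$ to an $A(m)$-algebra $B$ extends uniquely along it to a morphism $\mathfrak A(X)\to B$. -/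

import Mathlib

open scoped TensorProduct DirectSum

universe u v w

noncomputable section

/-! ### A(m)-algebras -/

/-- The arities of the structure operations: natural numbers `j` with `1 ≤ j ≤ m`, `j < ∞`. -/
abbrev Ar (m : ℕ∞) : Type := {j : ℕ // 1 ≤ j ∧ (j : ℕ∞) ≤ m}

/-- The arity `j ≤ n`, for `n` an arity. -/
def Ar.below {m : ℕ∞} (n : Ar m) (j : ℕ) (h1 : 1 ≤ j) (hn : j ≤ n.1) : Ar m :=
  ⟨j, h1, (Nat.cast_le.mpr hn).trans n.2.2⟩

/-- The tuple `(a₁, …, a_l, b, a_{l+k+1}, …, a_n)` of length `n - k + 1 = c`, obtained from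
`(a₁, …, a_n)` by replacing the block `a_{l+1}, …, a_{l+k}` by `b`. -/
def replaceBlock {A : Type*} {n : ℕ} (a : Fin n → A) (l k c : ℕ) (hlk : l + k ≤ n)
    (hc : c + k = n + 1) (b : A) : Fin c → A := fun i =>
  if h : i.1 < l then a ⟨i.1, by omega⟩
  else if h' : i.1 = l then b
  else a ⟨i.1 + k - 1, by omega⟩

/-- An A(m)-algebra structure on the graded module `A = ⨁_d 𝒜 d`. -/
@[ext]
structure AmStructure (k : Type u) [CommRing k] (m : ℕ∞) {A : Type v} [AddCommGroup A]
    [Module k A] (𝒜 : ℤ → Submodule k A) where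
  /-- the operations `μ_j : A^{⊗ j} → A` -/
  μ : ∀ j : Ar m, MultilinearMap k (fun _ : Fin j.1 => A) A
  /-- `μ_j` has degree `j - 2` -/
  degree : ∀ (j : Ar m) (d : Fin j.1 → ℤ) (a : Fin j.1 → A), (∀ i, a i ∈ 𝒜 (d i)) →
    μ j a ∈ 𝒜 ((∑ i, d i) + (j.1 - 2))
  /-- the A(m) axioms; the inner summation index `s` stands for `k - 1`, so the sign exponent
  is `k + l + k l + k (|a₁| + ⋯ + |a_l|)` with `k = s + 1` -/
  rel : ∀ (n : Ar m) (d : Fin n.1 → ℤ) (a : Fin n.1 → A), (∀ i, a i ∈ 𝒜 (d i)) →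
    ∑ l : Fin n.1, ∑ s : Fin (n.1 - l.1),
      Int.negOnePow (((s.1 + 1 : ℕ) : ℤ) + l.1 + (s.1 + 1 : ℕ) * l.1
          + (s.1 + 1 : ℕ) * ∑ i : Fin l.1, d ⟨i.1, i.2.trans l.2⟩) •
        μ (n.below (n.1 - s.1) (by omega) (by omega))
          (replaceBlock a l.1 (s.1 + 1) (n.1 - s.1) (by omega) (by omega)
            (μ (n.below (s.1 + 1) (by omega) (by omega))
              (fun t : Fin (s.1 + 1) => a ⟨l.1 + t.1, by omega⟩))) = 0

/-- Strict morphisms of A(m)-algebras: degree zero linear maps commuting with all operations. -/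
structure AmStructure.IsHom {k : Type u} [CommRing k] {m : ℕ∞}
    {A : Type v} [AddCommGroup A] [Module k A] {𝒜 : ℤ → Submodule k A}
    {B : Type w} [AddCommGroup B] [Module k B] {ℬ : ℤ → Submodule k B}
    (S : AmStructure k m 𝒜) (R : AmStructure k m ℬ) (f : A →ₗ[k] B) : Prop where
  degree_zero : ∀ (d : ℤ) (a : A), a ∈ 𝒜 d → f a ∈ ℬ d
  map_μ : ∀ (j : Ar m) (a : Fin j.1 → A), f (S.μ j a) = R.μ j (fun i => f (a i))

/-- `(A, S)` is the free A(m)-algebra on the graded module `X`, with unit `η : X → A`: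
`η` is a universal arrow from `X` to the forgetful functor from A(m)-algebras (and strict
morphisms) to graded modules (and degree zero linear maps). -/
def AmStructure.IsFreeOn {k : Type u} [CommRing k] {m : ℕ∞}
    {A : Type*} [AddCommGroup A] [Module k A] {𝒜 : ℤ → Submodule k A}
    (S : AmStructure k m 𝒜)
    {X : Type*} [AddCommGroup X] [Module k X] (𝒳 : ℤ → Submodule k X) (η : X →ₗ[k] A) : Prop :=
  (∀ (d : ℤ) (x : X), x ∈ 𝒳 d → η x ∈ 𝒜 d) ∧
  ∀ (B : Type w) [AddCommGroup B] [Module k B] (ℬ : ℤ → Submodule k B),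
    DirectSum.IsInternal ℬ → ∀ (R : AmStructure k m ℬ) (f : X →ₗ[k] B),
      (∀ (d : ℤ) (x : X), x ∈ 𝒳 d → f x ∈ ℬ d) →
        ∃! F : A →ₗ[k] B, S.IsHom R F ∧ F ∘ₗ η = f

/-! ### Planar trees -/

/-- Planar rooted trees all of whose vertices have between `1` and `m` input edges. The tree
`leaf` is the tree with one edge and no vertex; `node j c` has a root vertex with `j` input
edges, at which the trees `c 0, …, c (j-1)` are grafted in this order. -/
inductive PTree (m : ℕ∞) : Type
  | leaf : PTree m
  | node (j : Ar m) (c : Fin j.1 → PTree m) : PTree m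

namespace PTree

variable {m : ℕ∞}

/-- The number of input legs. -/
def leaves : PTree m → ℕ
  | leaf => 1
  | node _ c => ∑ i, (c i).leaves

/-- The degree `∑_v (val(v) - 2)`, summed over all vertices. -/
def deg : PTree m → ℤ
  | leaf => 0
  | node j c => ((j.1 : ℤ) - 2) + ∑ i, (c i).deg

/-- Admissible trees: all inputs of each unary vertex are input legs. -/
def Admissible : PTree m → Prop
  | leaf => True
  | node j c => (j.1 = 1 → ∀ i, c i = leaf) ∧ ∀ i, (c i).Admissible

/-- `graft T i S` is the tree obtained by grafting `S` at the `i`-th input leg of `T`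
(counted from `0`). -/
def graft : (T : PTree m) → Fin T.leaves → PTree m → PTree m
  | leaf, _, S => S
  | node j c, i, S =>
      let p := (finSigmaFinEquiv (n := fun i => (c i).leaves)).symm i
      node j (Function.update c p.1 (graft (c p.1) p.2 S))

/-- The sum of the degrees of those vertices of `T` that come after the `i`-th input leg when
the tree is read from the root upwards and from the left to the right (depth first). -/
def degAfter : (T : PTree m) → Fin T.leaves → ℤ
  | leaf, _ => 0
  | node _ c, i =>
      let p := (finSigmaFinEquiv (n := fun i => (c i).leaves)).symm i
      degAfter (c p.1) p.2 + ∑ q ∈ Finset.univ.filter (fun q => p.1 < q), (c q).deg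

theorem leaves_graft (T : PTree m) (i : Fin T.leaves) (S : PTree m) :
    (T.graft i S).leaves + 1 = T.leaves + S.leaves := by
  induction T with
  | leaf => simp [graft, leaves, Nat.add_comm]
  | node j c ih =>
    have h := ih ((finSigmaFinEquiv (n := fun i => (c i).leaves)).symm i).1
      ((finSigmaFinEquiv (n := fun i => (c i).leaves)).symm i).2
    simp only [graft, leaves]
    generalize (finSigmaFinEquiv (n := fun i => (c i).leaves)).symm i = p at h ⊢
    rw [← Finset.add_sum_erase _ _ (Finset.mem_univ p.1),
      ← Finset.add_sum_erase Finset.univ (fun i => (c i).leaves) (Finset.mem_univ p.1)]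
    have h2 : ∑ x ∈ Finset.univ.erase p.1,
        (Function.update c p.1 ((c p.1).graft p.2 S) x).leaves
        = ∑ x ∈ Finset.univ.erase p.1, (c x).leaves :=
      Finset.sum_congr rfl fun x hx => by
        rw [Function.update_of_ne (Finset.ne_of_mem_erase hx)]
    rw [h2]
    simp only [Function.update_self]
    omega

end PTree

/-- The set of planar trees with `n` input legs and vertices of arity at most `m`. -/
abbrev Tr (m : ℕ∞) (n : ℕ) : Type := {T : PTree m // T.leaves = n}

/-- The set of admissible `n`-trees. -/
abbrev AdmTr (m : ℕ∞) (n : ℕ) : Type := {T : Tr m n // T.1.Admissible}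

/-- The tree `ξ_j(T_1, …, T_j)`. -/
def Tr.corollaOf {m : ℕ∞} (j : Ar m) {n : Fin j.1 → ℕ} (T : ∀ i, Tr m (n i)) :
    Tr m (∑ i, n i) :=
  ⟨PTree.node j fun i => (T i).1, Finset.sum_congr rfl fun i _ => (T i).2⟩

/-- The tree with one leg and no vertex. -/
def Tr.unit (m : ℕ∞) : Tr m 1 := ⟨PTree.leaf, rfl⟩

/-- The `j`-corolla `ξ_j`. -/
def Tr.corolla {m : ℕ∞} (j : Ar m) : Tr m j.1 :=
  ⟨PTree.node j fun _ => PTree.leaf, by simp [PTree.leaves]⟩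

/-- The grafting `Tr m a × Tr m b → Tr m (a + b - 1)`, with `c = a + b - 1`. -/
def Tr.graft {m : ℕ∞} {a b c : ℕ} (h : c + 1 = a + b) (T : Tr m a) (i : Fin a) (S : Tr m b) :
    Tr m c :=
  ⟨T.1.graft (Fin.cast T.2.symm i) S.1, by
    have := T.1.leaves_graft (Fin.cast T.2.symm i) S.1
    have hT := T.2
    have hS := S.2
    omega⟩

/-! ### The operad -/

section Operad

variable (k : Type u) [CommRing k] (m : ℕ∞)

/-- The arity `n` component of the free graded non-symmetric operad on `ξ_j`, `1 ≤ j ≤ m`,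
with `ξ_j` of arity `j` and degree `j - 2`. A tree `ξ_j(T_1, …, T_j)` represents the operadic
composition `γ(ξ_j; T_1, …, T_j)`. -/
abbrev FreeOp (n : ℕ) : Type u := Tr m n →₀ k

variable {m}

/-- The circle product `∘_i` of the free graded operad (with `i` counted from `0`): grafting of
trees, with the Koszul sign for moving `S` past the vertices of `T` that follow the `i`-th leg. -/
def FreeOp.circ {a b c : ℕ} (h : c + 1 = a + b) (i : Fin a) :
    FreeOp k m a →ₗ[k] FreeOp k m b →ₗ[k] FreeOp k m c :=
  Finsupp.lsum k fun T : Tr m a => LinearMap.toSpanSingleton k _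
    (Finsupp.lsum k fun S : Tr m b => LinearMap.toSpanSingleton k _
      (Int.negOnePow (S.1.deg * T.1.degAfter (Fin.cast T.2.symm i)) •
        Finsupp.single (Tr.graft h T i S) (1 : k)))

/-- The relation `Φ_n = ∑_{l=0}^{n-1} ∑_{k=1}^{n-l} (-1)^{l(k+1)+k} ξ_{n-k+1} ∘_{l+1} ξ_k`;
the inner summation index `s` is `k - 1`. -/
def FreeOp.Φ (n : Ar m) : FreeOp k m n.1 :=
  ∑ l : Fin n.1, ∑ s : Fin (n.1 - l.1),
    Int.negOnePow (((l.1 * ((s.1 + 1) + 1) + (s.1 + 1) : ℕ) : ℤ)) •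
      FreeOp.circ k (a := n.1 - s.1) (b := s.1 + 1) (c := n.1) (by omega) ⟨l.1, by omega⟩
        (Finsupp.single (Tr.corolla (n.below (n.1 - s.1) (by omega) (by omega))) 1)
        (Finsupp.single (Tr.corolla (n.below (s.1 + 1) (by omega) (by omega))) 1)

/-- Operadic ideals of the free operad. -/
def FreeOp.IsIdeal (J : ∀ n, Submodule k (FreeOp k m n)) : Prop :=
  ∀ (a b c : ℕ) (h : c + 1 = a + b) (i : Fin a) (f : FreeOp k m a) (g : FreeOp k m b),
    (f ∈ J a ∨ g ∈ J b) → FreeOp.circ k h i f g ∈ J c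

variable (m)

/-- The operadic ideal generated by the `Φ_n`, `n ≤ m`. -/
def relIdeal (n : ℕ) : Submodule k (FreeOp k m n) :=
  sInf {I | ∃ J : ∀ n, Submodule k (FreeOp k m n),
    FreeOp.IsIdeal k J ∧ (∀ j : Ar m, FreeOp.Φ k j ∈ J j.1) ∧ I = J n}

/-- The arity `n` component of the operad for A(m)-algebras. -/
abbrev AmOp (n : ℕ) : Type u := FreeOp k m n ⧸ relIdeal k m n

variable {m}

/-- The class of a tree in the operad for A(m)-algebras. -/
def AmOp.ofTree {n : ℕ} (T : Tr m n) : AmOp k m n :=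
  (relIdeal k m n).mkQ (Finsupp.single T 1)

/-- The class of a linear combination of admissible trees. -/
def AmOp.ofAdm {n : ℕ} : (AdmTr m n →₀ k) →ₗ[k] AmOp k m n :=
  Finsupp.linearCombination k fun T : AdmTr m n => AmOp.ofTree k T.1

variable (m)

/-- `Ω : Tr m n → Span (AdmTr m n)` satisfies `Ω(T) ≡ T` modulo the relations. -/
def IsNormalization (Ω : ∀ n : ℕ, Tr m n → (AdmTr m n →₀ k)) : Prop :=
  ∀ (n : ℕ) (T : Tr m n), AmOp.ofAdm k (Ω n T) = AmOp.ofTree k T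

end Operad

/-! ### The graded module `⨁_{n ≥ 1} A_m(n) ⊗ X^{⊗ n}` -/

section FreeModule

variable (k : Type u) [CommRing k] (m : ℕ∞) (X : Type v) [AddCommGroup X] [Module k X]

/-- The module `⨁_{n ≥ 1} A_m(n) ⊗ X^{⊗ n}`. -/
abbrev FreeAm : Type (max u v) := ⨁ n : ℕ+, (AmOp k m n ⊗[k] (⨂[k]^(n : ℕ) X))

instance FreeAm.instAddCommGroup : AddCommGroup (FreeAm k m X) :=
  Module.addCommMonoidToAddCommGroup k

variable {k m X}

/-- The element `p ⊗ x₁ ⊗ ⋯ ⊗ x_n` of the `n`-th summand, as a multilinear function of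
`x₁, …, x_n`. -/
def FreeAm.elem (n : ℕ+) (p : AmOp k m n) :
    MultilinearMap k (fun _ : Fin n => X) (FreeAm k m X) :=
  (DirectSum.lof k ℕ+ (fun n : ℕ+ => AmOp k m n ⊗[k] (⨂[k]^(n : ℕ) X)) n ∘ₗ
    TensorProduct.mk k (AmOp k m n) (⨂[k]^(n : ℕ) X) p).compMultilinearMap
      (PiTensorProduct.tprod k)

variable (m) in
/-- The internal grading: the degree of `T ⊗ x₁ ⊗ ⋯ ⊗ x_n` is `deg T + |x₁| + ⋯ + |x_n|`. -/
def FreeAm.grading (𝒳 : ℤ → Submodule k X) (d : ℤ) : Submodule k (FreeAm k m X) :=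
  Submodule.span k {z | ∃ (n : ℕ+) (T : Tr m n) (e : Fin n → ℤ) (x : Fin n → X),
    (∀ i, x i ∈ 𝒳 (e i)) ∧ T.1.deg + ∑ i, e i = d ∧ z = FreeAm.elem n (AmOp.ofTree k T) x}

variable (k m X) in
/-- The inclusion of generators `x ↦ | ⊗ x`, where `|` is the tree without vertices. -/
def FreeAm.unit : X →ₗ[k] FreeAm k m X :=
  (MultilinearMap.ofSubsingleton k X (FreeAm k m X) (0 : Fin 1)).symm
    (FreeAm.elem 1 (AmOp.ofTree k (Tr.unit m)))

/-- The sum of a nonempty tuple of positive integers. -/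
def posSum {m : ℕ∞} (j : Ar m) (n : Fin j.1 → ℕ+) : ℕ+ :=
  ⟨∑ i, (n i : ℕ), Finset.sum_pos (fun i _ => (n i).2) ⟨⟨0, j.2.1⟩, Finset.mem_univ _⟩⟩

/-- Concatenation of tuples. -/
def concat {j : ℕ} {n : Fin j → ℕ} (x : ∀ i, Fin (n i) → X) : Fin (∑ i, n i) → X :=
  fun q => x (finSigmaFinEquiv.symm q).1 (finSigmaFinEquiv.symm q).2

/-- The formula
`μ_j(T_1 ⊗ v_1, …, T_j ⊗ v_j) = ± Ω(ξ_j(T_1, …, T_j)) ⊗ (v_1 ⊗ ⋯ ⊗ v_j)`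
for admissible trees `T_i` and `v_i = x_{i,1} ⊗ ⋯ ⊗ x_{i,n_i}` with homogeneous entries; the sign
is the Koszul sign `(-1)^{∑_{p < q} |v_p| deg(T_q)}` for moving the trees to the left of the
tensors. -/
def IsGraftingFormula (𝒳 : ℤ → Submodule k X) (Ω : ∀ n : ℕ, Tr m n → (AdmTr m n →₀ k))
    (S : AmStructure k m (FreeAm.grading m 𝒳)) : Prop :=
  ∀ (j : Ar m) (n : Fin j.1 → ℕ+) (T : ∀ i, AdmTr m (n i))
    (e : ∀ i, Fin (n i) → ℤ) (x : ∀ i, Fin (n i) → X),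
    (∀ i l, x i l ∈ 𝒳 (e i l)) →
      S.μ j (fun i => FreeAm.elem (n i) (AmOp.ofTree k (T i).1) (x i)) =
        Int.negOnePow (∑ q : Fin j.1, ∑ p ∈ Finset.univ.filter (fun p => p < q),
            (∑ l, e p l) * (T q).1.1.deg) •
          FreeAm.elem (posSum j n)
            (AmOp.ofAdm k (Ω _ (Tr.corollaOf j fun i => (T i).1))) (concat x)

end FreeModule

end

/-! In `A_m` the relation `Φ_n` can be solved for its term `ξ_1 ∘ ξ_n`. A unary vertex can therefore
be pushed towards the legs until it sits on a leg, or meets another unary vertex and vanishes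
because `ξ_1 ∘ ξ_1 = 0`. So the admissible trees span. `PTree.diff` is this rewriting for `ξ_1(T)`,
and `PTree.op` is the resulting operation `ξ_j` on linear combinations of trees.

The heart of the matter is that the rewriting loses nothing: the operations `op` satisfy all
`A(m)`-relations. In arities `n ≥ 2` this is the definition of `diff`; in arity `1` it says that
`diff` squares to zero. Suspend, giving a tree the parity `deg + 1`. The operations then form the
corestriction `b` of an odd coderivation `B` of the tensor coalgebra, and the relations become `b ∘
B = 0`. As `B ∘ B` is again a coderivation, it vanishes on a word once `b ∘ B` vanishes on the
factors of the word (`Words.ext_coder_coder`). Let `w` be the word of the subtrees at the root of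
`T`, where the root is not unary. Its factors are covered by the relations of arity at least `2` and
by induction, so `b (B (B w)) = 0`. After expanding the inner `B` a single term survives, and it is
`diff (diff T)` up to sign (`PTree.diff_diff`).

The free operad acts on every `A(m)`-algebra with Koszul signs, and the ideal of relations acts as
zero (`AmStructure.relIdeal_le_annihilator`). By the relations for `op`, finitely supported
functions on trees with values in a graded algebra `R` form an `A(m)`-algebra. For `R = k`, an
admissible tree evaluated at the trivial tree `|` in every input returns itself, so the classes of
admissible trees are independent. For `R` the tensor algebra of `X`, the module `𝔄(X)` embeds as the
span of the `T ⊗ v` with `T` admissible and `v` of tensor degree the number of legs of `T`. This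
span is closed under the operations, hence inherits the structure and the grading.

A map `f : X → B` extends by letting `T ⊗ x_1 ⊗ ⋯ ⊗ x_n` go to the action of `T` on the `f(x_i)`,
which is well defined since the relations act as zero. The extension is unique because the elements
`| ⊗ x` generate. -/

noncomputable section

/-! ### Coderivations on words -/

section Words

variable {α : Type*}

/-- The sum of `φ x y` over all factorizations `w = x ++ y`. -/
def splitSum {N : Type*} [AddCommMonoid N] : (List α → List α → N) → List α → N
  | φ, [] => φ [] []
  | φ, a :: w => φ [] (a :: w) + splitSum (fun x y => φ (a :: x) y) w

section splitSum

variable {N : Type*} [AddCommMonoid N]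

theorem splitSum_congr {φ ψ : List α → List α → N} {w : List α}
    (h : ∀ x y, x ++ y = w → φ x y = ψ x y) : splitSum φ w = splitSum ψ w := by
  induction w generalizing φ ψ with
  | nil => exact h [] [] rfl
  | cons a w ih =>
    simp only [splitSum]
    rw [h [] _ rfl, ih fun x y hxy => h (a :: x) y (by simp [hxy])]

theorem splitSum_add (φ ψ : List α → List α → N) (w : List α) :
    splitSum (fun x y => φ x y + ψ x y) w = splitSum φ w + splitSum ψ w := by
  induction w generalizing φ ψ with
  | nil => rfl
  | cons a w ih => simp only [splitSum, ih]; abel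

theorem splitSum_zero (w : List α) : splitSum (fun _ _ => (0 : N)) w = 0 := by
  induction w with
  | nil => rfl
  | cons a w ih => simp only [splitSum, ih, add_zero]

theorem map_splitSum {N' F : Type*} [AddCommMonoid N'] [FunLike F N N'] [AddMonoidHomClass F N N']
    (f : F) (φ : List α → List α → N) (w : List α) :
    f (splitSum φ w) = splitSum (fun x y => f (φ x y)) w := by
  induction w generalizing φ with
  | nil => rfl
  | cons a w ih => simp only [splitSum, map_add, ih]

/-- Coassociativity of deconcatenation: both sides run over the factorizations `w = x ++ y ++ z`. -/
theorem splitSum_coassoc (f : List α → List α → List α → N) (w : List α) :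
    splitSum (fun x y => splitSum (fun y' z => f x y' z) y) w =
      splitSum (fun y z => splitSum (fun x y' => f x y' z) y) w := by
  induction w generalizing f with
  | nil => rfl
  | cons a w ih =>
    simp only [splitSum]
    rw [ih, splitSum_add, add_assoc]

end splitSum

variable (k : Type*) [CommRing k]

/-- Linear combinations of words. -/
abbrev Words (α : Type*) := List α →₀ k

namespace Words

variable {k}

/-- The word `w` as a linear combination. -/
abbrev of (w : List α) : Words k α := Finsupp.single w 1

/-- Prefixing a letter. -/
def cons (a : α) : Words k α →ₗ[k] Words k α := Finsupp.lmapDomain k k (List.cons a)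

/-- Inserting a linear combination of letters in front of a word. -/
def push (v : List α) : (α →₀ k) →ₗ[k] Words k α := Finsupp.lmapDomain k k (fun a => a :: v)

/-- The linear extension to words of a function on words. -/
abbrev ext {N : Type*} [AddCommMonoid N] [Module k N] (f : List α → N) : Words k α →ₗ[k] N :=
  Finsupp.linearCombination k f

@[simp] theorem cons_of (a : α) (w : List α) : cons a (of w : Words k α) = of (a :: w) := by
  simp [cons, of]

theorem push_single (v : List α) (a : α) (c : k) :
    push v (Finsupp.single a c) = Finsupp.single (a :: v) c := by
  simp [push]

theorem ext_of {N : Type*} [AddCommMonoid N] [Module k N] (f : List α → N) (w : List α) :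
    ext (k := k) f (of w) = f w := by
  simp [ext, of]

theorem lhom_ext {N : Type*} [AddCommMonoid N] [Module k N] {f g : Words k α →ₗ[k] N}
    (h : ∀ w, f (of w) = g (of w)) : f = g :=
  Finsupp.lhom_ext' fun w => LinearMap.ext_ring (h w)

variable (p : α → ℤ) (b : List α → (α →₀ k))

/-- The parity of a word. -/
def parity (w : List α) : ℤ := (w.map p).sum

/-- The Koszul sign of a word. -/
def sgn (w : List α) : ℤˣ := Int.negOnePow (parity p w)

@[simp] theorem sgn_nil : sgn p ([] : List α) = 1 := rfl

theorem sgn_cons (a : α) (w : List α) : sgn p (a :: w) = sgn p [a] * sgn p w := by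
  simp [sgn, parity, Int.negOnePow_add]

/-- The sum of `b(x) y` over all factorizations `w = x ++ y`. -/
def head (w : List α) : Words k α := splitSum (fun x y => push y (b x)) w

/-- The coderivation of the tensor coalgebra with corestriction `b`. -/
def coder : List α → Words k α
  | [] => 0
  -- Either `b` acts to the right of `a`, passing it with a Koszul sign, or it consumes a prefix
  -- containing `a`. The empty prefix also occurs in `head` and contributes nothing once `b [] = 0`.
  | a :: w => sgn p [a] • cons a (coder w) + head b (a :: w)

/-- The linear extension of a bilinear function of the two factors in a factorization. -/
def splitL {N : Type*} [AddCommGroup N] [Module k N] (Φ : Words k α →ₗ[k] Words k α →ₗ[k] N) :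
    Words k α →ₗ[k] N := ext (splitSum fun x y => Φ (of x) (of y))

variable {N : Type*} [AddCommGroup N] [Module k N] (Φ : Words k α →ₗ[k] Words k α →ₗ[k] N)

theorem splitL_of (w : List α) :
    splitL Φ (of w) = splitSum (fun x y => Φ (of x) (of y)) w := ext_of _ _

theorem splitL_cons (a : α) (z : Words k α) :
    splitL Φ (cons a z) = Φ (of []) (cons a z) + splitL (Φ ∘ₗ cons a) z := by
  have : splitL Φ ∘ₗ cons a = Φ (of []) ∘ₗ cons a + splitL (Φ ∘ₗ cons a) :=
    lhom_ext fun w => by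
      simp only [LinearMap.comp_apply, LinearMap.add_apply, cons_of, splitL_of]
      rfl
  exact LinearMap.congr_fun this z

theorem splitL_push (v : List α) (x : α →₀ k) :
    splitL Φ (push v x) =
      Φ (of []) (push v x) + splitSum (fun y z => Φ (push y x) (of z)) v := by
  induction x using Finsupp.induction_linear with
  | zero => simp only [map_zero, LinearMap.zero_apply, splitSum_zero, add_zero]
  | add x y hx hy =>
    simp only [map_add, LinearMap.add_apply, splitSum_add, hx, hy]; abel
  | single a c =>
    have hc : ∀ v : List α, push v (Finsupp.single a c) = c • (of (a :: v) : Words k α) := by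
      intro v; simp [push_single, of]
    simp only [hc, map_smul, LinearMap.smul_apply, splitL_of, splitSum, smul_add]
    congr 1
    exact map_splitSum (DistribSMul.toAddMonoidHom N c) _ _

/-- A cut of `b(x) y` lies in front of the letter `b(x)` or somewhere behind it. The cuts of the
second kind are factorizations of `w` into three parts, regrouped by coassociativity. -/
theorem splitL_head (w : List α) :
    splitL Φ (head b w) =
      Φ (of []) (head b w) + splitSum (fun z y => Φ (head b z) (of y)) w := by
  simp only [head, map_splitSum, splitL_push, splitSum_add]
  rw [splitSum_coassoc]
  congr 1
  refine splitSum_congr fun x y _ => ?_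
  have := map_splitSum (Φ.flip (of y)) (fun x y => push y (b x)) x
  simp only [LinearMap.flip_apply] at this
  rw [← this, map_splitSum]

variable {b}

theorem head_nil (hb : b [] = 0) : head b [] = 0 := by simp [head, splitSum, hb]

/-- The co-Leibniz rule. -/
theorem splitL_coder (hb : b [] = 0) (w : List α) :
    splitL Φ (coder p b w) =
      splitSum (fun x y => Φ (coder p b x) (of y) + sgn p x • Φ (of x) (coder p b y)) w := by
  induction w generalizing Φ with
  | nil => simp [coder, splitSum]
  | cons a w ih =>
    obtain ⟨u, hu⟩ : ∃ u, u = sgn p [a] := ⟨_, rfl⟩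
    have e : ∀ x, sgn p (a :: x) = u * sgn p x := fun x => hu ▸ sgn_cons p a x
    simp only [coder, splitSum, e, sgn_nil, mul_one]
    have h1 := map_splitSum (DistribSMul.toAddMonoidHom N (u : ℤ))
      (fun x y => Φ (cons a (coder p b x)) (of y)) w
    have h2 := map_splitSum (DistribSMul.toAddMonoidHom N (u : ℤ))
      (fun x y => (sgn p x : ℤ) • Φ (of (a :: x)) (coder p b y)) w
    simp only [DistribSMul.toAddMonoidHom_apply] at h1 h2
    simp only [map_add, Units.smul_def, map_zsmul, LinearMap.add_apply, LinearMap.smul_apply,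
      splitSum_add, map_zero, LinearMap.zero_apply, mul_smul, one_smul, zero_add]
    rw [splitL_cons, splitL_head, ih]
    simp only [splitSum, Units.smul_def, LinearMap.comp_apply, cons_of, splitSum_add, head_nil hb,
      map_zero, LinearMap.zero_apply, zero_add, smul_add]
    rw [h1, h2]
    abel

/-- The bilinear map `(x, y) ↦ b(x) y`. -/
def headBilin (b : List α → (α →₀ k)) : Words k α →ₗ[k] Words k α →ₗ[k] Words k α :=
  LinearMap.flip (ext fun y => push y ∘ₗ ext b)

theorem headBilin_apply (x : Words k α) (y : List α) :
    headBilin b x (of y) = push y (ext b x) := by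
  simp [headBilin]

theorem ext_head_of (w : List α) :
    ext (head b) (of w : Words k α) = splitL (headBilin b) (of w) := by
  rw [ext_of, splitL_of]
  simp only [headBilin_apply, ext_of]
  rfl

theorem ext_head : ext (head b) = splitL (headBilin b) := lhom_ext ext_head_of

/-- The bilinear map `(x, y) ↦ x y` for linear combinations of letters `x` and words `y`. -/
def pushBilin : (α →₀ k) →ₗ[k] Words k α →ₗ[k] Words k α := LinearMap.flip (ext push)

theorem pushBilin_of (x : α →₀ k) (y : List α) : pushBilin x (of y) = push y x := by
  simp [pushBilin]

theorem headBilin_of (x : List α) (z : Words k α) :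
    headBilin b (of x) z = pushBilin (b x) z := by
  have : headBilin b (of x) = pushBilin (b x) := lhom_ext fun y => by
    rw [headBilin_apply, pushBilin_of, ext_of]
  rw [this]

/-- The coderivation applied to a word whose first letter is a homogeneous linear combination. -/
theorem ext_coder_push (e : ℤ) (x : α →₀ k) (y : List α) (hx : ∀ a ∈ x.support,
    Int.negOnePow (p a) = Int.negOnePow e) :
    ext (coder p b) (push y x) =
      Int.negOnePow e • pushBilin x (coder p b y) + ext (head b) (push y x) := by
  have key : ∀ x ∈ Submodule.span k {z : α →₀ k | ∃ a, Int.negOnePow (p a) = Int.negOnePow e ∧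
      z = Finsupp.single a 1}, ext (coder p b) (push y x) =
      Int.negOnePow e • pushBilin x (coder p b y) + ext (head b) (push y x) := by
    intro x hx
    induction hx using Submodule.span_induction with
    | zero => simp
    | add x y _ _ hx hy => simp only [map_add, LinearMap.add_apply, smul_add, hx, hy]; abel
    | smul c x _ hx =>
      simp only [map_smul, LinearMap.smul_apply, hx, smul_add]
      rw [smul_comm]
    | mem x hx =>
      obtain ⟨a, ha, rfl⟩ := hx
      have h1 : (pushBilin (Finsupp.single a 1) : Words k α →ₗ[k] Words k α) = cons a :=
        lhom_ext fun y => by rw [pushBilin_of, push_single, cons_of]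
      rw [push_single, ext_of, ext_of, h1, coder]
      simp [sgn, parity, ha]
  refine key x ?_
  rw [← Finsupp.sum_single x]
  refine Submodule.sum_mem _ fun a ha => ?_
  have : Finsupp.single a (x a) = x a • Finsupp.single a (1 : k) := by simp
  rw [this]
  exact Submodule.smul_mem _ _ (Submodule.subset_span ⟨a, hx a ha, rfl⟩)

/-- If `b` is odd and `b ∘ B` vanishes on all factors of a word for the coderivation `B` with
corestriction `b`, then `B ∘ B` vanishes on this word. -/
theorem ext_coder_coder (hb : b [] = 0)
    (hodd : ∀ w, ∀ a ∈ (b w).support, Int.negOnePow (p a) = Int.negOnePow (parity p w + 1))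
    (w : List α) (h : ∀ v, v <:+: w → ext b (coder p b v) = 0) :
    ext (coder p b) (coder p b w) = 0 := by
  induction w with
  | nil => simp [coder]
  | cons a w ih =>
    have ih := ih fun v hv => h v (hv.trans (List.suffix_cons a w).isInfix)
    have hcons : ∀ z : Words k α, ext (coder p b) (cons a z) =
        sgn p [a] • cons a (ext (coder p b) z) + ext (head b) (cons a z) := by
      intro z
      have : ext (coder p b) ∘ₗ cons a =
          (sgn p [a] : ℤ) • cons a ∘ₗ ext (coder p b) + ext (head b) ∘ₗ cons a :=
        lhom_ext fun w => by
          simp only [LinearMap.comp_apply, cons_of, ext_of, LinearMap.add_apply,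
            LinearMap.smul_apply, coder, Units.smul_def]
      simpa [Units.smul_def] using LinearMap.congr_fun this z
    -- Co-Leibniz rule for `B`, then `b` on the first factor: the terms `b(B x) y` vanish by
    -- hypothesis and the terms `b(x) B(y)` remain.
    have h1 : ext (head b) (coder p b (a :: w)) =
        splitSum (fun x y => sgn p x • pushBilin (b x) (coder p b y)) (a :: w) := by
      rw [ext_head, splitL_coder p _ hb]
      refine splitSum_congr fun x y hxy => ?_
      rw [headBilin_apply, headBilin_of, h x (List.IsPrefix.isInfix ⟨y, hxy⟩), map_zero, zero_add]
    -- On `b(x) y`, the coderivation acts behind the letter `b(x)` or on a prefix. Since `b` is odd,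
    -- the terms of the first kind are those of `h1` with the opposite sign.
    have h2 : ext (coder p b) (head b (a :: w)) = ext (head b) (head b (a :: w)) -
        splitSum (fun x y => sgn p x • pushBilin (b x) (coder p b y)) (a :: w) := by
      rw [eq_sub_iff_add_eq]
      conv_lhs => rw [head]
      conv_rhs => rw [head]
      rw [map_splitSum, map_splitSum, ← splitSum_add]
      refine splitSum_congr fun x y _ => ?_
      rw [ext_coder_push p (parity p x + 1) _ _ (hodd x), Int.negOnePow_succ, sgn]
      simp only [Units.smul_def, Units.val_neg, neg_smul]
      abel
    -- The terms in which `a` is untouched by both applications form `a B(B w)`, which is zero by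
    -- induction.
    have h3 : ext (coder p b) (coder p b (a :: w)) = ext (head b) (coder p b (a :: w)) +
        (ext (coder p b) (head b (a :: w)) - ext (head b) (head b (a :: w))) := by
      conv_lhs => rw [coder]
      conv_rhs => enter [1]; rw [coder]
      simp only [map_add, Units.smul_def, map_zsmul, hcons, ih, map_zero, smul_zero, zero_add]
      abel
    rw [h3, h1, h2]
    abel

end Words
end Words
end

noncomputable section

/-! ### Blocks of tuples -/

section Blocks

variable {A : Type*}

theorem ofFn_replaceBlock {n : ℕ} (a : Fin n → A) (l k c : ℕ) (hlk : l + k ≤ n)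
    (hc : c + k = n + 1) (b : A) :
    List.ofFn (replaceBlock a l k c hlk hc b) =
      (List.ofFn a).take l ++ b :: (List.ofFn a).drop (l + k) := by
  apply List.ext_getElem
  · simp; omega
  · intro i h1 h2
    simp only [List.length_ofFn] at h1
    simp only [List.getElem_ofFn, replaceBlock, List.getElem_append, List.getElem_take,
      List.length_take, List.length_ofFn]
    simp only [Nat.min_eq_left (show l ≤ n by omega)]
    split_ifs with h h'
    · rfl
    · simp [h']
    · rw [List.getElem_cons, dif_neg (by omega)]
      simp only [List.getElem_drop, List.getElem_ofFn]
      congr 2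
      omega

theorem ofFn_block {n : ℕ} (a : Fin n → A) (l k : ℕ) (hlk : l + k ≤ n) :
    List.ofFn (fun t : Fin k => a ⟨l + t.1, by omega⟩) = ((List.ofFn a).drop l).take k := by
  apply List.ext_getElem
  · simp; omega
  · intro i h1 h2
    simp

theorem list_take_block_drop (w : List A) (l k : ℕ) :
    w = w.take l ++ ((w.drop l).take k ++ w.drop (l + k)) := by
  rw [← List.drop_drop, List.take_append_drop, List.take_append_drop]

/-- Both sides sum over the entries outside the block, those in the block, and `b`; this form needs
no subtraction in `M`. -/
theorem sum_replaceBlock {M : Type*} [AddCommMonoid M] (g : A → M) {n : ℕ} (a : Fin n → A)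
    (l k c : ℕ) (hlk : l + k ≤ n) (hc : c + k = n + 1) (b : A) :
    ∑ i, g (replaceBlock a l k c hlk hc b i) + ∑ t : Fin k, g (a ⟨l + t.1, by omega⟩) =
      ∑ i, g (a i) + g b := by
  have h : ∀ {j : ℕ} (f : Fin j → A), ∑ i, g (f i) = ((List.ofFn f).map g).sum := by
    intro j f
    rw [List.map_ofFn, List.sum_ofFn]
    rfl
  rw [h, h (fun t : Fin k => a ⟨l + t.1, by omega⟩), h a, ofFn_replaceBlock, ofFn_block _ _ _ hlk]
  conv_rhs => rw [list_take_block_drop (List.ofFn a) l k]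
  simp only [List.map_append, List.sum_append, List.map_cons, List.sum_cons]
  abel

theorem replaceBlock_update_left {n : ℕ} (a : Fin n → A) (l k c : ℕ) (hlk : l + k ≤ n)
    (hc : c + k = n + 1) (b : A) (i : Fin n) (hi : i.1 < l) (x : A) :
    replaceBlock (Function.update a i x) l k c hlk hc b =
      Function.update (replaceBlock a l k c hlk hc b) ⟨i.1, by omega⟩ x := by
  funext q
  simp only [replaceBlock, Function.update_apply, Fin.ext_iff]
  split_ifs <;> first | rfl | omega

theorem replaceBlock_update_right {n : ℕ} (a : Fin n → A) (l k c : ℕ) (hlk : l + k ≤ n)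
    (hc : c + k = n + 1) (b : A) (i : Fin n) (hi : l + k ≤ i.1) (x : A) :
    replaceBlock (Function.update a i x) l k c hlk hc b =
      Function.update (replaceBlock a l k c hlk hc b) ⟨i.1 + 1 - k, by omega⟩ x := by
  funext q
  simp only [replaceBlock, Function.update_apply, Fin.ext_iff]
  split_ifs <;> first | rfl | omega

theorem replaceBlock_update_mid {n : ℕ} (a : Fin n → A) (l k c : ℕ) (hlk : l + k ≤ n)
    (hc : c + k = n + 1) (b : A) (i : Fin n) (h1 : l ≤ i.1) (h2 : i.1 < l + k) (x : A) :
    replaceBlock (Function.update a i x) l k c hlk hc b = replaceBlock a l k c hlk hc b := by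
  funext q
  simp only [replaceBlock, Function.update_apply, Fin.ext_iff]
  split_ifs <;> first | rfl | omega

/-- Presents the inserted entry as an updated coordinate, which makes multilinearity in that entry
available; the old value `b'` is immaterial. -/
theorem replaceBlock_eq_update {n : ℕ} (a : Fin n → A) (l k c : ℕ) (hlk : l + k ≤ n)
    (hc : c + k = n + 1) (hl : l < c) (b b' : A) :
    replaceBlock a l k c hlk hc b =
      Function.update (replaceBlock a l k c hlk hc b') ⟨l, hl⟩ b := by
  funext q
  simp only [replaceBlock, Function.update_apply, Fin.ext_iff]
  split_ifs <;> first | rfl | omega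

theorem block_update_mid {n : ℕ} (a : Fin n → A) (l k : ℕ) (hlk : l + k ≤ n)
    (i : Fin n) (h1 : l ≤ i.1) (h2 : i.1 < l + k) (x : A) :
    (fun t : Fin k => Function.update a i x ⟨l + t.1, by omega⟩) =
      Function.update (fun t : Fin k => a ⟨l + t.1, by omega⟩) ⟨i.1 - l, by omega⟩ x := by
  funext q
  simp only [Function.update_apply, Fin.ext_iff]
  split_ifs <;> first | rfl | omega

theorem block_update_out {n : ℕ} (a : Fin n → A) (l k : ℕ) (hlk : l + k ≤ n)
    (i : Fin n) (h : i.1 < l ∨ l + k ≤ i.1) (x : A) :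
    (fun t : Fin k => Function.update a i x ⟨l + t.1, by omega⟩) =
      (fun t : Fin k => a ⟨l + t.1, by omega⟩) := by
  funext q
  simp only [Function.update_apply, Fin.ext_iff]
  split_ifs <;> first | rfl | omega

theorem map_replaceBlock {A' : Type*} (f : A → A') {n : ℕ} (a : Fin n → A) (l k c : ℕ)
    (hlk : l + k ≤ n) (hc : c + k = n + 1) (b : A) (i : Fin c) :
    f (replaceBlock a l k c hlk hc b i) = replaceBlock (fun i => f (a i)) l k c hlk hc (f b) i := by
  simp only [replaceBlock]
  split_ifs <;> rfl

end Blocks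

theorem splitSum_eq_sum {α N : Type*} [AddCommMonoid N] (φ : List α → List α → N) (w : List α) :
    splitSum φ w = ∑ i ∈ Finset.range (w.length + 1), φ (w.take i) (w.drop i) := by
  induction w generalizing φ with
  | nil => simp [splitSum]
  | cons a w ih =>
    rw [List.length_cons, Finset.sum_range_succ', splitSum, ih, add_comm]
    simp

/-- Unfolding the recursion, `b` is applied to each nonempty block, namely `s + 1` letters behind a
prefix of length `l`. This is the shape of the double sums in the `A(m)`-relations. -/
theorem Words.coder_eq_sum {k : Type*} [CommRing k] {α : Type*} (p : α → ℤ)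
    {b : List α → (α →₀ k)} (hb : b [] = 0) (w : List α) :
    Words.coder p b w = ∑ l ∈ Finset.range w.length, ∑ s ∈ Finset.range (w.length - l),
      Words.sgn p (w.take l) • Finsupp.lmapDomain k k
        (fun U => w.take l ++ U :: w.drop (l + (s + 1))) (b ((w.drop l).take (s + 1))) := by
  induction w with
  | nil => simp [coder]
  | cons a w ih =>
    rw [List.length_cons, Finset.sum_range_succ', coder, ih, head, splitSum_eq_sum,
      Finset.sum_range_succ']
    congr 1
    · simp only [map_sum, Finset.smul_sum]
      refine Finset.sum_congr rfl fun l _ => Finset.sum_congr (by simp) fun s _ => ?_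
      simp only [List.take_succ_cons, List.drop_succ_cons, Units.smul_def, map_zsmul]
      rw [sgn_cons p a (w.take l), Units.val_mul, mul_smul]
      congr 2
      rw [show l + 1 + (s + 1) = l + (s + 1) + 1 by omega, List.drop_succ_cons]
      simp only [cons, Finsupp.lmapDomain_apply, ← Finsupp.mapDomain_comp]
      rfl
    · simp only [List.take_zero, hb, map_zero, add_zero, List.length_cons, Nat.sub_zero, sgn_nil,
        one_smul, List.drop_zero, List.nil_append, zero_add]
      rfl

end

noncomputable section

/-- The arity `j ≤ n`; a reducible variant of `Ar.below`. -/
abbrev Ar.lower {m : ℕ∞} (n : Ar m) (j : ℕ) (h1 : 1 ≤ j) (hn : j ≤ n.1) : Ar m :=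
  ⟨j, h1, (Nat.cast_le.mpr hn).trans n.2.2⟩

/-! ### The differential on trees -/

/-- The sign of the `(l, k)`-th term of the `A(m)`-relation, for arguments of degrees `d`. -/
def amSign {n : ℕ} (d : Fin n → ℤ) (l : Fin n) (k : ℕ) : ℤˣ :=
  Int.negOnePow ((k : ℤ) + l.1 + k * l.1 + k * ∑ i : Fin l.1, d ⟨i.1, i.2.trans l.2⟩)

namespace PTree

variable {m : ℕ∞}

theorem leaves_pos (T : PTree m) : 0 < T.leaves := by
  induction T with
  | leaf => exact Nat.one_pos
  | node j c ih => exact Finset.sum_pos (fun i _ => ih i) ⟨⟨0, j.2.1⟩, Finset.mem_univ _⟩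

variable (k : Type*) [CommRing k]

/-- The normal form of `ξ_1(T)`, for `T` in normal form. -/
def diff : PTree m → (PTree m →₀ k)
  | leaf => if h : ((1 : ℕ) : ℕ∞) ≤ m then Finsupp.single (node ⟨1, le_rfl, h⟩ fun _ => leaf) 1 else 0
  -- A unary root gives zero because `ξ_1 ∘ ξ_1 = 0`. Otherwise the relation of arity `j` is solved
  -- for the term `l = 0`, `s + 1 = j`, which is `ξ_1(ξ_j(c))` with sign `(-1)^j`; this explains the
  -- exponent `j + 1` and the omission of that term. The terms with `s = 0` apply `ξ_1` to one
  -- subtree and are normalized recursively.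
  | node j c => if j.1 = 1 then 0 else Int.negOnePow (j.1 + 1) •
      ∑ l : Fin j.1, ∑ s : Fin (j.1 - l.1), if s.1 + 1 = j.1 then 0 else
        amSign (fun i => (c i).deg) l (s.1 + 1) •
          Finsupp.lmapDomain k k (fun U => node (j.lower (j.1 - s.1) (by omega) (by omega))
            (replaceBlock c l.1 (s.1 + 1) (j.1 - s.1) (by omega) (by omega) U))
          (if s.1 = 0 then diff (c l) else
            Finsupp.single (node (j.lower (s.1 + 1) (by omega) (by omega))
              (fun t : Fin (s.1 + 1) => c ⟨l.1 + t.1, by omega⟩)) 1)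

/-- The normal form of `ξ_j(c_1, …, c_j)`, for `c_i` in normal form. -/
def op (j : Ar m) (c : Fin j.1 → PTree m) : PTree m →₀ k :=
  if h : j.1 = 1 then diff k (c ⟨0, by omega⟩) else Finsupp.single (node j c) 1

variable {k}

theorem op_of_ne (j : Ar m) (h : j.1 ≠ 1) (c : Fin j.1 → PTree m) :
    op k j c = Finsupp.single (node j c) 1 := dif_neg h

theorem op_one (j : Ar m) (h : j.1 = 1) (c : Fin j.1 → PTree m) (i : Fin j.1) :
    op k j c = diff k (c i) := by
  rw [op, dif_pos h]
  congr 2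
  ext
  simp only
  omega

variable (k) in
/-- The left hand side of the `A(m)`-relation. -/
def rel (n : Ar m) (c : Fin n.1 → PTree m) : PTree m →₀ k :=
  ∑ l : Fin n.1, ∑ s : Fin (n.1 - l.1), amSign (fun i => (c i).deg) l (s.1 + 1) •
    Finsupp.linearCombination k (fun U => op k (n.lower (n.1 - s.1) (by omega) (by omega))
        (replaceBlock c l.1 (s.1 + 1) (n.1 - s.1) (by omega) (by omega) U))
      (op k (n.lower (s.1 + 1) (by omega) (by omega))
        (fun t : Fin (s.1 + 1) => c ⟨l.1 + t.1, by omega⟩))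

theorem linearCombination_single_one {α β : Type*} (f : α → β) (x : α →₀ k) :
    Finsupp.linearCombination k (fun a => (Finsupp.single (f a) 1 : β →₀ k)) x =
      Finsupp.lmapDomain k k f x := by
  have : Finsupp.linearCombination k (fun a => (Finsupp.single (f a) 1 : β →₀ k)) =
      Finsupp.lmapDomain k k f := Finsupp.lhom_ext fun a b => by simp
  rw [this]

/-- Holds by construction of `diff`: the terms with `s + 1 ≠ n` have a non-unary outer vertex, so
they are the terms in the definition of `diff (node n c)`, and the remaining term is `(-1)^n diff
(node n c)`, which cancels them. -/
theorem rel_of_ne_one (n : Ar m) (hn : n.1 ≠ 1) (c : Fin n.1 → PTree m) : rel k n c = 0 := by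
  have hn0 := n.2.1
  have hz : 0 < n.1 := by omega
  set F : ∀ (l : Fin n.1) (s : Fin (n.1 - l.1)), PTree m →₀ k := fun l s =>
    amSign (fun i => (c i).deg) l (s.1 + 1) •
    Finsupp.linearCombination k (fun U => op k (n.lower (n.1 - s.1) (by omega) (by omega))
        (replaceBlock c l.1 (s.1 + 1) (n.1 - s.1) (by omega) (by omega) U))
      (op k (n.lower (s.1 + 1) (by omega) (by omega))
        (fun t : Fin (s.1 + 1) => c ⟨l.1 + t.1, by omega⟩)) with hF
  have h1 : ∀ (l : Fin n.1) (s : Fin (n.1 - l.1)), F l s = (if s.1 + 1 = n.1 then F l s else 0) +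
      (if s.1 + 1 = n.1 then 0 else F l s) := by
    intro l s; split_ifs <;> simp
  have h2 : ∑ l : Fin n.1, ∑ s : Fin (n.1 - l.1), (if s.1 + 1 = n.1 then 0 else F l s) =
      Int.negOnePow (n.1 + 1) • diff k (node n c) := by
    rw [diff, if_neg hn, smul_smul, Int.units_mul_self, one_smul]
    refine Finset.sum_congr rfl fun l _ => Finset.sum_congr rfl fun s _ => ?_
    split_ifs with h3 h4
    · rfl
    · simp only [hF]
      congr 1
      have : n.1 - s.1 ≠ 1 := by omega
      rw [op_one _ (by simp [h4]) _ ⟨0, by simp⟩]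
      simp only [op_of_ne (n.lower (n.1 - s.1) (by omega) (by omega)) this,
        linearCombination_single_one]
      rfl
    · simp only [hF]
      congr 1
      have : n.1 - s.1 ≠ 1 := by omega
      have h5 : s.1 + 1 ≠ 1 := by omega
      simp only [op_of_ne (n.lower (n.1 - s.1) (by omega) (by omega)) this,
        op_of_ne (n.lower (s.1 + 1) (by omega) (by omega)) h5,
        linearCombination_single_one]
  have h3 : ∑ l : Fin n.1, ∑ s : Fin (n.1 - l.1), (if s.1 + 1 = n.1 then F l s else 0) =
      Int.negOnePow n.1 • diff k (node n c) := by
    rw [Finset.sum_eq_single ⟨0, hz⟩, Finset.sum_eq_single ⟨n.1 - 1, by simp; omega⟩]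
    · have hs : n.1 - 1 + 1 = n.1 := by omega
      simp only [hF, amSign, hs, if_true]
      have h6 : n.lower n.1 (by omega) le_rfl = n := rfl
      congr 1
      rw [op_of_ne _ (by simpa [hs] using hn), Finsupp.linearCombination_single, one_smul,
        op_one _ (by simp; omega) _ ⟨0, by simp; omega⟩]
      simp only [replaceBlock, lt_irrefl, dite_false, dite_true, zero_add]
      congr 1
      obtain ⟨j, hj⟩ := n
      obtain ⟨j, rfl⟩ : ∃ i, j = i + 1 := ⟨j - 1, by simp at hz; omega⟩
      rfl
    · intro s _ hs
      rw [if_neg]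
      intro h
      exact hs (Fin.ext (by simp; omega))
    · simp
    · intro l _ hl
      refine Finset.sum_eq_zero fun s _ => if_neg fun h => hl ?_
      have := s.2
      exact Fin.ext (by simp; omega)
    · simp
  have h4 : rel k n c = ∑ l : Fin n.1, ∑ s : Fin (n.1 - l.1), F l s := rfl
  rw [h4, Finset.sum_congr rfl fun l _ => Finset.sum_congr rfl fun s _ => h1 l s]
  simp only [Finset.sum_add_distrib]
  rw [h2, h3, Int.negOnePow_succ]
  simp [Units.smul_def]

/-! Degrees, leaves and admissibility of normal forms. -/

theorem sum_deg_replaceBlock {n : ℕ} (c : Fin n → PTree m) (l k j : ℕ) (hlk : l + k ≤ n)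
    (hj : j + k = n + 1) (U : PTree m)
    (hU : U.deg = ∑ t : Fin k, (c ⟨l + t.1, by omega⟩).deg + k - 2) :
    ∑ i, (replaceBlock c l k j hlk hj U i).deg = ∑ i, (c i).deg + k - 2 := by
  have := sum_replaceBlock deg c l k j hlk hj U
  linarith

theorem sum_leaves_replaceBlock {n : ℕ} (c : Fin n → PTree m) (l k j : ℕ) (hlk : l + k ≤ n)
    (hj : j + k = n + 1) (U : PTree m)
    (hU : U.leaves = ∑ t : Fin k, (c ⟨l + t.1, by omega⟩).leaves) :
    ∑ i, (replaceBlock c l k j hlk hj U i).leaves = ∑ i, (c i).leaves := by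
  have := sum_replaceBlock leaves c l k j hlk hj U
  omega

theorem admissible_replaceBlock {n : ℕ} (c : Fin n → PTree m) (l k j : ℕ) (hlk : l + k ≤ n)
    (hj : j + k = n + 1) (U : PTree m) (hc : ∀ i, (c i).Admissible) (hU : U.Admissible) (i) :
    (replaceBlock c l k j hlk hj U i).Admissible := by
  unfold replaceBlock
  split_ifs
  exacts [hc _, hU, hc _]

/-- Admissibility survives because the vertices created in the recursive case have at least two
inputs: the outer one has `j - s ≥ 2`, and an inner one of arity `s + 1` is created only for `s ≠
0`. -/
theorem diff_mem (T : PTree m) :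
    diff k T ∈ Finsupp.supported k k {U : PTree m | U.deg = T.deg - 1 ∧ U.leaves = T.leaves ∧
      (T.Admissible → U.Admissible)} := by
  induction T with
  | leaf =>
    rw [diff]
    split_ifs with h
    · exact Finsupp.single_mem_supported _ _ ⟨by simp [deg], by simp [leaves],
        fun _ => ⟨fun _ _ => rfl, fun _ => trivial⟩⟩
    · exact Submodule.zero_mem _
  | node j c ih =>
    rw [diff]
    split_ifs with h
    · exact Submodule.zero_mem _
    · rw [Units.smul_def]
      refine zsmul_mem (Submodule.sum_mem _ fun l _ => Submodule.sum_mem _ fun s _ => ?_) _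
      split_ifs with h1 h2
      · exact Submodule.zero_mem _
      · rw [Units.smul_def]
        refine zsmul_mem ?_ _
        have : Finsupp.lmapDomain k k (fun U => node (j.lower (j.1 - s.1) (by omega) (by omega))
            (replaceBlock c l.1 (s.1 + 1) (j.1 - s.1) (by omega) (by omega) U)) (diff k (c l)) ∈
            Submodule.map (Finsupp.lmapDomain k k _) _ := Submodule.mem_map_of_mem (ih l)
        rw [Finsupp.lmapDomain_supported] at this
        refine Finsupp.supported_mono ?_ this
        rintro _ ⟨U, ⟨hU1, hU2, hU3⟩, rfl⟩
        have e : ∀ f : PTree m → ℤ, ∑ t : Fin (s.1 + 1), f (c ⟨l.1 + t.1, by omega⟩) = f (c l) := by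
          intro f
          have : ∀ t : Fin (s.1 + 1), f (c ⟨l.1 + t.1, by omega⟩) = f (c l) := by
            intro t; congr 2; ext; simp; omega
          simp [this, h2]
        have e' : ∑ t : Fin (s.1 + 1), (c ⟨l.1 + t.1, by omega⟩).leaves = (c l).leaves := by
          exact_mod_cast e fun T => T.leaves
        refine ⟨?_, ?_, fun hT => ⟨fun hj => ?_, ?_⟩⟩
        · simp only [deg]
          rw [sum_deg_replaceBlock _ _ _ _ _ _ _ (by rw [e deg, hU1]; push_cast; rw [h2]; ring)]
          push_cast [Nat.cast_sub (show s.1 ≤ j.1 by omega)]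
          ring
        · simp only [leaves]
          rw [sum_leaves_replaceBlock _ _ _ _ _ _ _ (by rw [e', hU2])]
        · simp at hj; omega
        · exact admissible_replaceBlock _ _ _ _ _ _ _ hT.2 (hU3 (hT.2 _))
      · rw [Units.smul_def, Finsupp.lmapDomain_apply, Finsupp.mapDomain_single]
        refine zsmul_mem (Finsupp.single_mem_supported _ _ ?_) _
        refine ⟨?_, ?_, fun hT => ⟨fun hj => ?_, ?_⟩⟩
        · simp only [deg]
          rw [sum_deg_replaceBlock _ _ _ _ _ _ _ (by simp only [deg]; push_cast; ring)]
          push_cast [Nat.cast_sub (show s.1 ≤ j.1 by omega)]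
          ring
        · simp only [leaves]
          rw [sum_leaves_replaceBlock _ _ _ _ _ _ _ (by simp only [leaves])]
        · simp at hj; omega
        · exact admissible_replaceBlock _ _ _ _ _ _ _ hT.2
            ⟨fun hs => by simp at hs; omega, fun i => hT.2 _⟩

theorem op_mem (j : Ar m) (c : Fin j.1 → PTree m) :
    op k j c ∈ Finsupp.supported k k {U : PTree m | U.deg = (∑ i, (c i).deg) + (j.1 - 2) ∧
      U.leaves = ∑ i, (c i).leaves ∧ ((∀ i, (c i).Admissible) → U.Admissible)} := by
  by_cases h : j.1 = 1
  · rw [op_one j h c ⟨0, by omega⟩]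
    refine Finsupp.supported_mono ?_ (diff_mem _)
    rintro U ⟨h1, h2, h3⟩
    have e : ∀ f : PTree m → ℤ, ∑ t, f (c t) = f (c ⟨0, by omega⟩) := by
      intro f
      have : ∀ t, f (c t) = f (c ⟨0, by omega⟩) := by
        intro t; congr 2; ext; simp; omega
      simp [this, h]
    refine ⟨?_, ?_, fun h => h3 (h _)⟩
    · rw [e deg, h1]; simp only [h]; push_cast; ring
    · rw [h2]; exact_mod_cast (e fun T => T.leaves).symm
  · rw [op_of_ne j h]
    exact Finsupp.single_mem_supported _ _ ⟨by rw [deg]; ring, rfl,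
      fun hc => ⟨fun h' => absurd h' h, hc⟩⟩

end PTree
end

/-! ### Suspended operations and the square of the differential -/

noncomputable section

theorem map_intUnits_smul {A A' F : Type*} [AddCommGroup A] [AddCommGroup A'] [FunLike F A A']
    [AddMonoidHomClass F A A'] (f : F) (e : ℤˣ) (a : A) : f (e • a) = e • f a := by
  rw [Units.smul_def, map_zsmul, Units.smul_def]

theorem linearCombination_congr_support {k α N : Type*} [CommRing k] [AddCommGroup N] [Module k N]
    {f g : α → N} {x : α →₀ k} (h : ∀ a ∈ x.support, f a = g a) :
    Finsupp.linearCombination k f x = Finsupp.linearCombination k g x := by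
  rw [Finsupp.linearCombination_apply, Finsupp.linearCombination_apply]
  exact Finsupp.sum_congr fun a ha => by rw [h a ha]

theorem linearCombination_units_smul {k α N : Type*} [CommRing k] [AddCommGroup N] [Module k N]
    (e : ℤˣ) (f : α → N) (x : α →₀ k) :
    Finsupp.linearCombination k (fun a => e • f a) x = e • Finsupp.linearCombination k f x := by
  rw [Finsupp.linearCombination_apply, Finsupp.linearCombination_apply, Finsupp.smul_sum]
  exact Finsupp.sum_congr fun a _ => smul_comm _ _ _

namespace PTree

variable {m : ℕ∞} {k : Type*} [CommRing k]

/-- The parity of a tree after suspension. -/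
abbrev par (T : PTree m) : ℤ := T.deg + 1

/-- The exponent of the sign relating operations before and after suspension. -/
def susp : List (PTree m) → ℤ
  | [] => 0
  | T :: w => w.length * par T + susp w

theorem susp_append (x y : List (PTree m)) :
    susp (x ++ y) = susp x + y.length * Words.parity par x + susp y := by
  induction x with
  | nil => simp [susp, Words.parity]
  | cons T x ih =>
    simp only [List.cons_append, susp, List.length_append, Nat.cast_add, ih, Words.parity,
      List.map_cons, List.sum_cons]
    ring

variable (k) in
/-- The normal form of `ξ_j(T_1, …, T_j)` for a list of trees, or zero if there is no `ξ_j`. -/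
def opList (w : List (PTree m)) : PTree m →₀ k :=
  if h : 1 ≤ w.length ∧ (w.length : ℕ∞) ≤ m then op k ⟨w.length, h⟩ w.get else 0

theorem opList_ofFn (j : Ar m) (c : Fin j.1 → PTree m) : opList k (List.ofFn c) = op k j c := by
  have key : ∀ (w : List (PTree m)) (j : Ar m) (c : Fin j.1 → PTree m), w = List.ofFn c →
      opList k w = op k j c := by
    rintro w ⟨j, hj⟩ c h
    have hl : w.length = j := by rw [h, List.length_ofFn]
    subst hl
    rw [opList, dif_pos hj]
    congr 1
    exact List.ofFn_injective (by rw [← h]; exact List.ofFn_get w)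
  exact key _ j c rfl

variable (k) in
/-- The suspended operations. -/
def sop (w : List (PTree m)) : PTree m →₀ k := Int.negOnePow (susp w) • opList k w

theorem sop_nil : sop k ([] : List (PTree m)) = 0 := by simp [sop, opList]

theorem sum_ofFn (f : PTree m → ℤ) {n : ℕ} (c : Fin n → PTree m) :
    ((List.ofFn c).map f).sum = ∑ i, f (c i) := by
  rw [List.map_ofFn, List.sum_ofFn]; rfl

theorem parity_eq (w : List (PTree m)) :
    Words.parity par w = (w.map deg).sum + w.length := by
  induction w with
  | nil => simp [Words.parity]
  | cons T w ih =>
    simp only [Words.parity, List.map_cons, List.sum_cons, List.length_cons] at ih ⊢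
    rw [ih]; push_cast; ring

theorem deg_of_mem_opList (w : List (PTree m)) (U : PTree m) (hU : U ∈ (opList k w).support) :
    U.deg = Words.parity par w - 2 := by
  rw [opList] at hU
  split_ifs at hU with h
  · have := op_mem (k := k) ⟨w.length, h⟩ w.get
    rw [Finsupp.mem_supported] at this
    rw [(this hU).1, parity_eq]
    have e : ∑ i, (w.get i).deg = (w.map deg).sum := by
      rw [← sum_ofFn, List.ofFn_get]
    rw [e]
    ring
  · simp at hU

theorem support_units_smul {α : Type*} (e : ℤˣ) (x : α →₀ k) : (e • x).support = x.support := by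
  rcases Int.units_eq_one_or e with rfl | rfl
  · simp
  · simp [Units.smul_def]

/-- `ξ_j` has degree `j - 2`. Measuring every tree by `deg + 1` turns this into `-1` for all `j`, so
the suspended operations are uniformly odd. -/
theorem sop_odd (w : List (PTree m)) : ∀ U ∈ (sop k w).support,
    Int.negOnePow (par U) = Int.negOnePow (Words.parity par w + 1) := by
  intro U hU
  rw [sop, support_units_smul] at hU
  rw [par, deg_of_mem_opList w U hU, Int.negOnePow_eq_iff]
  exact ⟨-1, by ring⟩

theorem sum_take {n : ℕ} (c : Fin n → PTree m) (l : Fin n) :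
    Words.parity par ((List.ofFn c).take l.1) =
      ∑ i : Fin l.1, (c ⟨i.1, i.2.trans l.2⟩).deg + l.1 := by
  rw [parity_eq, ← sum_ofFn deg fun i : Fin l.1 => c ⟨i.1, i.2.trans l.2⟩]
  have : (List.ofFn c).take l.1 = List.ofFn fun i : Fin l.1 => c ⟨i.1, i.2.trans l.2⟩ := by
    have := ofFn_block c 0 l.1 (by omega)
    simpa using this.symm
  rw [this, List.length_ofFn]

theorem rel_one (n : Ar m) (h : n.1 = 1) (c : Fin n.1 → PTree m) (T : PTree m)
    (hT : c ⟨0, by omega⟩ = T) :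
    rel k n c = (-1 : ℤˣ) • Finsupp.linearCombination k (diff k) (diff k T) := by
  obtain ⟨n, hn⟩ := n
  obtain rfl : n = 1 := h
  rw [rel, ← hT]
  refine (Fin.sum_univ_one _).trans ((Fin.sum_univ_one _).trans ?_)
  congr 1

/-- The suspended relation. -/
theorem ext_sop_coder (n : Ar m) (c : Fin n.1 → PTree m) :
    Words.ext (sop k) (Words.coder par (sop k) (List.ofFn c)) =
      Int.negOnePow (n.1 + susp (List.ofFn c)) • rel k n c := by
  rw [Words.coder_eq_sum _ sop_nil, rel]
  simp only [List.length_ofFn, map_sum, Finset.smul_sum]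
  rw [← Fin.sum_univ_eq_sum_range (fun l => ∑ s ∈ Finset.range (n.1 - l), _)]
  refine Finset.sum_congr rfl fun l _ => ?_
  rw [← Fin.sum_univ_eq_sum_range (fun s => _)]
  refine Finset.sum_congr rfl fun s _ => ?_
  rw [map_intUnits_smul, sop, map_intUnits_smul, map_intUnits_smul, ← ofFn_block c l.1 (s.1 + 1) (by omega),
    opList_ofFn (n.lower (s.1 + 1) (by omega) (by omega))]
  set y := List.ofFn fun t : Fin (s.1 + 1) => c ⟨l.1 + t.1, by omega⟩ with hy
  have hylen : y.length = s.1 + 1 := by simp [y]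
  have h1 : ∀ x : PTree m →₀ k, Words.ext (sop k) (Finsupp.lmapDomain k k (fun U =>
      (List.ofFn c).take l.1 ++ U :: (List.ofFn c).drop (l.1 + (s.1 + 1))) x) =
      Finsupp.linearCombination k (fun U => sop k
        (List.ofFn (replaceBlock c l.1 (s.1 + 1) (n.1 - s.1) (by omega) (by omega) U))) x := by
    intro x
    rw [Words.ext, Finsupp.lmapDomain_apply, Finsupp.linearCombination_mapDomain]
    congr 2
    funext U
    rw [ofFn_replaceBlock]
    rfl
  -- All trees `U` in the inner result have the same degree, so the suspension sign of the outer
  -- word does not depend on `U` and leaves the sum.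
  rw [h1, linearCombination_congr_support (g := fun U => Int.negOnePow (
      susp ((List.ofFn c).take l.1) + (n.1 - l.1 - s.1) *
        Words.parity par ((List.ofFn c).take l.1) + (n.1 - l.1 - s.1 - 1) * (Words.parity par y - 1)
        + susp ((List.ofFn c).drop (l.1 + (s.1 + 1)))) •
      op k (n.lower (n.1 - s.1) (by omega) (by omega))
        (replaceBlock c l.1 (s.1 + 1) (n.1 - s.1) (by omega) (by omega) U)),
    linearCombination_units_smul]
  · simp only [← mul_smul]
    congr 1
    rw [Words.sgn, amSign, ← Int.negOnePow_add, ← Int.negOnePow_add, ← Int.negOnePow_add,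
      Int.negOnePow_eq_iff]
    have e1 : susp (List.ofFn c) = susp ((List.ofFn c).take l.1 ++ (y ++
        (List.ofFn c).drop (l.1 + (s.1 + 1)))) := by
      congr 1
      rw [hy, ofFn_block c l.1 (s.1 + 1) (by omega)]
      exact list_take_block_drop _ _ _
    rw [e1, susp_append, susp_append, List.length_append, hylen, List.length_drop, List.length_ofFn,
      sum_take, Nat.cast_add, Nat.cast_sub (show l.1 + (s.1 + 1) ≤ n.1 by omega)]
    push_cast
    set X := ∑ i : Fin l.1, (c ⟨i.1, i.2.trans l.2⟩).deg
    set Y := Words.parity par y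
    generalize (l.1 : ℤ) = l
    generalize (s.1 : ℤ) = s
    generalize (n.1 : ℤ) = n
    exact ⟨-s * X - l * s - n, by ring⟩
  · intro U hU
    have h2 : U.deg = Words.parity par y - 2 := by
      refine deg_of_mem_opList (k := k) y U ?_
      rwa [hy, opList_ofFn (n.lower (s.1 + 1) (by omega) (by omega))]
    rw [sop, opList_ofFn (n.lower (n.1 - s.1) (by omega) (by omega)), ofFn_replaceBlock, susp_append,
      susp, par, h2, List.length_cons, List.length_drop, List.length_ofFn, Nat.cast_add,
      Nat.cast_sub (show l.1 + (s.1 + 1) ≤ n.1 by omega)]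
    congr 2
    push_cast
    ring

/-- Up to sign `b ∘ B` on a word is the relation of that arity, which is known except in arity `1`;
there it is the extra hypothesis. The bound on the length guarantees that the arity is allowed. -/
theorem ext_sop_coder_eq_zero (v : List (PTree m)) (hv : (v.length : ℕ∞) ≤ m)
    (h : ∀ T, v = [T] → Finsupp.linearCombination k (diff k) (diff k T) = 0) :
    Words.ext (sop k) (Words.coder par (sop k) v) = 0 := by
  rcases Nat.eq_zero_or_pos v.length with h0 | h0
  · rw [List.length_eq_zero_iff.mp h0, Words.coder, map_zero]
  have key := ext_sop_coder (k := k) ⟨v.length, h0, hv⟩ v.get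
  rw [List.ofFn_get] at key
  rw [key]
  by_cases h1 : v.length = 1
  · obtain ⟨T, rfl⟩ := List.length_eq_one_iff.mp h1
    rw [rel_one _ rfl _ T (by rfl), h T rfl, smul_zero, smul_zero]
  · rw [rel_of_ne_one _ h1, smul_zero]

/-- The only relation not built into `diff`. It follows from the others, applied to the word `w` of
the subtrees at the root: `B (B w) = 0`, and the one-letter component of this identity contains
`diff (diff T)`. -/
theorem diff_diff (T : PTree m) : Finsupp.linearCombination k (diff k) (diff k T) = 0 := by
  induction T with
  | leaf =>
    rw [diff]
    split_ifs with h
    · rw [Finsupp.linearCombination_single, one_smul, diff, if_pos rfl]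
    · rw [map_zero]
  | node j c ih =>
    by_cases hj : j.1 = 1
    · rw [diff, if_pos hj, map_zero]
    have hj0 := j.2.1
    set w := List.ofFn c with hw
    have hwl : w.length = j.1 := by simp [hw]
    -- Factors of `w` have length at most `j ≤ m`, and a one-letter factor is a subtree at the root,
    -- to which the induction hypothesis applies.
    have hBB := Words.ext_coder_coder par sop_nil (sop_odd (k := k)) w fun v hv => by
      refine ext_sop_coder_eq_zero v ?_ ?_
      · exact (Nat.cast_le.mpr (hv.length_le.trans_eq hwl)).trans j.2.2
      · rintro T rfl
        obtain ⟨i, rfl⟩ : ∃ i, c i = T := by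
          have := hv.subset (List.mem_singleton_self T)
          rwa [hw, List.mem_ofFn] at this
        exact ih i
    have hQ := congrArg (Words.ext (sop k)) hBB
    rw [map_zero] at hQ
    -- Only the inner `B` is expanded, so that `b ∘ B` acts as a whole on each resulting word.
    conv_lhs at hQ => enter [2, 2]; rw [Words.coder_eq_sum _ sop_nil]
    simp only [map_sum, map_intUnits_smul] at hQ
    -- Contracting a proper block leaves a word of length `j - s ≥ 2`, on which `b ∘ B` vanishes
    -- whatever its letters are.
    have hterm : ∀ l s, l + (s + 1) ≤ j.1 → s + 1 ≠ j.1 → ∀ x : PTree m →₀ k,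
        Words.ext (sop k) (Words.ext (Words.coder par (sop k)) (Finsupp.lmapDomain k k (fun U =>
          w.take l ++ U :: w.drop (l + (s + 1))) x)) = 0 := by
      intro l s hl hs x
      induction x using Finsupp.induction_linear with
      | zero => simp
      | add x y hx hy => rw [map_add, map_add, map_add, hx, hy, add_zero]
      | single U a =>
        have hlen : (w.take l ++ U :: w.drop (l + (s + 1))).length = j.1 - s := by
          simp [hwl]; omega
        rw [Finsupp.lmapDomain_apply, Finsupp.mapDomain_single, Words.ext,
          Finsupp.linearCombination_single, map_smul, ext_sop_coder_eq_zero, smul_zero]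
        · rw [hlen]; exact (Nat.cast_le.mpr (Nat.sub_le _ _)).trans j.2.2
        · intro T hT
          rw [hT] at hlen
          simp at hlen
          omega
    -- Contracting all of `w` yields the one-letter word `node j c`, on which `b ∘ B` is `diff ∘
    -- diff`.
    rw [Finset.sum_eq_single 0, Finset.sum_eq_single (j.1 - 1)] at hQ
    · have h1 : j.1 - 1 + 1 = j.1 := by omega
      simp only [List.take_zero, Words.sgn_nil, one_smul, List.drop_zero, zero_add, h1,
        List.nil_append] at hQ
      rw [← hwl, List.take_length, List.drop_length, sop, hw, opList_ofFn, op_of_ne j hj,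
        map_intUnits_smul, map_intUnits_smul, map_intUnits_smul, Finsupp.lmapDomain_apply,
        Finsupp.mapDomain_single, Words.ext_of, Words.coder, Words.coder, Words.head, splitSum,
        splitSum, sop_nil] at hQ
      have h2 : (1 : ℕ) ≤ 1 ∧ ((1 : ℕ) : ℕ∞) ≤ m := ⟨le_rfl, (Nat.cast_le.mpr hj0).trans j.2.2⟩
      have h3 : ∀ T : PTree m, sop k [T] = diff k T := by
        intro T
        have := opList_ofFn (k := k) ⟨1, h2⟩ fun _ => T
        rw [op_one _ rfl _ ⟨0, Nat.one_pos⟩] at this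
        simpa [sop, susp] using this
      have h4 : ∀ x : PTree m →₀ k, Words.ext (sop k) (Words.push [] x) =
          Finsupp.linearCombination k (diff k) x := by
        intro x
        rw [Words.ext, Words.push, Finsupp.lmapDomain_apply, Finsupp.linearCombination_mapDomain]
        congr 2
        funext T
        exact h3 T
      rw [map_zero, map_zero, smul_zero, zero_add, zero_add, h4, h3] at hQ
      have := congrArg (fun z => Int.negOnePow (susp (List.ofFn c)) • z) hQ
      simpa only [smul_smul, Int.units_mul_self, one_smul, smul_zero] using this
    · intro s hs hs'
      rw [hterm 0 s (by simp [hwl] at hs; omega) (by omega), smul_zero]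
    · intro h; exact absurd (Finset.mem_range.mpr (by omega)) h
    · intro l hl hl'
      refine Finset.sum_eq_zero fun s hs => ?_
      rw [Finset.mem_range, hwl] at hs
      rw [hterm l s (by omega) (by omega), smul_zero]
    · intro h; exact absurd (Finset.mem_range.mpr (by omega)) h

/-- The `A(m)`-relation for normal forms. -/
theorem rel_eq_zero (n : Ar m) (c : Fin n.1 → PTree m) : rel k n c = 0 := by
  by_cases h : n.1 = 1
  · rw [rel_one n h c (c ⟨0, by omega⟩) rfl, diff_diff, smul_zero]
  · exact rel_of_ne_one n h c

end PTree
end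

noncomputable section

/-! ### Offsets of blocks -/

/-- The number of entries in the first `i` blocks, for blocks of lengths `n 0, …, n (j-1)`. -/
def blockStart {j : ℕ} (n : Fin j → ℕ) (i : ℕ) : ℕ := ∑ q with q.1 < i, n q

theorem sum_filter_lt_succ {M : Type*} [AddCommMonoid M] {j : ℕ} (f : Fin j → M) (i : Fin j) :
    ∑ q with q.1 < i.1 + 1, f q = ∑ q with q.1 < i.1, f q + f i := by
  have : (Finset.univ.filter fun q : Fin j => q.1 < i.1 + 1) =
      insert i (Finset.univ.filter fun q : Fin j => q.1 < i.1) := by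
    ext q
    simp only [Finset.mem_filter, Finset.mem_univ, true_and, Finset.mem_insert, Fin.ext_iff]
    omega
  rw [this, Finset.sum_insert (by simp), add_comm]

theorem sum_filter_lt_all {M : Type*} [AddCommMonoid M] {j : ℕ} (f : Fin j → M) :
    ∑ q with q.1 < j, f q = ∑ q, f q := by
  congr 1
  ext q
  simp

section blockStart

variable {j : ℕ} (n : Fin j → ℕ)

theorem blockStart_succ (i : Fin j) : blockStart n (i.1 + 1) = blockStart n i.1 + n i :=
  sum_filter_lt_succ n i

theorem blockStart_all : blockStart n j = ∑ i, n i := sum_filter_lt_all n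

theorem blockStart_mono {i i' : ℕ} (h : i ≤ i') : blockStart n i ≤ blockStart n i' :=
  Finset.sum_le_sum_of_subset fun q hq => by
    rw [Finset.mem_filter] at hq ⊢
    exact ⟨hq.1, hq.2.trans_le h⟩

theorem blockStart_add_lt {p : Fin j} {r : ℕ} (hr : r < n p) {i : ℕ} (hi : p.1 < i) :
    blockStart n p.1 + r < blockStart n i :=
  (by rw [blockStart_succ]; omega : blockStart n p.1 + r < blockStart n (p.1 + 1)).trans_le
    (blockStart_mono n hi)

theorem blockStart_add_lt_sum {p : Fin j} {r : ℕ} (hr : r < n p) :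
    blockStart n p.1 + r < ∑ i, n i := by
  rw [← blockStart_all]
  exact blockStart_add_lt n hr p.2

theorem finSigmaFinEquiv_val (x : (i : Fin j) × Fin (n i)) :
    (finSigmaFinEquiv x : ℕ) = blockStart n x.1.1 + x.2.1 := by
  rw [finSigmaFinEquiv_apply, blockStart]
  congr 1
  symm
  refine Finset.sum_bij' (fun q hq => ⟨q.1, (Finset.mem_filter.mp hq).2⟩)
    (fun q _ => Fin.castLE x.1.2.le q) ?_ ?_ ?_ ?_ ?_
  · intro q hq; exact Finset.mem_univ _
  · intro q hq; exact Finset.mem_filter.mpr ⟨Finset.mem_univ _, q.2⟩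
  · intro q hq; rfl
  · intro q hq; rfl
  · intro q hq; rfl

theorem exists_eq_blockStart_add {i : ℕ} (hi : i < ∑ i, n i) :
    ∃ (p : Fin j) (r : ℕ), r < n p ∧ i = blockStart n p.1 + r := by
  have := finSigmaFinEquiv_val n (finSigmaFinEquiv.symm ⟨i, hi⟩)
  rw [Equiv.apply_symm_apply] at this
  exact ⟨_, _, (finSigmaFinEquiv.symm ⟨i, hi⟩).2.2, this⟩

theorem sum_range_blockStart {M : Type*} [AddCommMonoid M] (d : ℕ → M) {i : ℕ} (hi : i ≤ j) :
    ∑ t ∈ Finset.range (blockStart n i), d t =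
      ∑ q with q.1 < i, ∑ t ∈ Finset.range (n q), d (blockStart n q.1 + t) := by
  induction i with
  | zero => simp [blockStart]
  | succ i ih =>
    rw [blockStart_succ n ⟨i, hi⟩, Finset.sum_range_add, ih (by omega),
      sum_filter_lt_succ _ (⟨i, hi⟩ : Fin j)]

theorem sum_range_sum {M : Type*} [AddCommMonoid M] (d : ℕ → M) :
    ∑ t ∈ Finset.range (∑ i, n i), d t =
      ∑ q, ∑ t ∈ Finset.range (n q), d (blockStart n q.1 + t) := by
  rw [← blockStart_all, sum_range_blockStart n d le_rfl, sum_filter_lt_all]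

theorem blockStart_update_le {p : Fin j} {i : ℕ} (hi : i ≤ p.1) (x : ℕ) :
    blockStart (Function.update n p x) i = blockStart n i :=
  Finset.sum_congr rfl fun q hq => by
    rw [Finset.mem_filter] at hq
    rw [Function.update_of_ne]
    rintro rfl
    omega

theorem blockStart_update_lt {p : Fin j} {i : ℕ} (hi : p.1 < i) (x : ℕ) :
    blockStart (Function.update n p x) i + n p = blockStart n i + x := by
  have hp : p ∈ Finset.univ.filter (fun q : Fin j => q.1 < i) := by simpa
  rw [blockStart, blockStart, ← Finset.add_sum_erase _ _ hp, ← Finset.add_sum_erase _ n hp,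
    Function.update_self]
  have : ∑ q ∈ (Finset.univ.filter (fun q : Fin j => q.1 < i)).erase p, Function.update n p x q =
      ∑ q ∈ (Finset.univ.filter (fun q : Fin j => q.1 < i)).erase p, n q :=
    Finset.sum_congr rfl fun q hq => by rw [Function.update_of_ne (Finset.ne_of_mem_erase hq)]
  omega

end blockStart

/-- The sequence obtained from `b` by replacing the block of `L` entries starting at `i`
by the single entry `x`. -/
def contract {A : Type*} (i L : ℕ) (b : ℕ → A) (x : A) : ℕ → A := fun t =>
  if t < i then b t else if t = i then x else b (t + L - 1)

theorem contract_eq_update {A : Type*} (i L : ℕ) (b : ℕ → A) (x y : A) :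
    contract i L b x = Function.update (contract i L b y) i x := by
  funext t
  simp only [contract, Function.update_apply]
  split_ifs <;> first | rfl | omega

theorem contract_shift {A : Type*} (i o L : ℕ) (b : ℕ → A) (x : A) (t : ℕ) :
    contract (o + i) L b x (o + t) = contract i L (fun t => b (o + t)) x t := by
  simp only [contract]
  split_ifs <;> first | rfl | omega | (congr 1; omega)

theorem sum_contract {M : Type*} [AddCommMonoid M] {i L N : ℕ} (hL : 0 < L) (hi : i < N)
    (d : ℕ → M) (x : M) :
    ∑ t ∈ Finset.range N, contract i L d x t + ∑ u ∈ Finset.range L, d (i + u) =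
      ∑ t ∈ Finset.range (N + L - 1), d t + x := by
  obtain ⟨K, rfl⟩ : ∃ K, N = i + 1 + K := ⟨N - (i + 1), by omega⟩
  rw [show i + 1 + K + L - 1 = i + L + K by omega, Finset.sum_range_add, Finset.sum_range_succ,
    Finset.sum_range_add _ (i + L), Finset.sum_range_add _ i]
  have h1 : ∑ t ∈ Finset.range i, contract i L d x t = ∑ t ∈ Finset.range i, d t :=
    Finset.sum_congr rfl fun t ht => if_pos (Finset.mem_range.mp ht)
  have h2 : contract i L d x i = x := by simp [contract]
  have h3 : ∑ t ∈ Finset.range K, contract i L d x (i + 1 + t) =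
      ∑ t ∈ Finset.range K, d (i + L + t) := Finset.sum_congr rfl fun t _ => by
    simp only [contract]
    rw [if_neg (by omega), if_neg (by omega)]
    congr 1
    omega
  rw [h1, h2, h3]
  abel

/-! ### The action of trees -/

namespace PTree

variable {m : ℕ∞}

theorem deg_graft (T : PTree m) (i : Fin T.leaves) (S : PTree m) :
    (T.graft i S).deg = T.deg + S.deg := by
  induction T with
  | leaf => simp [graft, deg]
  | node j c ih =>
    simp only [graft, deg]
    generalize (finSigmaFinEquiv (n := fun i => (c i).leaves)).symm i = p
    have h := ih p.1 p.2
    rw [← Finset.add_sum_erase _ _ (Finset.mem_univ p.1),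
      ← Finset.add_sum_erase Finset.univ (fun i => (c i).deg) (Finset.mem_univ p.1)]
    have h2 : ∑ x ∈ Finset.univ.erase p.1,
        (Function.update c p.1 ((c p.1).graft p.2 S) x).deg
        = ∑ x ∈ Finset.univ.erase p.1, (c x).deg :=
      Finset.sum_congr rfl fun x hx => by
        rw [Function.update_of_ne (Finset.ne_of_mem_erase hx)]
    rw [h2, Function.update_self, h]
    ring

/-- The position of the first leg of the `i`-th subtree. -/
abbrev start {j : ℕ} (c : Fin j → PTree m) (i : ℕ) : ℕ := blockStart (fun q => (c q).leaves) i

/-- The sum of the degrees of the trees after the `i`-th one. -/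
def degRight {j : ℕ} (c : Fin j → PTree m) (i : Fin j) : ℤ := ∑ q with i < q, (c q).deg

/-- Addresses a leg by a subtree and an offset in it, which replaces the equivalence
`finSigmaFinEquiv` by arithmetic on positions. -/
theorem graft_node {j : Ar m} (c : Fin j.1 → PTree m) (i : Fin (node j c).leaves) (p : Fin j.1)
    (r : Fin (c p).leaves) (h : i.1 = start c p.1 + r.1) (S : PTree m) :
    (node j c).graft i S = node j (Function.update c p ((c p).graft r S)) ∧
      (node j c).degAfter i = (c p).degAfter r + degRight c p := by
  have : (finSigmaFinEquiv (n := fun i => (c i).leaves)).symm i = ⟨p, r⟩ := by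
    refine (Equiv.symm_apply_eq _).mpr (Fin.ext ?_)
    exact h.trans (finSigmaFinEquiv_val (fun i => (c i).leaves) ⟨p, r⟩).symm
  constructor
  · simp only [graft]
    rw [this]
  · simp only [degAfter]
    rw [this]
    rfl

theorem exists_leg {j : Ar m} (c : Fin j.1 → PTree m) (i : Fin (node j c).leaves) :
    ∃ (p : Fin j.1) (r : Fin (c p).leaves), i.1 = start c p.1 + r.1 := by
  obtain ⟨p, r, hr, h⟩ := exists_eq_blockStart_add (fun q => (c q).leaves) i.2
  exact ⟨p, ⟨r, hr⟩, h⟩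

theorem degRight_update {j : ℕ} (c : Fin j → PTree m) (p q : Fin j) (S : PTree m) :
    degRight (Function.update c p S) q = degRight c q + if q < p then S.deg - (c p).deg else 0 := by
  simp only [degRight]
  split_ifs with h
  · have hp : p ∈ Finset.univ.filter (fun i : Fin j => q < i) := by simpa
    rw [← Finset.add_sum_erase _ _ hp, ← Finset.add_sum_erase _ (fun i => (c i).deg) hp,
      Function.update_self]
    have : ∑ i ∈ (Finset.univ.filter (fun i : Fin j => q < i)).erase p,
        (Function.update c p S i).deg =
        ∑ i ∈ (Finset.univ.filter (fun i : Fin j => q < i)).erase p, (c i).deg :=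
      Finset.sum_congr rfl fun q hq => by rw [Function.update_of_ne (Finset.ne_of_mem_erase hq)]
    rw [this]
    ring
  · rw [add_zero]
    refine Finset.sum_congr rfl fun i hi => ?_
    rw [Finset.mem_filter] at hi
    rw [Function.update_of_ne]
    rintro rfl
    exact h hi.2

theorem leaves_update {j : ℕ} (c : Fin j → PTree m) (p : Fin j) (S : PTree m) :
    (fun q => (Function.update c p S q).leaves) =
      Function.update (fun q => (c q).leaves) p S.leaves := by
  funext q
  simp only [Function.update_apply]
  split_ifs <;> rfl

theorem start_graft_of_le {j : ℕ} (c : Fin j → PTree m) (p : Fin j) (r : Fin (c p).leaves)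
    (S : PTree m) {q : Fin j} (hq : q ≤ p) :
    start (Function.update c p ((c p).graft r S)) q.1 = start c q.1 := by
  rw [start, leaves_update, blockStart_update_le _ hq]

/-- A contraction inside block `p` leaves the other blocks intact; those to its right are shifted by
`S.leaves - 1`, just as the starting positions change under grafting. -/
theorem contract_start {A : Type*} {j : ℕ} (c : Fin j → PTree m) (p : Fin j)
    (r : Fin (c p).leaves) (S : PTree m) (f : ℕ → A) (x : A) {q : Fin j} (hq : q ≠ p) {t : ℕ}
    (ht : t < (c q).leaves) :
    contract (start c p.1 + r.1) S.leaves f x (start c q.1 + t) =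
      f (start (Function.update c p ((c p).graft r S)) q.1 + t) := by
  rcases lt_or_gt_of_ne hq with hq | hq
  · rw [start_graft_of_le c p r S hq.le, contract, if_pos]
    have := blockStart_add_lt (fun q => (c q).leaves) (p := q) ht hq
    simp only [start]
    omega
  · have h1 := blockStart_add_lt (fun q => (c q).leaves) (p := p) r.2 hq
    have h2 := blockStart_update_lt (fun q => (c q).leaves) hq ((c p).graft r S).leaves
    have h3 := (c p).leaves_graft r S
    rw [← leaves_update] at h2
    simp only [start]
    rw [contract, if_neg (by omega), if_neg (by omega)]
    congr 1
    omega

section act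

variable {k : Type*} [CommRing k] {B : Type*} [AddCommGroup B] [Module k B]
variable (μ : ∀ j : Ar m, MultilinearMap k (fun _ : Fin j.1 => B) B)

/-- The value of a tree on a sequence `b` of elements of degrees `d`, with Koszul signs. -/
def act : PTree m → (ℕ → ℤ) → (ℕ → B) → B
  | leaf, _, b => b 0
  -- The sign moves the entries of each subtree past the subtrees to its right. Infinite sequences
  -- are used so that passing to a subtree is a mere shift. The degrees `d` are declared and not
  -- read off from `b`, which makes the value multilinear in `b`.
  | node j c, d, b =>
    Int.negOnePow (∑ i, degRight c i * ∑ t ∈ Finset.range (c i).leaves, d (start c i.1 + t)) •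
      μ j fun i => act (c i) (fun t => d (start c i.1 + t)) (fun t => b (start c i.1 + t))

theorem act_congr (T : PTree m) {d d' : ℕ → ℤ} {b b' : ℕ → B} (hd : ∀ t < T.leaves, d t = d' t)
    (hb : ∀ t < T.leaves, b t = b' t) : act μ T d b = act μ T d' b' := by
  induction T generalizing d d' b b' with
  | leaf => exact hb 0 Nat.one_pos
  | node j c ih =>
    simp only [act]
    have hlt : ∀ i, ∀ t < (c i).leaves, start c i.1 + t < (node j c).leaves := fun i t ht =>
      blockStart_add_lt_sum (fun q => (c q).leaves) ht
    congr 2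
    · refine Finset.sum_congr rfl fun i _ => congrArg _ (Finset.sum_congr rfl fun t ht => ?_)
      exact hd _ (hlt i t (Finset.mem_range.mp ht))
    · funext i
      exact ih i (fun t ht => hd _ (hlt i t ht)) (fun t ht => hb _ (hlt i t ht))

variable {μ} in
theorem act_mem {ℬ : ℤ → Submodule k B}
    (hμ : ∀ (j : Ar m) (d : Fin j.1 → ℤ) (a : Fin j.1 → B), (∀ i, a i ∈ ℬ (d i)) →
      μ j a ∈ ℬ ((∑ i, d i) + (j.1 - 2)))
    (T : PTree m) {d : ℕ → ℤ} {b : ℕ → B} (hb : ∀ t < T.leaves, b t ∈ ℬ (d t)) :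
    act μ T d b ∈ ℬ (T.deg + ∑ t ∈ Finset.range T.leaves, d t) := by
  induction T generalizing d b with
  | leaf => simpa [act, deg, leaves] using hb 0 Nat.one_pos
  | node j c ih =>
    rw [act, Units.smul_def]
    refine zsmul_mem ?_ _
    convert! hμ j _ _ fun i => ih i (d := fun t => d (start c i.1 + t))
      (b := fun t => b (start c i.1 + t)) fun t ht =>
      hb _ (blockStart_add_lt_sum (fun q => (c q).leaves) ht) using 2
    rw [deg, Finset.sum_add_distrib, leaves, sum_range_sum]
    ring

theorem act_node_update {j : Ar m} (c : Fin j.1 → PTree m) (p : Fin j.1) {r : ℕ}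
    (hr : r < (c p).leaves) (d : ℕ → ℤ) (b : ℕ → B) (x : B) :
    act μ (node j c) d (Function.update b (start c p.1 + r) x) =
      Int.negOnePow (∑ i, degRight c i * ∑ t ∈ Finset.range (c i).leaves, d (start c i.1 + t)) •
      μ j (Function.update
        (fun i => act μ (c i) (fun t => d (start c i.1 + t)) (fun t => b (start c i.1 + t))) p
        (act μ (c p) (fun t => d (start c p.1 + t))
          (Function.update (fun t => b (start c p.1 + t)) r x))) := by
  rw [act]
  congr 2
  funext q
  by_cases hq : q = p
  · subst hq
    rw [Function.update_self]
    congr 1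
    funext t
    simp only [Function.update_apply, Nat.add_left_cancel_iff]
  · rw [Function.update_of_ne hq]
    refine act_congr μ _ (fun _ _ => rfl) fun t ht => ?_
    rw [Function.update_of_ne]
    intro h
    have h1 := finSigmaFinEquiv_val (fun q => (c q).leaves) ⟨q, t, ht⟩
    have h2 := finSigmaFinEquiv_val (fun q => (c q).leaves) ⟨p, r, hr⟩
    have h3 := finSigmaFinEquiv.injective (Fin.ext (h1.trans (h.trans h2.symm)))
    exact hq (congrArg Sigma.fst h3)

theorem act_update_add (T : PTree m) {i : ℕ} (hi : i < T.leaves) (d : ℕ → ℤ) (b : ℕ → B)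
    (x y : B) : act μ T d (Function.update b i (x + y)) =
      act μ T d (Function.update b i x) + act μ T d (Function.update b i y) := by
  induction T generalizing i d b with
  | leaf =>
    obtain rfl : i = 0 := by simp [leaves] at hi; exact hi
    simp [act]
  | node j c ih =>
    obtain ⟨p, r, hr, rfl⟩ := exists_eq_blockStart_add (fun q => (c q).leaves) hi
    rw [act_node_update μ c p hr, act_node_update μ c p hr, act_node_update μ c p hr, ih p hr,
      MultilinearMap.map_update_add, smul_add]

theorem act_update_smul (T : PTree m) {i : ℕ} (hi : i < T.leaves) (d : ℕ → ℤ) (b : ℕ → B)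
    (a : k) (x : B) : act μ T d (Function.update b i (a • x)) =
      a • act μ T d (Function.update b i x) := by
  induction T generalizing i d b with
  | leaf =>
    obtain rfl : i = 0 := by simp [leaves] at hi; exact hi
    simp [act]
  | node j c ih =>
    obtain ⟨p, r, hr, rfl⟩ := exists_eq_blockStart_add (fun q => (c q).leaves) hi
    rw [act_node_update μ c p hr, act_node_update μ c p hr, ih p hr,
      MultilinearMap.map_update_smul, smul_comm]

/-- The value of a tree as a linear function of its `i`-th entry. -/
def actLinear (T : PTree m) {i : ℕ} (hi : i < T.leaves) (d : ℕ → ℤ) (b : ℕ → B) : B →ₗ[k] B where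
  toFun x := act μ T d (Function.update b i x)
  map_add' := act_update_add μ T hi d b
  map_smul' := act_update_smul μ T hi d b

theorem map_update_intUnits_smul {j : ℕ} (f : MultilinearMap k (fun _ : Fin j => B) B)
    (a : Fin j → B) (p : Fin j) (e : ℤˣ) (x : B) :
    f (Function.update a p (e • x)) = e • f (Function.update a p x) :=
  map_intUnits_smul (f.toLinearMap a p) e x

/-- The declared degree of an entry enters only through signs, linearly in the exponent, with
coefficient the total degree to the right of the entry along its path to the root. That the
coefficient does not depend on `b` allows inhomogeneous elements to be inserted. -/
theorem exists_act_shift (T : PTree m) {i : ℕ} (hi : i < T.leaves) (d : ℕ → ℤ) :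
    ∃ C : ℤ, ∀ (e K : ℤ) (b : ℕ → B), act μ T (Function.update d i (e + K)) b =
      Int.negOnePow (e * C) • act μ T (Function.update d i K) b := by
  induction T generalizing i d with
  | leaf => exact ⟨0, fun e K b => by simp [act]⟩
  | node j c ih =>
    obtain ⟨p, r, hr, rfl⟩ := exists_eq_blockStart_add (fun q => (c q).leaves) hi
    obtain ⟨C, hC⟩ := ih p hr fun t => d (start c p.1 + t)
    refine ⟨C + degRight c p, fun e K b => ?_⟩
    have hne : ∀ q, q ≠ p → ∀ t < (c q).leaves, start c q.1 + t ≠ start c p.1 + r := by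
      intro q hq t ht h
      have h1 := finSigmaFinEquiv_val (fun q => (c q).leaves) ⟨q, t, ht⟩
      have h2 := finSigmaFinEquiv_val (fun q => (c q).leaves) ⟨p, r, hr⟩
      have h3 := finSigmaFinEquiv.injective (Fin.ext (h1.trans (h.trans h2.symm)))
      exact hq (congrArg Sigma.fst h3)
    have hp : ∀ x, (fun t => Function.update d (start c p.1 + r) x (start c p.1 + t)) =
        Function.update (fun t => d (start c p.1 + t)) r x := by
      intro x
      funext t
      simp only [Function.update_apply, Nat.add_left_cancel_iff]
    simp only [act]
    have h1 : (fun i : Fin j.1 => act μ (c i)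
        (fun t => Function.update d (start c p.1 + r) (e + K) (start c i.1 + t))
        (fun t => b (start c i.1 + t))) = Function.update (fun i : Fin j.1 => act μ (c i)
        (fun t => Function.update d (start c p.1 + r) K (start c i.1 + t))
        (fun t => b (start c i.1 + t))) p (Int.negOnePow (e * C) • act μ (c p)
        (fun t => Function.update d (start c p.1 + r) K (start c p.1 + t))
        (fun t => b (start c p.1 + t))) := by
      funext q
      by_cases hq : q = p
      · subst hq
        rw [Function.update_self, hp, hp, hC]
      · rw [Function.update_of_ne hq]
        refine act_congr μ _ (fun t ht => ?_) fun _ _ => rfl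
        rw [Function.update_of_ne (hne q hq t ht), Function.update_of_ne (hne q hq t ht)]
    have h2 : ∀ q, ∑ t ∈ Finset.range (c q).leaves,
        Function.update d (start c p.1 + r) (e + K) (start c q.1 + t) =
        ∑ t ∈ Finset.range (c q).leaves,
        Function.update d (start c p.1 + r) K (start c q.1 + t) + if q = p then e else 0 := by
      intro q
      by_cases hq : q = p
      · subst hq
        have h3 : ∀ x, ∑ t ∈ Finset.range (c q).leaves,
            Function.update d (start c q.1 + r) x (start c q.1 + t) =
            x + ∑ t ∈ (Finset.range (c q).leaves).erase r, d (start c q.1 + t) := by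
          intro x
          rw [← Finset.add_sum_erase _ _ (Finset.mem_range.mpr hr), Function.update_self]
          congr 1
          refine Finset.sum_congr rfl fun t ht => ?_
          rw [Function.update_of_ne]
          have := Finset.ne_of_mem_erase ht
          omega
        rw [h3, h3, if_pos rfl]
        ring
      · rw [if_neg hq, add_zero]
        refine Finset.sum_congr rfl fun t ht => ?_
        rw [Finset.mem_range] at ht
        rw [Function.update_of_ne (hne q hq t ht), Function.update_of_ne (hne q hq t ht)]
    rw [h1, map_update_intUnits_smul, Function.update_eq_self, smul_smul, smul_smul,
      ← Int.negOnePow_add, ← Int.negOnePow_add]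
    congr 2
    simp only [h2, mul_add, Finset.sum_add_distrib, mul_ite, mul_zero, Finset.sum_ite_eq',
      Finset.mem_univ, if_true]
    ring

/-- The action is compatible with grafting. -/
theorem act_graft (T : PTree m) (i : Fin T.leaves) (S : PTree m) (d : ℕ → ℤ) (b : ℕ → B) :
    act μ (T.graft i S) d b =
      Int.negOnePow (S.deg * (T.degAfter i + ∑ t ∈ Finset.range i.1, d t)) •
        act μ T (contract i.1 S.leaves d (S.deg + ∑ t ∈ Finset.range S.leaves, d (i.1 + t)))
          (contract i.1 S.leaves b (act μ S (fun t => d (i.1 + t)) fun t => b (i.1 + t))) := by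
  induction T generalizing d b with
  | leaf =>
    obtain ⟨i, hi⟩ := i
    obtain rfl : i = 0 := by simp [leaves] at hi; exact hi
    simp [graft, act, degAfter, contract]
  | node j c ih =>
    obtain ⟨p, r, h⟩ := exists_leg c i
    obtain ⟨hg, hd⟩ := graft_node c i p r h S
    have hL := S.leaves_pos
    rw [hg, hd, h]
    set c' := Function.update c p ((c p).graft r S) with hc'
    set D := contract (start c p.1 + r.1) S.leaves d
      (S.deg + ∑ t ∈ Finset.range S.leaves, d (start c p.1 + r.1 + t)) with hD
    set b' := contract (start c p.1 + r.1) S.leaves b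
      (act μ S (fun t => d (start c p.1 + r.1 + t)) fun t => b (start c p.1 + r.1 + t)) with hb'
    have hcp : c' p = (c p).graft r S := Function.update_self _ _ _
    have hcq : ∀ q, q ≠ p → c' q = c q := fun q hq => Function.update_of_ne hq _ _
    have hstart : start c' p.1 = start c p.1 := start_graft_of_le c p r S le_rfl
    have hDp : (fun t => D (start c p.1 + t)) = contract r.1 S.leaves (fun t => d (start c p.1 + t))
        (S.deg + ∑ t ∈ Finset.range S.leaves, d (start c p.1 + (r.1 + t))) := by
      funext t
      simp only [hD, contract_shift, add_assoc]
    -- The contracted entry carries the degrees of its inputs plus `S.deg`; hence the correction in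
    -- block `p` and in no other.
    have hsum : ∀ q, ∑ t ∈ Finset.range (c' q).leaves, d (start c' q.1 + t) =
        ∑ t ∈ Finset.range (c q).leaves, D (start c q.1 + t) - if q = p then S.deg else 0 := by
      intro q
      by_cases hq : q = p
      · subst hq
        have h1 := congrFun hDp
        have h2 := sum_contract hL r.2 (fun t => d (start c q.1 + t))
          (S.deg + ∑ t ∈ Finset.range S.leaves, d (start c q.1 + (r.1 + t)))
        have h3 : (c' q).leaves = (c q).leaves + S.leaves - 1 := by
          rw [hcp]
          have := (c q).leaves_graft r S
          omega
        simp only [h1, if_true, h3, hstart]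
        linarith
      · rw [if_neg hq, sub_zero, hcq q hq]
        refine Finset.sum_congr rfl fun t ht => ?_
        rw [hD, contract_start c p r S _ _ hq (Finset.mem_range.mp ht)]
    have hact : (fun q : Fin j.1 => act μ (c' q) (fun t => d (start c' q.1 + t))
        (fun t => b (start c' q.1 + t))) = Function.update (fun q : Fin j.1 => act μ (c q)
        (fun t => D (start c q.1 + t)) (fun t => b' (start c q.1 + t))) p
        (Int.negOnePow (S.deg * ((c p).degAfter r +
          ∑ t ∈ Finset.range r.1, d (start c p.1 + t))) • act μ (c p)
        (fun t => D (start c p.1 + t)) (fun t => b' (start c p.1 + t))) := by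
      funext q
      by_cases hq : q = p
      · subst hq
        rw [Function.update_self, hcp, hstart, ih, hDp]
        congr 2
        funext t
        simp only [hb', contract_shift, add_assoc]
      · rw [Function.update_of_ne hq, hcq q hq]
        refine act_congr μ _ (fun t ht => ?_) fun t ht => ?_
        · rw [hD, contract_start c p r S _ _ hq ht]
        · rw [hb', contract_start c p r S _ _ hq ht]
    have hlow : ∑ q with q.1 < p.1, ∑ t ∈ Finset.range (c' q).leaves, d (start c' q.1 + t) =
        ∑ t ∈ Finset.range (start c p.1), d t := by
      rw [← hstart, start, sum_range_blockStart _ _ p.2.le]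
    have hright : ∀ q, degRight c' q = degRight c q + if q.1 < p.1 then S.deg else 0 := by
      intro q
      rw [hc', degRight_update, deg_graft, add_sub_cancel_left]
      rfl
    rw [act, act, hact, map_update_intUnits_smul, Function.update_eq_self, smul_smul, smul_smul,
      ← Int.negOnePow_add, ← Int.negOnePow_add]
    congr 1
    rw [Int.negOnePow_eq_iff]
    simp only [hright, add_mul, ite_mul, zero_mul, Finset.sum_add_distrib, ← Finset.sum_filter,
      ← Finset.mul_sum, hlow]
    simp only [hsum, mul_sub, Finset.sum_sub_distrib, mul_ite, mul_zero, Finset.sum_ite_eq',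
      Finset.mem_univ, if_true, Finset.sum_range_add]
    exact ⟨-degRight c p * S.deg, by ring⟩

end act
end PTree
end

noncomputable section

/-! ### The relations act as zero -/

namespace AmStructure

open PTree

variable {k : Type u} [CommRing k] {m : ℕ∞} {B : Type v} [AddCommGroup B] [Module k B]
variable {ℬ : ℤ → Submodule k B} (S : AmStructure k m ℬ)

/-- The action of the free operad on homogeneous sequences, with an additional twist by the
parity `ε`. -/
def actFree {n : ℕ} (ε : ℤ) (d : ℕ → ℤ) (b : ℕ → B) : FreeOp k m n →ₗ[k] B :=
  Finsupp.linearCombination k fun T : Tr m n => Int.negOnePow (ε * T.1.deg) • act S.μ T.1 d b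

theorem actFree_single {n : ℕ} (ε : ℤ) (d : ℕ → ℤ) (b : ℕ → B) (T : Tr m n) :
    S.actFree ε d b (Finsupp.single T 1) = Int.negOnePow (ε * T.1.deg) • act S.μ T.1 d b := by
  rw [actFree, Finsupp.linearCombination_single, one_smul]

/-- The elements of the free operad acting as zero. -/
def annihilator (n : ℕ) : Submodule k (FreeOp k m n) :=
  ⨅ (ε : ℤ) (d : ℕ → ℤ) (b : ℕ → B) (_ : ∀ t < n, b t ∈ ℬ (d t)), LinearMap.ker (S.actFree ε d b)

theorem mem_annihilator {n : ℕ} {f : FreeOp k m n} : f ∈ S.annihilator n ↔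
    ∀ (ε : ℤ) (d : ℕ → ℤ) (b : ℕ → B), (∀ t < n, b t ∈ ℬ (d t)) → S.actFree ε d b f = 0 := by
  simp only [annihilator, Submodule.mem_iInf, LinearMap.mem_ker]

theorem circ_single {a b c : ℕ} (h : c + 1 = a + b) (i : Fin a) (T : Tr m a) (U : Tr m b) :
    FreeOp.circ k h i (Finsupp.single T 1) (Finsupp.single U 1) =
      Int.negOnePow (U.1.deg * T.1.degAfter (Fin.cast T.2.symm i)) •
        Finsupp.single (Tr.graft h T i U) (1 : k) := by
  simp [FreeOp.circ]

theorem actFree_circ {a b c : ℕ} (h : c + 1 = a + b) (i : Fin a) (T : Tr m a) (U : Tr m b)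
    (ε : ℤ) (d : ℕ → ℤ) (x : ℕ → B) :
    S.actFree ε d x (FreeOp.circ k h i (Finsupp.single T 1) (Finsupp.single U 1)) =
      Int.negOnePow (ε * T.1.deg + ε * U.1.deg + U.1.deg * ∑ t ∈ Finset.range i.1, d t) •
        act S.μ T.1 (contract i.1 b d (U.1.deg + ∑ t ∈ Finset.range b, d (i.1 + t)))
          (contract i.1 b x (act S.μ U.1 (fun t => d (i.1 + t)) fun t => x (i.1 + t))) := by
  obtain ⟨T, rfl⟩ := T
  obtain ⟨U, rfl⟩ := U
  rw [circ_single, map_intUnits_smul, actFree_single]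
  simp only [Tr.graft]
  rw [act_graft, deg_graft, smul_smul, smul_smul, ← Int.negOnePow_add, ← Int.negOnePow_add]
  congr 1
  rw [Int.negOnePow_eq_iff]
  exact ⟨U.deg * T.degAfter i, by simp only [Fin.cast_refl, id_eq]; ring⟩

theorem mem_contract {i a b c : ℕ} (h : c + 1 = a + b) (hi : i < a) {d : ℕ → ℤ} {x : ℕ → B}
    (hx : ∀ t < c, x t ∈ ℬ (d t)) (U : PTree m) (hU : U.leaves = b) :
    ∀ t < a, contract i b x (act S.μ U (fun t => d (i + t)) fun t => x (i + t)) t ∈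
      ℬ (contract i b d (U.deg + ∑ t ∈ Finset.range b, d (i + t)) t) := by
  subst hU
  have hb := U.leaves_pos
  intro t ht
  simp only [contract]
  split_ifs
  · exact hx _ (by omega)
  · exact act_mem S.degree U fun t ht => hx _ (by omega)
  · exact hx _ (by omega)

/-- Acting with a composite means acting on a contracted sequence. If the left factor annihilates,
the additional signs are independent of its trees. If the right factor annihilates, they vary with
the degree of its trees, so an inhomogeneous element could be affected; the twist by `ε` in the
definition of the annihilator covers exactly these variations. -/
theorem isIdeal_annihilator : FreeOp.IsIdeal k S.annihilator := by
  intro a b c h i f g hfg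
  rw [mem_annihilator]
  intro ε d x hx
  rcases hfg with hf | hg
  · rw [mem_annihilator] at hf
    induction g using Finsupp.induction_linear with
    | zero => simp
    | add g g' hg hg' => rw [map_add, map_add, hg, hg', add_zero]
    | single U r =>
      rw [← Finsupp.smul_single_one, map_smul, map_smul]
      have key : S.actFree ε d x ∘ₗ (FreeOp.circ k h i).flip (Finsupp.single U 1) =
          (Int.negOnePow (ε * U.1.deg + U.1.deg * ∑ t ∈ Finset.range i.1, d t) : ℤ) •
          S.actFree ε (contract i.1 b d (U.1.deg + ∑ t ∈ Finset.range b, d (i.1 + t)))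
            (contract i.1 b x (act S.μ U.1 (fun t => d (i.1 + t)) fun t => x (i.1 + t))) := by
        refine Finsupp.lhom_ext' fun T => LinearMap.ext_ring ?_
        simp only [LinearMap.comp_apply, LinearMap.flip_apply, Finsupp.lsingle_apply,
          LinearMap.smul_apply, actFree_circ, actFree_single, ← Units.smul_def, smul_smul,
          ← Int.negOnePow_add]
        congr 2
        ring
      have := LinearMap.congr_fun key f
      simp only [LinearMap.comp_apply, LinearMap.flip_apply, LinearMap.smul_apply] at this
      rw [this, hf _ _ _ (S.mem_contract h i.2 hx U.1 U.2), smul_zero, smul_zero]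
  · rw [mem_annihilator] at hg
    induction f using Finsupp.induction_linear with
    | zero => simp
    | add f f' hf hf' => rw [map_add, LinearMap.add_apply, map_add, hf, hf', add_zero]
    | single T r =>
      rw [← Finsupp.smul_single_one, map_smul, LinearMap.smul_apply, map_smul]
      have hi : i.1 < T.1.leaves := by rw [T.2]; exact i.2
      obtain ⟨C, hC⟩ := exists_act_shift S.μ T.1 hi (contract i.1 b d 0)
      set K := ∑ t ∈ Finset.range b, d (i.1 + t) with hK
      -- Three signs depend on the degree of `U`: the old twist, the passage across the entries left
      -- of the leg, and the declared degree of the inserted entry. Together they form the new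
      -- twist.
      have key : S.actFree ε d x ∘ₗ FreeOp.circ k h i (Finsupp.single T 1) =
          (Int.negOnePow (ε * T.1.deg) : ℤ) •
          actLinear S.μ T.1 hi (Function.update (contract i.1 b d 0) i.1 K) (contract i.1 b x 0) ∘ₗ
          S.actFree (ε + ∑ t ∈ Finset.range i.1, d t + C) (fun t => d (i.1 + t))
            (fun t => x (i.1 + t)) := by
        refine Finsupp.lhom_ext' fun U => LinearMap.ext_ring ?_
        simp only [LinearMap.comp_apply, Finsupp.lsingle_apply,
          LinearMap.smul_apply, actFree_circ, actFree_single, ← Units.smul_def,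
          map_intUnits_smul]
        rw [contract_eq_update i.1 b d _ 0, hC, contract_eq_update i.1 b x _ 0, smul_smul,
          smul_smul, ← Int.negOnePow_add, ← Int.negOnePow_add]
        simp only [actLinear, LinearMap.coe_mk, AddHom.coe_mk]
        congr 2
        ring
      have := LinearMap.congr_fun key g
      simp only [LinearMap.comp_apply, LinearMap.smul_apply] at this
      rw [this, hg _ _ _ fun t ht => hx _ (by omega), map_zero, smul_zero, smul_zero]

theorem act_corolla (j : Ar m) (d : ℕ → ℤ) (b : ℕ → B) :
    act S.μ (Tr.corolla j).1 d b = S.μ j fun i => b i.1 := by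
  have h1 : ∀ i : ℕ, i ≤ j.1 → start (fun _ : Fin j.1 => (leaf : PTree m)) i = i := by
    intro i hi
    induction i with
    | zero => simp [blockStart]
    | succ i ih => rw [start, blockStart_succ _ (⟨i, hi⟩ : Fin j.1)]; exact congrArg (· + 1) (ih (by omega))
  simp only [Tr.corolla, act]
  have h2 : ∀ i, degRight (fun _ : Fin j.1 => (leaf : PTree m)) i = 0 := fun i => by
    simp [degRight, deg]
  simp only [h2, zero_mul, Finset.sum_const_zero, Int.negOnePow_zero, one_smul]
  congr 1
  funext i
  rw [h1 _ i.2.le, add_zero]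

theorem deg_corolla (j : Ar m) : (Tr.corolla j).1.deg = j.1 - 2 := by
  simp [Tr.corolla, deg]

theorem rel' (n : Ar m) (d : Fin n.1 → ℤ) (a : Fin n.1 → B) (ha : ∀ i, a i ∈ ℬ (d i)) :
    ∑ l : Fin n.1, ∑ s : Fin (n.1 - l.1), amSign d l (s.1 + 1) •
      S.μ (n.lower (n.1 - s.1) (by omega) (by omega))
        (replaceBlock a l.1 (s.1 + 1) (n.1 - s.1) (by omega) (by omega)
          (S.μ (n.lower (s.1 + 1) (by omega) (by omega))
            (fun t : Fin (s.1 + 1) => a ⟨l.1 + t.1, by omega⟩))) = 0 :=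
  S.rel n d a ha

theorem Φ_eq (n : Ar m) : FreeOp.Φ k n = ∑ l : Fin n.1, ∑ s : Fin (n.1 - l.1),
    Int.negOnePow (((l.1 * ((s.1 + 1) + 1) + (s.1 + 1) : ℕ) : ℤ)) •
      FreeOp.circ k (a := n.1 - s.1) (b := s.1 + 1) (c := n.1) (by omega) ⟨l.1, by omega⟩
        (Finsupp.single (Tr.corolla (n.lower (n.1 - s.1) (by omega) (by omega))) 1)
        (Finsupp.single (Tr.corolla (n.lower (s.1 + 1) (by omega) (by omega))) 1) := rfl

/-- `Φ_n` is homogeneous of degree `n - 3`, so the twist is a global sign. What is left is the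
`A(m)`-axiom, since `k` and `k - 2` have the same parity. -/
theorem Φ_mem_annihilator (n : Ar m) : FreeOp.Φ k n ∈ S.annihilator n.1 := by
  rw [mem_annihilator]
  intro ε d b hb
  have key := S.rel' n (fun i => d i.1) (fun i => b i.1) fun i => hb _ i.2
  rw [Φ_eq]
  simp only [map_sum, map_intUnits_smul]
  have key' := congrArg (fun z => Int.negOnePow (ε * (n.1 - 3)) • z) key
  simp only [smul_zero, Finset.smul_sum] at key'
  rw [← key']
  refine Finset.sum_congr rfl fun l _ => Finset.sum_congr rfl fun s _ => ?_
  rw [actFree_circ, act_corolla, act_corolla, deg_corolla, deg_corolla, smul_smul, smul_smul,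
    amSign, ← Int.negOnePow_add, ← Int.negOnePow_add]
  congr 1
  rw [Int.negOnePow_eq_iff, ← Fin.sum_univ_eq_sum_range d]
  simp only [Nat.cast_sub (show s.1 ≤ n.1 by omega)]
  push_cast
  exact ⟨-∑ i : Fin l.1, d i.1, by ring⟩

/-- Every `A(m)`-algebra is thus acted upon by the quotient operad. The linear independence of
admissible trees and the existence of extensions both rest on this. -/
theorem relIdeal_le_annihilator (n : ℕ) : relIdeal k m n ≤ S.annihilator n :=
  sInf_le ⟨S.annihilator, S.isIdeal_annihilator, S.Φ_mem_annihilator, rfl⟩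

end AmStructure
end

noncomputable section

/-! ### Classes of trees in the operad -/

section Classes

open PTree

variable {k : Type u} [CommRing k] {m : ℕ∞}

theorem isIdeal_relIdeal : FreeOp.IsIdeal k (relIdeal k m) := by
  intro a b c h i f g hfg
  rw [relIdeal, Submodule.mem_sInf]
  rintro _ ⟨J, hJ, hΦ, rfl⟩
  refine hJ a b c h i f g (hfg.imp ?_ ?_) <;> intro hf <;>
    exact (Submodule.mem_sInf.mp hf) _ ⟨J, hJ, hΦ, rfl⟩

theorem Φ_mem_relIdeal (n : Ar m) : FreeOp.Φ k n ∈ relIdeal k m n.1 := by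
  rw [relIdeal, Submodule.mem_sInf]
  rintro _ ⟨J, hJ, hΦ, rfl⟩
  exact hΦ n

namespace AmOp

variable (k) in
/-- The class of a tree in arity `n`, or zero if the tree does not have `n` legs. -/
def cls (n : ℕ) (T : PTree m) : AmOp k m n :=
  if h : T.leaves = n then AmOp.ofTree k ⟨T, h⟩ else 0

theorem cls_of_eq {n : ℕ} {T : PTree m} (h : T.leaves = n) : cls k n T = AmOp.ofTree k ⟨T, h⟩ :=
  dif_pos h

theorem cls_of_ne {n : ℕ} {T : PTree m} (h : T.leaves ≠ n) : cls k n T = 0 := dif_neg h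

theorem cls_val {n : ℕ} (T : Tr m n) : cls k n T.1 = AmOp.ofTree k T := cls_of_eq T.2

variable (k) in
/-- The class of a linear combination of trees. -/
def clsL (n : ℕ) : (PTree m →₀ k) →ₗ[k] AmOp k m n := Finsupp.linearCombination k (cls k n)

theorem clsL_single (n : ℕ) (T : PTree m) : clsL k n (Finsupp.single T 1) = cls k n T := by
  rw [clsL, Finsupp.linearCombination_single, one_smul]

/-- Composition with a tree from the right. -/
def compRight {a b c : ℕ} (h : c + 1 = a + b) (i : Fin a) (S : Tr m b) :
    AmOp k m a →ₗ[k] AmOp k m c :=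
  Submodule.liftQ _ ((relIdeal k m c).mkQ ∘ₗ (FreeOp.circ k h i).flip (Finsupp.single S 1))
    fun f hf => by
      rw [LinearMap.mem_ker, LinearMap.comp_apply, Submodule.mkQ_apply,
        Submodule.Quotient.mk_eq_zero]
      exact isIdeal_relIdeal _ _ _ h i _ _ (Or.inl hf)

/-- Composition with a tree from the left. -/
def compLeft {a b c : ℕ} (h : c + 1 = a + b) (i : Fin a) (T : Tr m a) :
    AmOp k m b →ₗ[k] AmOp k m c :=
  Submodule.liftQ _ ((relIdeal k m c).mkQ ∘ₗ FreeOp.circ k h i (Finsupp.single T 1))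
    fun f hf => by
      rw [LinearMap.mem_ker, LinearMap.comp_apply, Submodule.mkQ_apply,
        Submodule.Quotient.mk_eq_zero]
      exact isIdeal_relIdeal _ _ _ h i _ _ (Or.inr hf)

theorem mkQ_circ {a b c : ℕ} (h : c + 1 = a + b) (i : Fin a) (T : Tr m a) (S : Tr m b) :
    (relIdeal k m c).mkQ (FreeOp.circ k h i (Finsupp.single T 1) (Finsupp.single S 1)) =
      Int.negOnePow (S.1.deg * T.1.degAfter (Fin.cast T.2.symm i)) •
        cls k c (T.1.graft (Fin.cast T.2.symm i) S.1) := by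
  rw [AmStructure.circ_single, map_intUnits_smul]
  congr 1
  exact (cls_val (Tr.graft h T i S)).symm

theorem compRight_cls {a b c : ℕ} (h : c + 1 = a + b) (i : Fin a) (S : Tr m b) (T : PTree m)
    (hT : T.leaves = a) : compRight (k := k) h i S (cls k a T) =
      Int.negOnePow (S.1.deg * T.degAfter (Fin.cast hT.symm i)) •
        cls k c (T.graft (Fin.cast hT.symm i) S.1) := by
  rw [cls_of_eq hT]
  exact mkQ_circ h i ⟨T, hT⟩ S

theorem compLeft_cls {a b c : ℕ} (h : c + 1 = a + b) (i : Fin a) (T : Tr m a) (S : PTree m)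
    (hS : S.leaves = b) : compLeft (k := k) h i T (cls k b S) =
      Int.negOnePow (S.deg * T.1.degAfter (Fin.cast T.2.symm i)) •
        cls k c (T.1.graft (Fin.cast T.2.symm i) S) := by
  rw [cls_of_eq hS]
  exact mkQ_circ h i T ⟨S, hS⟩

theorem graft_of_eq_leaf {T : PTree m} (h : T = leaf) (i : Fin T.leaves) (S : PTree m) :
    T.graft i S = S ∧ T.degAfter i = 0 := by
  subst h
  exact ⟨rfl, rfl⟩

/-- The trees of given degree and number of legs. -/
def _root_.PTree.homogeneous (m : ℕ∞) (δ : ℤ) (n : ℕ) : Set (PTree m) :=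
  {U | U.deg = δ ∧ U.leaves = n}

/-- With the `p`-th subtree replaced by a bare leg, inserting `U` is grafting at that leg, which is
composition in the operad. Its Koszul sign depends only on the degree of `U`; hence the homogeneity
of `g`. -/
theorem linearCombination_node_eq_zero {j : Ar m} (c : Fin j.1 → PTree m) (p : Fin j.1) (N : ℕ)
    {δ : ℤ} {b : ℕ} {g : PTree m →₀ k} (hg : g ∈ Finsupp.supported k k (homogeneous m δ b))
    (h0 : clsL k b g = 0) :
    Finsupp.linearCombination k (fun U => cls k N (node j (Function.update c p U))) g = 0 := by
  set c₀ := Function.update c p leaf with hc₀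
  have hcp : c₀ p = leaf := Function.update_self _ _ _
  have hr : 0 < (c₀ p).leaves := leaves_pos _
  have hi : start c₀ p.1 + 0 < (node j c₀).leaves :=
    blockStart_add_lt_sum (fun q => (c₀ q).leaves) hr
  have hgr : ∀ U : PTree m, (node j c₀).graft ⟨start c₀ p.1 + 0, hi⟩ U =
      node j (Function.update c p U) := by
    intro U
    rw [(graft_node c₀ _ p ⟨0, hr⟩ rfl U).1, (graft_of_eq_leaf hcp _ _).1, hc₀,
      Function.update_idem]
  by_cases hN : N + 1 = (node j c₀).leaves + b
  · have key := congrArg (compLeft (k := k) hN ⟨start c₀ p.1 + 0, hi⟩ ⟨node j c₀, rfl⟩) h0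
    rw [clsL, Finsupp.apply_linearCombination, map_zero,
      linearCombination_congr_support (g := fun U => Int.negOnePow
        (δ * (node j c₀).degAfter ⟨start c₀ p.1 + 0, hi⟩) •
          cls k N (node j (Function.update c p U))), linearCombination_units_smul] at key
    · exact (smul_eq_zero_iff_eq _).mp key
    · intro U hU
      have := (Finsupp.mem_supported _ _).mp hg hU
      rw [Function.comp_apply, compLeft_cls _ _ _ _ this.2, this.1]
      congr 2
      exact hgr U
  -- If the arities do not match, every class in the sum is the default value zero.
  · rw [linearCombination_congr_support (g := fun _ => 0)]
    · simp [Finsupp.linearCombination_apply]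
    · intro U hU
      have := (Finsupp.mem_supported _ _).mp hg hU
      refine cls_of_ne fun h => hN ?_
      have h' := (node j c₀).leaves_graft ⟨start c₀ p.1 + 0, hi⟩ U
      rw [hgr, h, this.2] at h'
      exact h'

/-- Congruences in one of the subtrees of a tree. -/
theorem linearCombination_node {j : Ar m} (c : Fin j.1 → PTree m) (p : Fin j.1) (N : ℕ)
    {T : PTree m} {g : PTree m →₀ k}
    (hg : g ∈ Finsupp.supported k k (homogeneous m T.deg T.leaves))
    (h : clsL k T.leaves g = cls k T.leaves T) :
    Finsupp.linearCombination k (fun U => cls k N (node j (Function.update c p U))) g =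
      cls k N (node j (Function.update c p T)) := by
  have := linearCombination_node_eq_zero (k := k) c p N (δ := T.deg) (b := T.leaves)
    (g := g - Finsupp.single T 1)
    (Submodule.sub_mem _ hg (Finsupp.single_mem_supported _ _ ⟨rfl, rfl⟩))
    (by rw [map_sub, h, clsL_single, sub_self])
  rw [map_sub, Finsupp.linearCombination_single, one_smul, sub_eq_zero] at this
  exact this

/-! #### Composites of the relations with trees -/

/-- The tree with two levels in which a block of the trees `c` is grafted at an inner vertex. -/
def twoLevel {n : Ar m} (l : Fin n.1) (s : Fin (n.1 - l.1)) (c : Fin n.1 → PTree m) : PTree m :=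
  node (n.lower (n.1 - s.1) (by omega) (by omega))
    (replaceBlock c l.1 (s.1 + 1) (n.1 - s.1) (by omega) (by omega)
      (node (n.lower (s.1 + 1) (by omega) (by omega))
        (fun t : Fin (s.1 + 1) => c ⟨l.1 + t.1, by omega⟩)))

section twoLevel

variable {n : Ar m} (l : Fin n.1) (s : Fin (n.1 - l.1)) (c : Fin n.1 → PTree m)

theorem leaves_twoLevel : (twoLevel l s c).leaves = ∑ i, (c i).leaves :=
  sum_leaves_replaceBlock _ _ _ _ _ _ _ rfl

theorem degRight_add {j : ℕ} (c : Fin j → PTree m) (p : Fin j) :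
    degRight c p + ∑ q with q ≤ p, (c q).deg = ∑ q, (c q).deg := by
  rw [degRight, ← Finset.sum_filter_add_sum_filter_not Finset.univ (fun q => p < q)]
  simp only [not_lt]

theorem start_of_leaf {j : ℕ} (c : Fin j → PTree m) {i : ℕ} (hi : i ≤ j)
    (hc : ∀ q : Fin j, q.1 < i → c q = leaf) : start c i = i := by
  induction i with
  | zero => simp [blockStart]
  | succ i ih =>
    have := blockStart_succ (fun q => (c q).leaves) (⟨i, hi⟩ : Fin j)
    simp only at this
    rw [start, this, ← start, ih (by omega) fun q hq => hc q (by omega),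
      hc ⟨i, hi⟩ (Nat.lt_succ_self i)]
    rfl

/-- Because all trees up to the `i`-th are bare legs, the leg sits at position `i`, and every vertex
of the subtrees follows it. The inner vertex, of degree `s - 1`, follows only if the leg lies left
of the block. The proof separates legs left of, inside and right of the block. -/
theorem twoLevel_graft (i : Fin n.1) (hc : ∀ q ≤ i, c q = leaf) (S : PTree m)
    (i' : Fin (twoLevel l s c).leaves) (hi' : i'.1 = i.1) :
    (twoLevel l s c).graft i' S = twoLevel l s (Function.update c i S) ∧
      (twoLevel l s c).degAfter i' =
        ∑ q, (c q).deg + if i.1 < l.1 then ((s.1 : ℤ) - 1) else 0 := by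
  have hls := s.2
  set blk : Fin (s.1 + 1) → PTree m := fun t => c ⟨l.1 + t.1, by omega⟩ with hblk
  set N := node (n.lower (s.1 + 1) (by omega) (by omega)) blk with hN
  set rb := replaceBlock c l.1 (s.1 + 1) (n.1 - s.1) (by omega) (by omega) N with hrb
  have hNdeg : N.deg = ∑ t, (blk t).deg + (s.1 - 1) := by
    rw [hN, deg]; push_cast; ring
  have hdeg : ∑ q, (rb q).deg = ∑ q, (c q).deg + (s.1 - 1) := by
    rw [hrb, sum_deg_replaceBlock c _ _ _ _ _ N (by rw [hNdeg]; push_cast; ring)]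
    push_cast
    ring
  have hrbl : rb ⟨l.1, by omega⟩ = N := by simp [hrb, replaceBlock]
  have hrb1 : ∀ q : Fin (n.1 - s.1), q.1 < l.1 → q.1 ≤ i.1 → rb q = leaf := by
    intro q hq hqi
    rw [hrb, replaceBlock, dif_pos hq]
    exact hc _ hqi
  have hrb2 : ∀ q : Fin (n.1 - s.1), l.1 < q.1 → q.1 + s.1 ≤ i.1 → rb q = leaf := by
    intro q hq hqi
    rw [hrb, replaceBlock, dif_neg (by omega), dif_neg (by omega)]
    exact hc _ (by simp only [Fin.le_def]; omega)
  rcases lt_or_ge i.1 l.1 with h1 | h1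
  · have hst : start rb i.1 = i.1 := start_of_leaf rb (by omega) fun q hq =>
      hrb1 q (by omega) hq.le
    have hleaf : rb ⟨i.1, by omega⟩ = leaf := hrb1 _ h1 le_rfl
    obtain ⟨g1, g2⟩ := graft_node (j := n.lower (n.1 - s.1) (by omega) (by omega)) rb i'
      ⟨i.1, (by omega : i.1 < n.1 - s.1)⟩ ⟨0, leaves_pos _⟩ (by simp only [hst, hi', add_zero]) S
    constructor
    · refine g1.trans ?_
      rw [(graft_of_eq_leaf hleaf _ _).1, twoLevel,
        replaceBlock_update_left _ _ _ _ _ _ _ i h1,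
        block_update_out _ _ _ (by omega) i (Or.inl h1)]
    · refine g2.trans ?_
      have := degRight_add rb ⟨i.1, by omega⟩
      rw [Finset.sum_eq_zero, add_zero, hdeg] at this
      · rw [(graft_of_eq_leaf hleaf _ S).2, this, if_pos h1, zero_add]
      · intro q hq
        rw [Finset.mem_filter, Fin.le_def] at hq
        rw [hrb1 q (by have := hq.2; simp only at this; omega) hq.2, deg]
  · rw [if_neg (by omega), add_zero]
    rcases lt_or_ge i.1 (l.1 + (s.1 + 1)) with h2 | h2
    · have hst : start rb l.1 = l.1 := start_of_leaf rb (by omega) fun q hq =>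
        hrb1 q (by omega) (by omega)
      have hst' : start blk (i.1 - l.1) = i.1 - l.1 := start_of_leaf blk (by omega) fun q hq =>
        hc _ (by simp only [Fin.le_def]; omega)
      have hleaf : blk ⟨i.1 - l.1, by omega⟩ = leaf := hc _ (by simp only [Fin.le_def]; omega)
      have hlt : i.1 - l.1 < N.leaves := by
        have := blockStart_add_lt_sum (fun q => (blk q).leaves) (p := ⟨i.1 - l.1, by omega⟩)
          (leaves_pos _)
        simp only [start] at hst'
        simp only [hst', add_zero] at this
        exact this
      obtain ⟨f1, f2⟩ := graft_node (j := n.lower (s.1 + 1) (by omega) (by omega)) blk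
        ⟨i.1 - l.1, hlt⟩ ⟨i.1 - l.1, (by omega : i.1 - l.1 < s.1 + 1)⟩ ⟨0, leaves_pos _⟩
        (by simp only [hst', add_zero]) S
      obtain ⟨g1, g2⟩ := graft_node (j := n.lower (n.1 - s.1) (by omega) (by omega)) rb i'
        ⟨l.1, (by omega : l.1 < n.1 - s.1)⟩ ⟨i.1 - l.1, by rw [hrbl]; exact hlt⟩
        (by simp only [hst, hi']; omega) S
      have hcast : ∀ (T : PTree m) (hT : T = N) (h : i.1 - l.1 < T.leaves),
          T.graft ⟨i.1 - l.1, h⟩ S = N.graft ⟨i.1 - l.1, hlt⟩ S ∧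
          T.degAfter ⟨i.1 - l.1, h⟩ = N.degAfter ⟨i.1 - l.1, hlt⟩ := by
        rintro T rfl h
        exact ⟨rfl, rfl⟩
      constructor
      · refine g1.trans ?_
        rw [(hcast _ hrbl _).1]
        conv_lhs => enter [2, 3]; rw [f1]
        rw [(graft_of_eq_leaf hleaf _ _).1, twoLevel,
          replaceBlock_update_mid _ _ _ _ _ _ _ i h1 h2,
          block_update_mid _ _ _ (by omega) i h1 h2, hrb,
          replaceBlock_eq_update _ _ _ _ _ _ (by omega) N leaf, Function.update_idem,
          ← replaceBlock_eq_update]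
      · refine g2.trans ?_
        rw [(hcast _ hrbl _).2]
        conv_lhs => enter [1]; rw [f2]
        rw [(graft_of_eq_leaf hleaf _ S).2]
        have e1 := degRight_add rb ⟨l.1, by omega⟩
        have e2 := degRight_add blk ⟨i.1 - l.1, by omega⟩
        rw [Finset.sum_eq_single ⟨l.1, by omega⟩, hdeg, hrbl, hNdeg] at e1
        · rw [Finset.sum_eq_zero, add_zero] at e2
          · linarith
          · intro q hq
            rw [Finset.mem_filter, Fin.le_def] at hq
            have : blk q = leaf := hc _ (by
              have := hq.2
              simp only [Fin.le_def] at this ⊢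
              omega)
            rw [this, deg]
        · intro q hq hq'
          rw [Finset.mem_filter, Fin.le_def] at hq
          have h3 : q.1 ≠ l.1 := fun h => hq' (Fin.ext h)
          have h4 := hq.2
          simp only at h4
          rw [hrb1 q (by omega) (by omega), deg]
        · intro h
          refine absurd (Finset.mem_filter.mpr ⟨Finset.mem_univ _, ?_⟩) h
          exact le_refl _
    · have hblk' : ∀ t, blk t = leaf := fun t => hc _ (by simp only [Fin.le_def]; omega)
      have hNl : N.leaves = s.1 + 1 := by
        simp [hN, leaves, hblk']
      have hst : start rb (i.1 - s.1) = i.1 := by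
        have e1 : start (replaceBlock c l.1 (s.1 + 1) (n.1 - s.1) (by omega) (by omega) leaf)
            (i.1 - s.1) = i.1 - s.1 := by
          refine start_of_leaf _ (by omega) fun q hq => ?_
          rw [replaceBlock]
          split_ifs
          · exact hc _ (by simp only [Fin.le_def]; omega)
          · rfl
          · exact hc _ (by simp only [Fin.le_def]; omega)
        have e2 := blockStart_update_lt (fun q => (replaceBlock c l.1 (s.1 + 1) (n.1 - s.1)
          (by omega) (by omega) leaf q).leaves) (p := ⟨l.1, by omega⟩) (i := i.1 - s.1)
          (by simp only; omega) N.leaves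
        rw [← leaves_update, ← replaceBlock_eq_update] at e2
        simp only [start] at e1 ⊢
        rw [e1, hNl] at e2
        have e3 : replaceBlock c l.1 (s.1 + 1) (n.1 - s.1) (by omega) (by omega) leaf
            ⟨l.1, by omega⟩ = leaf := by simp [replaceBlock]
        rw [e3, leaves] at e2
        rw [hrb]
        omega
      have hleaf : rb ⟨i.1 - s.1, by omega⟩ = leaf := hrb2 _ (by simp only; omega)
        (by simp only; omega)
      obtain ⟨g1, g2⟩ := graft_node (j := n.lower (n.1 - s.1) (by omega) (by omega)) rb i'
        ⟨i.1 - s.1, (by omega : i.1 - s.1 < n.1 - s.1)⟩ ⟨0, leaves_pos _⟩ (by simp only [hst, hi', add_zero]) S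
      constructor
      · refine g1.trans ?_
        rw [(graft_of_eq_leaf hleaf _ _).1, twoLevel,
          replaceBlock_update_right _ _ _ _ _ _ _ i h2,
          block_update_out _ _ _ (by omega) i (Or.inr h2)]
        congr 2
        ext
        simp only
        omega
      · refine g2.trans ?_
        rw [(graft_of_eq_leaf hleaf _ S).2]
        have e1 := degRight_add rb ⟨i.1 - s.1, by omega⟩
        rw [Finset.sum_eq_single ⟨l.1, by omega⟩, hdeg, hrbl, hNdeg] at e1
        · simp only [hblk', deg, Finset.sum_const_zero] at e1
          linarith
        · intro q hq hq'
          rw [Finset.mem_filter, Fin.le_def] at hq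
          have h3 : q.1 ≠ l.1 := fun h => hq' (Fin.ext h)
          have h4 := hq.2
          simp only at h4
          rcases lt_or_gt_of_ne h3 with h5 | h5
          · rw [hrb1 q h5 (by omega), deg]
          · rw [hrb2 q h5 (by omega), deg]
        · intro h
          refine absurd (Finset.mem_filter.mpr ⟨Finset.mem_univ _, ?_⟩) h
          simp only [Fin.le_def]
          omega

end twoLevel

end AmOp
end Classes
end

/-! ### The relations with trees grafted on the legs -/

noncomputable section
section Classes
open PTree
variable {k : Type u} [CommRing k] {m : ℕ∞}
namespace AmOp

/-- The tuple `(|, …, |, c_i, …, c_{n-1})`. -/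
def tailFrom {n : ℕ} (c : Fin n → PTree m) (i : ℕ) : Fin n → PTree m :=
  fun q => if i ≤ q.1 then c q else leaf

theorem tailFrom_step {n : ℕ} (c : Fin n → PTree m) (i : Fin n) :
    Function.update (tailFrom c (i.1 + 1)) i (c i) = tailFrom c i.1 := by
  funext q
  by_cases h : q = i
  · subst h; simp [tailFrom]
  · have h' : q.1 ≠ i.1 := fun h' => h (Fin.ext h')
    simp only [Function.update_of_ne h, tailFrom]
    split_ifs <;> first | rfl | omega

/-- The trees are grafted onto `Φ_n` from right to left, so that the leg next in turn is preceded by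
bare legs only. With all legs bare the statement is that the class of `Φ_n` vanishes. -/
theorem sum_twoLevel_tailFrom {n : Ar m} (c : Fin n.1 → PTree m) (i : ℕ) (hi : i ≤ n.1) (N : ℕ)
    (hN : ∑ q, (tailFrom c i q).leaves = N) :
    ∑ l : Fin n.1, ∑ s : Fin (n.1 - l.1),
      amSign (fun q => (tailFrom c i q).deg) l (s.1 + 1) •
        cls k N (twoLevel l s (tailFrom c i)) = 0 := by
  induction h : n.1 - i generalizing i N with
  | zero =>
    obtain rfl : i = n.1 := by omega
    have hleaf : tailFrom c n.1 = fun _ => leaf := by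
      funext q
      exact if_neg (by omega)
    have hN' : N = n.1 := by rw [← hN, hleaf]; simp [leaves]
    subst hN'
    have hΦ : (relIdeal k m n.1).mkQ (FreeOp.Φ k n) = 0 := by
      rw [Submodule.mkQ_apply, Submodule.Quotient.mk_eq_zero]
      exact Φ_mem_relIdeal n
    rw [AmStructure.Φ_eq] at hΦ
    simp only [map_sum, map_intUnits_smul] at hΦ
    rw [← hΦ]
    refine Finset.sum_congr rfl fun l _ => Finset.sum_congr rfl fun s _ => ?_
    have hls := s.2
    have hst : start (fun _ : Fin (n.1 - s.1) => (leaf : PTree m)) l.1 = l.1 :=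
      start_of_leaf _ (by omega) fun _ _ => rfl
    rw [mkQ_circ]
    obtain ⟨g1, g2⟩ := graft_node (j := n.lower (n.1 - s.1) (by omega) (by omega))
      (fun _ => leaf) (Fin.cast (Tr.corolla (n.lower (n.1 - s.1) (by omega) (by omega))).2.symm
        ⟨l.1, (by omega : l.1 < n.1 - s.1)⟩) ⟨l.1, (by omega : l.1 < n.1 - s.1)⟩ ⟨0, leaves_pos _⟩
      (by simp only [add_zero]; exact hst.symm)
      (Tr.corolla (n.lower (s.1 + 1) (by omega) (by omega))).1
    have g3 : (Tr.corolla (n.lower (n.1 - s.1) (by omega) (by omega))).1.degAfter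
        (Fin.cast (Tr.corolla (n.lower (n.1 - s.1) (by omega) (by omega))).2.symm
        ⟨l.1, (by omega : l.1 < n.1 - s.1)⟩) = 0 := by
      refine g2.trans ?_
      simp [degAfter, degRight, deg]
    rw [g3, mul_zero, Int.negOnePow_zero, one_smul]
    have g4 : (Tr.corolla (n.lower (n.1 - s.1) (by omega) (by omega))).1.graft
        (Fin.cast (Tr.corolla (n.lower (n.1 - s.1) (by omega) (by omega))).2.symm
        ⟨l.1, (by omega : l.1 < n.1 - s.1)⟩) (Tr.corolla (n.lower (s.1 + 1) (by omega) (by omega))).1 =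
        twoLevel l s (fun _ => leaf) := by
      refine g1.trans ?_
      rw [twoLevel, replaceBlock_eq_update _ _ _ _ _ _ (by omega) _ leaf]
      congr 2
      funext q
      simp only [replaceBlock]
      split_ifs <;> rfl
    rw [g4, hleaf]
    congr 1
    rw [amSign, Int.negOnePow_eq_iff]
    simp only [deg, Finset.sum_const_zero, mul_zero, add_zero]
    exact ⟨0, by push_cast; ring⟩
  | succ e ih =>
    have hin : i < n.1 := by omega
    set c₁ := tailFrom c (i + 1) with hc₁
    have hstep : Function.update c₁ ⟨i, hin⟩ (c ⟨i, hin⟩) = tailFrom c i :=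
      tailFrom_step c ⟨i, hin⟩
    have hleaf : ∀ q : Fin n.1, q ≤ ⟨i, hin⟩ → c₁ q = leaf := fun q hq => by
      have : q.1 ≤ i := hq
      rw [hc₁, tailFrom, if_neg (by omega)]
    have IH := ih (i + 1) hin _ rfl (by omega)
    set M := ∑ q, (c₁ q).leaves with hM
    have hiM : i < M := by
      have h1 := blockStart_add_lt_sum (fun q => (c₁ q).leaves) (p := ⟨i, hin⟩) (leaves_pos _)
      have h2 := start_of_leaf c₁ hin.le fun q hq => hleaf q (by simp only [Fin.le_def]; omega)
      simp only [start] at h2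
      simp only [h2, add_zero] at h1
      exact h1
    have hleaves : N + 1 = M + (c ⟨i, hin⟩).leaves := by
      have h1 : ∑ q, (tailFrom c i q).leaves =
          ∑ q, (Function.update (fun q => (c₁ q).leaves) ⟨i, hin⟩ (c ⟨i, hin⟩).leaves) q := by
        rw [← leaves_update, hstep]
      rw [← hN, h1, hM, Finset.sum_update_of_mem (Finset.mem_univ _),
        ← Finset.add_sum_erase _ _ (Finset.mem_univ (⟨i, hin⟩ : Fin n.1)), hleaf _ le_rfl,
        Finset.sdiff_singleton_eq_erase, leaves]
      omega
    have key := congrArg (compRight (k := k) hleaves ⟨i, hiM⟩ ⟨c ⟨i, hin⟩, rfl⟩) IH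
    simp only [map_sum, map_intUnits_smul, map_zero] at key
    -- This sign is common to all terms. For `i < l` grafting contributes in addition `(s - 1) * deg
    -- c_i`, which has the parity of the change `(s + 1) * deg c_i` in `amSign`.
    have key' := congrArg (fun z => Int.negOnePow ((c ⟨i, hin⟩).deg * ∑ q, (c₁ q).deg) • z) key
    simp only [smul_zero, Finset.smul_sum] at key'
    rw [← key']
    refine Finset.sum_congr rfl fun l _ => Finset.sum_congr rfl fun s _ => ?_
    obtain ⟨g1, g2⟩ := twoLevel_graft l s c₁ ⟨i, hin⟩ hleaf (c ⟨i, hin⟩)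
      (Fin.cast (leaves_twoLevel l s c₁).symm ⟨i, hiM⟩) rfl
    rw [compRight_cls _ _ _ _ (leaves_twoLevel l s c₁), g1, g2, hstep, smul_smul, smul_smul]
    congr 1
    have hsum : ∑ q : Fin l.1, (tailFrom c i ⟨q.1, q.2.trans l.2⟩).deg =
        ∑ q : Fin l.1, (c₁ ⟨q.1, q.2.trans l.2⟩).deg +
          if i < l.1 then (c ⟨i, hin⟩).deg else 0 := by
      rw [← hstep]
      split_ifs with h1
      · have e1 : ∀ (g : Fin n.1 → PTree m), ∑ q : Fin l.1, (g ⟨q.1, q.2.trans l.2⟩).deg =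
            (g ⟨i, hin⟩).deg + ∑ q ∈ Finset.univ.erase (⟨i, h1⟩ : Fin l.1),
              (g ⟨q.1, q.2.trans l.2⟩).deg := fun g =>
          (Finset.add_sum_erase _ _ (Finset.mem_univ (⟨i, h1⟩ : Fin l.1))).symm
        rw [e1, e1 c₁, Function.update_self, hleaf _ le_rfl, deg, zero_add, add_comm]
        congr 1
        refine Finset.sum_congr rfl fun q hq => ?_
        rw [Function.update_of_ne]
        intro h2
        exact Finset.ne_of_mem_erase hq (Fin.ext (by simpa only [Fin.mk.injEq] using h2))
      · rw [add_zero]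
        refine Finset.sum_congr rfl fun q _ => ?_
        rw [Function.update_of_ne]
        intro h2
        have := congrArg Fin.val h2
        have := q.2
        simp only at *
        omega
    rw [amSign, amSign, ← Int.negOnePow_add, ← Int.negOnePow_add, Int.negOnePow_eq_iff, hsum]
    set X := ∑ q : Fin l.1, (c₁ ⟨q.1, q.2.trans l.2⟩).deg
    set Y := ∑ q, (c₁ q).deg
    set Z := (c ⟨i, hin⟩).deg
    push_cast
    split_ifs
    · exact ⟨Z - Y * Z, by ring⟩
    · exact ⟨- Y * Z, by ring⟩

/-- The `A(m)`-relation for classes of trees. -/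
theorem sum_twoLevel {n : Ar m} (c : Fin n.1 → PTree m) (N : ℕ) (hN : ∑ q, (c q).leaves = N) :
    ∑ l : Fin n.1, ∑ s : Fin (n.1 - l.1), amSign (fun q => (c q).deg) l (s.1 + 1) •
      cls k N (twoLevel l s c) = 0 := by
  have h : tailFrom c 0 = c := by funext q; exact if_pos (Nat.zero_le _)
  have := sum_twoLevel_tailFrom (k := k) c 0 (Nat.zero_le _) N (by rw [h, hN])
  rwa [h] at this

theorem _root_.PTree.node_congr {i j : Ar m} (c : Fin i.1 → PTree m) (c' : Fin j.1 → PTree m)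
    (h : i.1 = j.1) (hc : ∀ q, c q = c' (Fin.cast h q)) : node i c = node j c' := by
  obtain rfl : i = j := Subtype.ext h
  exact congrArg _ (funext hc)

/-- Compare the relation for trees in `A_m` with the relation for normal forms. By induction they
agree in every term except the one for `ξ_1(ξ_n(c))`, hence also in that one. -/
theorem clsL_diff (T : PTree m) (hT' : T.Admissible) (N : ℕ) (j : Ar m) (hj : j.1 = 1) :
    clsL k N (diff k T) = cls k N (node j fun _ => T) := by
  induction T generalizing N j with
  | leaf =>
    obtain ⟨j, hj'⟩ := j
    obtain rfl : j = 1 := hj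
    rw [diff, dif_pos hj'.2, clsL_single]
  | node n c ih =>
    obtain ⟨j, hj'⟩ := j
    obtain rfl : j = 1 := hj
    by_cases hN : ∑ q, (c q).leaves = N
    swap
    · rw [cls_of_ne (by simpa [leaves] using hN), clsL, linearCombination_congr_support
        (g := fun _ => 0)]
      · simp [Finsupp.linearCombination_apply]
      · intro U hU
        have := (Finsupp.mem_supported _ _).mp (diff_mem (k := k) (node n c)) hU
        exact cls_of_ne fun h => hN (this.2.1.symm.trans h)
    have hn0 := n.2.1
    have h2 := sum_twoLevel (k := k) c N hN
    by_cases hn : n.1 = 1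
    · rw [Finset.sum_eq_single ⟨0, hn0⟩, Finset.sum_eq_single ⟨0, by simp only; omega⟩] at h2
      · rw [diff, if_pos hn, map_zero]
        have h3 := (smul_eq_zero_iff_eq _).mp h2
        rw [← h3]
        obtain ⟨n, hn'⟩ := n
        obtain rfl : n = 1 := hn
        congr 1
        refine node_congr _ _ rfl fun q => ?_
        obtain rfl : q = ⟨0, Nat.one_pos⟩ := Fin.ext (by have := q.2; simp only at this ⊢; omega)
        refine (node_congr _ _ rfl fun t => ?_).symm
        exact congrArg c (Fin.ext (Nat.zero_add _).symm)
      · rintro ⟨s, hs⟩ _ hs'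
        simp only at hs
        exact absurd (Fin.ext (by simp only; omega)) hs'
      · intro h; exact absurd (Finset.mem_univ _) h
      · rintro ⟨l, hl⟩ _ hl'
        exact absurd (Fin.ext (by simp only; omega)) hl'
      · intro h; exact absurd (Finset.mem_univ _) h
    have h1 := congrArg (clsL k N) (rel_eq_zero (k := k) n c)
    rw [rel, map_zero] at h1
    simp only [map_sum, map_intUnits_smul] at h1
    have h3 := h1.trans h2.symm
    rw [← sub_eq_zero, ← Finset.sum_sub_distrib] at h3
    simp only [← Finset.sum_sub_distrib, ← smul_sub] at h3
    -- The outer vertex is not unary here. For `s = 0` the induction hypothesis for the subtree `c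
    -- l` is transported through the outer vertex; for `s ≠ 0` both sides are the same tree.
    have hcongr : ∀ (l : Fin n.1) (s : Fin (n.1 - l.1)), s.1 + 1 ≠ n.1 →
        clsL k N (Finsupp.linearCombination k
          (fun U => op k (n.lower (n.1 - s.1) (by omega) (by omega))
            (replaceBlock c l.1 (s.1 + 1) (n.1 - s.1) (by omega) (by omega) U))
          (op k (n.lower (s.1 + 1) (by omega) (by omega))
            (fun t : Fin (s.1 + 1) => c ⟨l.1 + t.1, by omega⟩))) = cls k N (twoLevel l s c) := by
      intro l s hs
      have hls := s.2
      have h4 : n.1 - s.1 ≠ 1 := by omega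
      simp only [op_of_ne (n.lower (n.1 - s.1) (by omega) (by omega)) h4]
      rw [Finsupp.apply_linearCombination]
      have h5 : (clsL k N ∘ fun U => (Finsupp.single (node (n.lower (n.1 - s.1) (by omega)
          (by omega)) (replaceBlock c l.1 (s.1 + 1) (n.1 - s.1) (by omega) (by omega) U)) 1 :
          PTree m →₀ k)) = fun U => cls k N (node (n.lower (n.1 - s.1) (by omega)
          (by omega)) (replaceBlock c l.1 (s.1 + 1) (n.1 - s.1) (by omega) (by omega) U)) :=
        funext fun U => clsL_single _ _
      rw [h5]
      by_cases hs0 : s.1 = 0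
      · have h6 : op k (n.lower (s.1 + 1) (by omega) (by omega))
            (fun t : Fin (s.1 + 1) => c ⟨l.1 + t.1, by omega⟩) = diff k (c l) :=
          op_one _ (by simp only; omega) _ ⟨0, Nat.succ_pos _⟩
        rw [h6]
        have h7 : ∀ U, replaceBlock c l.1 (s.1 + 1) (n.1 - s.1) (by omega) (by omega) U =
            Function.update (replaceBlock c l.1 (s.1 + 1) (n.1 - s.1) (by omega) (by omega) leaf)
              ⟨l.1, by omega⟩ U := fun U => replaceBlock_eq_update _ _ _ _ _ _ (by omega) _ _
        rw [show (fun U => cls k N (node (n.lower (n.1 - s.1) (by omega) (by omega))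
            (replaceBlock c l.1 (s.1 + 1) (n.1 - s.1) (by omega) (by omega) U))) = fun U =>
            cls k N (node (n.lower (n.1 - s.1) (by omega) (by omega))
              (Function.update (replaceBlock c l.1 (s.1 + 1) (n.1 - s.1) (by omega) (by omega) leaf)
              ⟨l.1, (by omega : l.1 < n.1 - s.1)⟩ U)) from funext fun U => by rw [h7 U]]
        have hT : (node (n.lower (s.1 + 1) (by omega) (by omega))
            (fun t : Fin (s.1 + 1) => c ⟨l.1 + t.1, by omega⟩)) =
            node (n.lower (s.1 + 1) (by omega) (by omega)) (fun _ => c l) := by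
          congr 1
          funext t
          congr 1
          ext
          simp only
          omega
        have hdl : (node (n.lower (s.1 + 1) (by omega) (by omega)) (fun _ => c l)).deg =
            (c l).deg - 1 ∧ (node (n.lower (s.1 + 1) (by omega) (by omega)) (fun _ => c l)).leaves =
            (c l).leaves := by
          constructor
          · simp only [deg, Finset.sum_const, Finset.card_univ, Fintype.card_fin, hs0]
            push_cast
            ring
          · simp [leaves, hs0]
        rw [twoLevel, hT, h7 (node (n.lower (s.1 + 1) (by omega) (by omega)) (fun _ => c l))]
        refine linearCombination_node (k := k)
          (j := n.lower (n.1 - s.1) (by omega) (by omega)) _ _ N ?_ ?_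
        · refine Finsupp.supported_mono ?_ (diff_mem (c l))
          intro U hU
          exact ⟨hU.1.trans hdl.1.symm, hU.2.1.trans hdl.2.symm⟩
        · exact ih l (hT'.2 l) _ _ (by simp only; omega)
      · have h6 : s.1 + 1 ≠ 1 := by omega
        rw [op_of_ne (n.lower (s.1 + 1) (by omega) (by omega)) h6,
          Finsupp.linearCombination_single, one_smul]
        rfl
    rw [Finset.sum_eq_single ⟨0, hn0⟩, Finset.sum_eq_single ⟨n.1 - 1, by simp only; omega⟩] at h3
    · have h4 := sub_eq_zero.mp ((smul_eq_zero_iff_eq _).mp h3)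
      have h5 : n.1 - 1 + 1 ≠ 1 := by omega
      rw [op_of_ne (n.lower (n.1 - 1 + 1) (by omega) (by omega)) h5,
        Finsupp.linearCombination_single, one_smul,
        op_one (k := k) (n.lower (n.1 - (n.1 - 1)) (by omega) (by omega))
          (by simp only; omega) _ ⟨0, (by omega : 0 < n.1 - (n.1 - 1))⟩] at h4
      have e1 : node (n.lower (n.1 - 1 + 1) (by omega) (by omega))
          (fun t : Fin (n.1 - 1 + 1) => c ⟨0 + t.1, by omega⟩) = node n c :=
        node_congr _ _ (by simp only; omega) fun t => congrArg c (Fin.ext (Nat.zero_add _))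
      have e2 : replaceBlock c 0 (n.1 - 1 + 1) (n.1 - (n.1 - 1)) (by omega) (by omega)
          (node (n.lower (n.1 - 1 + 1) (by omega) (by omega))
            (fun t : Fin (n.1 - 1 + 1) => c ⟨0 + t.1, by omega⟩)) ⟨0, by omega⟩ = node n c := by
        rw [e1]; rfl
      rw [e2] at h4
      rw [h4]
      congr 1
      refine node_congr _ _ (by simp only; omega) fun q => ?_
      obtain rfl : q = ⟨0, by simp only; omega⟩ :=
        Fin.ext (by have := q.2; simp only at this ⊢; omega)
      exact e2
    · rintro ⟨s, hs⟩ _ hs'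
      rw [hcongr _ _ fun h => hs' (Fin.ext (by simp only at h ⊢; omega)), sub_self, smul_zero]
    · intro h; exact absurd (Finset.mem_univ _) h
    · rintro ⟨l, hl⟩ _ hl'
      refine Finset.sum_eq_zero fun s _ => ?_
      have hs := s.2
      have hl0 : l ≠ 0 := fun h => hl' (Fin.ext h)
      rw [hcongr _ _ (by simp only at hs; omega), sub_self, smul_zero]
    · intro h; exact absurd (Finset.mem_univ _) h

end AmOp
end Classes
end

/-! ### Admissible trees span -/

noncomputable section
section Normal
open PTree
variable {k : Type u} [CommRing k] {m : ℕ∞}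
namespace AmOp

theorem clsL_op (j : Ar m) (c : Fin j.1 → PTree m) (hc : ∀ i, (c i).Admissible) (N : ℕ) :
    clsL k N (op k j c) = cls k N (node j c) := by
  by_cases h : j.1 = 1
  · rw [op_one j h c ⟨0, j.2.1⟩, clsL_diff _ (hc _) N j h]
    congr 2
    funext q
    exact congrArg c (Fin.ext (by have := q.2; simp only; omega))
  · rw [op_of_ne j h, clsL_single]

variable (k) in
/-- The combinations of the classes of the admissible trees of the degree and arity of `T`. -/
def admSpan (T : PTree m) : Submodule k (AmOp k m T.leaves) :=
  (Finsupp.supported k k {U : PTree m | U.Admissible ∧ U ∈ homogeneous m T.deg T.leaves}).map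
    (clsL k T.leaves)

/-- The subtrees are normalized one at a time, `s` being the set of those still to be treated. Once
all are admissible, `op` gives the normal form of the whole tree. -/
theorem cls_node_mem {j : Ar m} (s : Finset (Fin j.1)) {N : ℕ} {δ : ℤ} (c : Fin j.1 → PTree m)
    (hN : (node j c).leaves = N) (hδ : (node j c).deg = δ)
    (h : ∀ i ∈ s, cls k (c i).leaves (c i) ∈ admSpan k (c i)) (h' : ∀ i ∉ s, (c i).Admissible) :
    cls k N (node j c) ∈
      (Finsupp.supported k k {U : PTree m | U.Admissible ∧ U ∈ homogeneous m δ N}).map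
        (clsL k N) := by
  induction s using Finset.induction_on generalizing c with
  | empty =>
    have hc : ∀ i, (c i).Admissible := fun i => h' i (Finset.notMem_empty i)
    rw [← clsL_op j c hc]
    refine Submodule.mem_map_of_mem (Finsupp.supported_mono ?_ (op_mem j c))
    rintro U ⟨h1, h2, h3⟩
    refine ⟨h3 hc, ?_, h2.trans hN⟩
    rw [h1, ← hδ, deg, add_comm]
  | insert i s hi ih =>
    obtain ⟨g, hg, hg'⟩ := h i (Finset.mem_insert_self i s)
    have h1 := linearCombination_node (k := k) c i N (T := c i) (g := g)
      (Finsupp.supported_mono (fun U hU => hU.2) hg) hg'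
    rw [Function.update_eq_self] at h1
    rw [← h1, Finsupp.linearCombination_apply]
    refine Submodule.sum_mem _ fun U hU => Submodule.smul_mem _ _ ?_
    obtain ⟨hU1, hU2, hU3⟩ := (Finsupp.mem_supported _ _).mp hg hU
    refine ih _ ?_ ?_ ?_ ?_
    · rw [← hN]
      simp only [leaves]
      exact Finset.sum_congr rfl fun q _ => by
        by_cases hq : q = i
        · subst hq; rw [Function.update_self, hU3]
        · rw [Function.update_of_ne hq]
    · rw [← hδ]
      simp only [deg]
      congr 1
      exact Finset.sum_congr rfl fun q _ => by
        by_cases hq : q = i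
        · subst hq; rw [Function.update_self, hU2]
        · rw [Function.update_of_ne hq]
    · intro q hq
      rw [Function.update_of_ne (ne_of_mem_of_not_mem hq hi)]
      exact h q (Finset.mem_insert_of_mem hq)
    · intro q hq
      by_cases hqi : q = i
      · subst hqi; rwa [Function.update_self]
      · rw [Function.update_of_ne hqi]
        exact h' q fun h2 => (Finset.mem_insert.mp h2).elim hqi hq

theorem cls_mem_admSpan (T : PTree m) : cls k T.leaves T ∈ admSpan k T := by
  induction T with
  | leaf =>
    exact ⟨Finsupp.single leaf 1, Finsupp.single_mem_supported _ _ ⟨trivial, rfl, rfl⟩,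
      clsL_single _ _⟩
  | node j c ih =>
    exact cls_node_mem Finset.univ c rfl rfl (fun i _ => ih i)
      fun i hi => absurd (Finset.mem_univ i) hi

theorem span_ofTree (n : ℕ) :
    Submodule.span k (Set.range fun T : Tr m n => AmOp.ofTree k T) = ⊤ := by
  rw [eq_top_iff]
  rintro z -
  obtain ⟨f, rfl⟩ := Submodule.mkQ_surjective _ z
  rw [← Finsupp.sum_single f, Finsupp.sum, map_sum]
  refine Submodule.sum_mem _ fun T _ => ?_
  rw [← mul_one (f T), ← smul_eq_mul, ← Finsupp.smul_single, map_smul]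
  exact Submodule.smul_mem _ _ (Submodule.subset_span ⟨T, rfl⟩)

/-- The restriction to trees of the same degree is what makes the grading of the free algebra
computable on admissible trees. -/
theorem ofTree_mem_span (n : ℕ) (T : Tr m n) :
    AmOp.ofTree k T ∈ Submodule.span k
      ((fun U : AdmTr m n => AmOp.ofTree k U.1) '' {U | U.1.1.deg = T.1.deg}) := by
  obtain ⟨T, rfl⟩ := T
  obtain ⟨g, hg, hg'⟩ := cls_mem_admSpan (k := k) T
  rw [← cls_val, ← hg', clsL, Finsupp.linearCombination_apply]
  refine Submodule.sum_mem _ fun U hU => Submodule.smul_mem _ _ (Submodule.subset_span ?_)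
  obtain ⟨hU1, hU2, hU3⟩ := (Finsupp.mem_supported _ _).mp hg hU
  exact ⟨⟨⟨U, hU3⟩, hU1⟩, hU2, (cls_of_eq hU3).symm⟩

theorem span_admissible (n : ℕ) :
    Submodule.span k (Set.range fun T : AdmTr m n => AmOp.ofTree k T.1) = ⊤ := by
  rw [eq_top_iff, ← span_ofTree, Submodule.span_le]
  rintro _ ⟨T, rfl⟩
  exact Submodule.span_mono (Set.image_subset_range _ _) (ofTree_mem_span n T)

end AmOp
end Normal
end

noncomputable section

/-! ### Multilinear maps and spans -/

section Span

variable {k : Type*} [CommRing k] {M P : Type*} [AddCommGroup M] [Module k M] [AddCommGroup P]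
  [Module k P]

/-- Generators are replaced by elements of the spans one coordinate at a time; `t` is the set of
coordinates already replaced. -/
theorem MultilinearMap.mem_of_mem_span {ι : Type*} [Fintype ι] [DecidableEq ι]
    (f : MultilinearMap k (fun _ : ι => M) P) (s : ι → Set M) (Q : Submodule k P)
    (h : ∀ a : ι → M, (∀ i, a i ∈ s i) → f a ∈ Q) (a : ι → M)
    (ha : ∀ i, a i ∈ Submodule.span k (s i)) : f a ∈ Q := by
  suffices H : ∀ (t : Finset ι) (a : ι → M), (∀ i ∈ t, a i ∈ Submodule.span k (s i)) →
      (∀ i ∉ t, a i ∈ s i) → f a ∈ Q from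
    H Finset.univ a (fun i _ => ha i) fun i hi => absurd (Finset.mem_univ i) hi
  intro t
  induction t using Finset.induction_on with
  | empty => exact fun a _ h' => h a fun i => h' i (Finset.notMem_empty i)
  | insert i t hi ih =>
    intro a ha h'
    have h1 : Submodule.span k (s i) ≤ Q.comap (f.toLinearMap a i) := by
      rw [Submodule.span_le]
      intro x hx
      refine ih _ (fun q hq => ?_) fun q hq => ?_
      · rw [Function.update_of_ne (ne_of_mem_of_not_mem hq hi)]
        exact ha q (Finset.mem_insert_of_mem hq)
      · by_cases hqi : q = i
        · subst hqi; rwa [Function.update_self]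
        · rw [Function.update_of_ne hqi]
          exact h' q fun h2 => (Finset.mem_insert.mp h2).elim hqi hq
    have h2 := h1 (ha i (Finset.mem_insert_self i t))
    rwa [Submodule.mem_comap, MultilinearMap.toLinearMap_apply, Function.update_eq_self] at h2

theorem MultilinearMap.eq_of_mem_span {ι : Type*} [Fintype ι] [DecidableEq ι]
    (f g : MultilinearMap k (fun _ : ι => M) P) (s : ι → Set M)
    (h : ∀ a : ι → M, (∀ i, a i ∈ s i) → f a = g a) (a : ι → M)
    (ha : ∀ i, a i ∈ Submodule.span k (s i)) : f a = g a := by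
  have := (f - g).mem_of_mem_span s ⊥ (fun a ha => by simp [h a ha]) a ha
  simpa [sub_eq_zero] using this

theorem Finsupp.eq_of_mem_supported {α : Type*} {φ ψ : (α →₀ k) →ₗ[k] P} {s : Set α}
    (h : ∀ i ∈ s, φ (Finsupp.single i 1) = ψ (Finsupp.single i 1)) {g : α →₀ k}
    (hg : g ∈ Finsupp.supported k k s) : φ g = ψ g := by
  rw [Finsupp.supported_eq_span_single] at hg
  refine LinearMap.eqOn_span (f := φ) (g := ψ) ?_ hg
  rintro _ ⟨i, hi, rfl⟩
  exact h i hi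

end Span

/-! ### The Koszul sign -/

/-- The exponent of the Koszul sign for `(D₁ ⊗ E₁) ⋯ (D_n ⊗ E_n) ↦ D₁ ⋯ D_n ⊗ E₁ ⋯ E_n`, given
the degrees `(|D_i|, |E_i|)`. -/
def koszul : List (ℤ × ℤ) → ℤ
  | [] => 0
  | a :: w => a.2 * (w.map Prod.fst).sum + koszul w

theorem koszul_append (v w : List (ℤ × ℤ)) :
    koszul (v ++ w) = koszul v + koszul w + (v.map Prod.snd).sum * (w.map Prod.fst).sum := by
  induction v with
  | nil => simp [koszul]
  | cons a v ih =>
    simp only [List.cons_append, koszul, ih, List.map_append, List.sum_append, List.map_cons,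
      List.sum_cons]
    ring

theorem koszul_ofFn {n : ℕ} (δ e : Fin n → ℤ) :
    koszul (List.ofFn fun i => (δ i, e i)) = ∑ i, (∑ q with i < q, δ q) * e i := by
  induction n with
  | zero => simp [koszul]
  | succ n ih =>
    rw [List.ofFn_succ, koszul, ih, Fin.sum_univ_succ, List.map_ofFn, List.sum_ofFn]
    simp only [Finset.sum_filter, Fin.sum_univ_succ, Fin.succ_lt_succ_iff, Fin.not_lt_zero,
      Function.comp, Fin.succ_pos, if_true, if_false, zero_add, lt_irrefl]
    ring

/-- Performing the reordering first inside the block and then outside differs from doing it at once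
only in that the degree `x` of the inner operation passes the second components left of the block.
-/
theorem koszul_replaceBlock {n : ℕ} (δ e : Fin n → ℤ) (l s c : ℕ) (hl : l + s ≤ n)
    (hc : c + s = n + 1) (x : ℤ) :
    koszul (List.ofFn (replaceBlock (fun i => (δ i, e i)) l s c hl hc
      ((∑ t : Fin s, δ ⟨l + t.1, by omega⟩) + x, ∑ t : Fin s, e ⟨l + t.1, by omega⟩))) +
      koszul (List.ofFn fun t : Fin s => (δ ⟨l + t.1, by omega⟩, e ⟨l + t.1, by omega⟩)) =
    koszul (List.ofFn fun i => (δ i, e i)) + x * ∑ i : Fin l, e ⟨i.1, by omega⟩ := by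
  have hB := ofFn_block (fun i => (δ i, e i)) l s hl
  have hA := ofFn_block (fun i => (δ i, e i)) 0 l (by omega)
  have hw := list_take_block_drop (List.ofFn fun i => (δ i, e i)) l s
  rw [ofFn_replaceBlock, hB]
  set w := List.ofFn fun i => (δ i, e i)
  rw [List.drop_zero] at hA
  have h1 : ∑ t : Fin s, δ ⟨l + t.1, by omega⟩ = (((w.drop l).take s).map Prod.fst).sum := by
    rw [← hB, List.map_ofFn, List.sum_ofFn]; rfl
  have h2 : ∑ t : Fin s, e ⟨l + t.1, by omega⟩ = (((w.drop l).take s).map Prod.snd).sum := by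
    rw [← hB, List.map_ofFn, List.sum_ofFn]; rfl
  have h3 : ∑ i : Fin l, e ⟨i.1, by omega⟩ = ((w.take l).map Prod.snd).sum := by
    rw [← hA, List.map_ofFn, List.sum_ofFn]
    exact Finset.sum_congr rfl fun i _ => congrArg e (Fin.ext (Nat.zero_add _).symm)
  rw [h1, h2, h3]
  rw [congrArg koszul hw]
  generalize w.take l = A
  generalize (w.drop l).take s = B
  generalize w.drop (l + s) = C
  simp only [koszul_append, koszul, List.map_append, List.sum_append, List.map_cons,
      List.sum_cons]
  ring
end

noncomputable section

/-! ### The relations as multilinear maps -/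

section RelMap

variable {k : Type*} [CommRing k] {m : ℕ∞} {A : Type*} [AddCommGroup A] [Module k A]
variable (μ : ∀ j : Ar m, MultilinearMap k (fun _ : Fin j.1 => A) A)

/-- `(a_1, …, a_n) ↦ μ_{c}(a_1, …, a_l, μ_{j}(a_{l+1}, …, a_{l+j}), …, a_n)`. -/
def insertMap {n : ℕ} (l : ℕ) (j c : Ar m) (hl : l + j.1 ≤ n) (hc : c.1 + j.1 = n + 1) :
    MultilinearMap k (fun _ : Fin n => A) A :=
  MultilinearMap.mk'
    (fun a => μ c (replaceBlock a l j.1 c.1 hl hc (μ j fun t => a ⟨l + t.1, by omega⟩)))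
    (fun a i x y => by
      have hj := j.2.1
      by_cases h1 : i.1 < l
      · simp only [replaceBlock_update_left a l j.1 c.1 hl hc _ i h1,
          block_update_out a l j.1 hl i (Or.inl h1), MultilinearMap.map_update_add]
      by_cases h2 : i.1 < l + j.1
      · simp only [replaceBlock_update_mid a l j.1 c.1 hl hc _ i (not_lt.mp h1) h2,
          block_update_mid a l j.1 hl i (not_lt.mp h1) h2, MultilinearMap.map_update_add]
        rw [replaceBlock_eq_update a l j.1 c.1 hl hc (by omega) _ 0, MultilinearMap.map_update_add,
          ← replaceBlock_eq_update, ← replaceBlock_eq_update]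
      · simp only [replaceBlock_update_right a l j.1 c.1 hl hc _ i (not_lt.mp h2),
          block_update_out a l j.1 hl i (Or.inr (not_lt.mp h2)), MultilinearMap.map_update_add])
    (fun a i r x => by
      have hj := j.2.1
      by_cases h1 : i.1 < l
      · simp only [replaceBlock_update_left a l j.1 c.1 hl hc _ i h1,
          block_update_out a l j.1 hl i (Or.inl h1), MultilinearMap.map_update_smul]
      by_cases h2 : i.1 < l + j.1
      · simp only [replaceBlock_update_mid a l j.1 c.1 hl hc _ i (not_lt.mp h1) h2,
          block_update_mid a l j.1 hl i (not_lt.mp h1) h2, MultilinearMap.map_update_smul]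
        rw [replaceBlock_eq_update a l j.1 c.1 hl hc (by omega) _ 0,
          MultilinearMap.map_update_smul, ← replaceBlock_eq_update]
      · simp only [replaceBlock_update_right a l j.1 c.1 hl hc _ i (not_lt.mp h2),
          block_update_out a l j.1 hl i (Or.inr (not_lt.mp h2)), MultilinearMap.map_update_smul])

/-- The left hand side of the `A(m)`-relation for arguments of degrees `d`. -/
def relMap (n : Ar m) (d : Fin n.1 → ℤ) : MultilinearMap k (fun _ : Fin n.1 => A) A :=
  ∑ l : Fin n.1, ∑ s : Fin (n.1 - l.1), ((amSign d l (s.1 + 1) : ℤ) : k) •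
    insertMap μ l.1 (n.lower (s.1 + 1) (by omega) (by omega))
      (n.lower (n.1 - s.1) (by omega) (by omega)) (by simp only; omega) (by simp only; omega)

theorem relMap_apply (n : Ar m) (d : Fin n.1 → ℤ) (a : Fin n.1 → A) :
    relMap μ n d a = ∑ l : Fin n.1, ∑ s : Fin (n.1 - l.1), amSign d l (s.1 + 1) •
      μ (n.lower (n.1 - s.1) (by omega) (by omega))
        (replaceBlock a l.1 (s.1 + 1) (n.1 - s.1) (by omega) (by omega)
          (μ (n.lower (s.1 + 1) (by omega) (by omega))
            (fun t : Fin (s.1 + 1) => a ⟨l.1 + t.1, by omega⟩))) := by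
  simp only [relMap, _root_.sum_apply, _root_.smul_apply, Units.smul_def,
    Int.cast_smul_eq_zsmul]
  rfl

end RelMap

/-! ### The model -/

/-- A `ℤ`-graded algebra with the maps `r ↦ (-1)^{e |r|} r`. -/
structure ParityAlgebra (k : Type u) [CommRing k] (R : Type v) [Ring R] [Algebra k R] where
  /-- the homogeneous components -/
  comp : ℤ → Submodule k R
  one_mem : 1 ∈ comp 0
  mul_mem : ∀ {d e : ℤ} {r s : R}, r ∈ comp d → s ∈ comp e → r * s ∈ comp (d + e)
  /-- the twist -/
  tw : ℤ → R →ₗ[k] R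
  tw_apply : ∀ (e : ℤ) {d : ℤ} {r : R}, r ∈ comp d → tw e r = Int.negOnePow (e * d) • r

namespace ParityAlgebra

open PTree

variable {k : Type u} [CommRing k] {R : Type v} [Ring R] [Algebra k R] (G : ParityAlgebra k R)
variable {m : ℕ∞}

theorem prod_mem {n : ℕ} (e : Fin n → ℤ) (r : Fin n → R) (h : ∀ i, r i ∈ G.comp (e i)) :
    (List.ofFn r).prod ∈ G.comp (∑ i, e i) := by
  induction n with
  | zero => simpa using G.one_mem
  | succ n ih =>
    rw [List.ofFn_succ, List.prod_cons, Fin.sum_univ_succ]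
    exact G.mul_mem (h 0) (ih _ _ fun i => h _)

/-- `g ⊗ r` as an `R`-valued function on trees. -/
def tens : (PTree m →₀ k) →ₗ[k] R →ₗ[k] (PTree m →₀ R) :=
  Finsupp.linearCombination k fun U => Finsupp.lsingle U

theorem tens_single (U : PTree m) (r : R) :
    tens (Finsupp.single U (1 : k)) r = Finsupp.single U r := by
  rw [tens, Finsupp.linearCombination_single, one_smul, Finsupp.lsingle_apply]

/-- The operations on the `R`-valued functions on trees. -/
def μ (j : Ar m) : MultilinearMap k (fun _ : Fin j.1 => PTree m →₀ R) (PTree m →₀ R) :=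
  (MultilinearMap.fromDirectSumEquiv (R := k) (M := fun (_ : Fin j.1) (_ : PTree m) => R)
    (fun T : Fin j.1 → PTree m =>
    -- Prescribed on the elements `T_i ⊗ r_i`. The twist `tw` is a linear form of the sign for
    -- moving `r_i` past the later trees, so it also applies to inhomogeneous `r_i`.
    (tens (op k j T)).compMultilinearMap
      ((MultilinearMap.mkPiAlgebraFin k j.1 R).compLinearMap fun i =>
        G.tw (degRight T i)))).compLinearMap
    fun _ => by classical exact (finsuppLEquivDirectSum k R (PTree m)).toLinearMap

theorem μ_single (j : Ar m) (T : Fin j.1 → PTree m) (r : Fin j.1 → R) :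
    G.μ j (fun i => Finsupp.single (T i) (r i)) =
      tens (op k j T) (List.ofFn fun i => G.tw (degRight T i) (r i)).prod := by
  classical
  rw [μ, MultilinearMap.compLinearMap_apply]
  have : ∀ i, finsuppLEquivDirectSum k R (PTree m) (Finsupp.single (T i) (r i)) =
    DirectSum.lof k (PTree m) (fun _ => R) (T i) (r i) :=
    fun i => finsuppLEquivDirectSum_single k R _ _ _
  have h2 := MultilinearMap.fromDirectSumEquiv_lof (R := k)
    (M := fun (_ : Fin j.1) (_ : PTree m) => R) (fun T : Fin j.1 → PTree m =>
    (tens (op k j T)).compMultilinearMap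
      ((MultilinearMap.mkPiAlgebraFin k j.1 R).compLinearMap fun i =>
        G.tw (degRight T i))) T r
  rw [LinearMap.compMultilinearMap_apply, MultilinearMap.compLinearMap_apply,
    MultilinearMap.mkPiAlgebraFin_apply] at h2
  rw [← h2]
  congr 1
  funext i
  convert! this i

theorem prod_intUnits_smul {n : ℕ} (e : Fin n → ℤ) (r : Fin n → R) :
    (List.ofFn fun i => Int.negOnePow (e i) • r i).prod =
      Int.negOnePow (∑ i, e i) • (List.ofFn r).prod := by
  induction n with
  | zero => simp
  | succ n ih =>
    rw [List.ofFn_succ, List.prod_cons, Fin.sum_univ_succ, ih, List.ofFn_succ, List.prod_cons,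
      Int.negOnePow_add, smul_mul_smul_comm]

theorem μ_homogeneous (j : Ar m) (T : Fin j.1 → PTree m) (e : Fin j.1 → ℤ) (r : Fin j.1 → R)
    (h : ∀ i, r i ∈ G.comp (e i)) :
    G.μ j (fun i => Finsupp.single (T i) (r i)) =
      Int.negOnePow (koszul (List.ofFn fun i => ((T i).deg, e i))) •
        tens (op k j T) (List.ofFn r).prod := by
  rw [μ_single]
  have : (fun i => G.tw (degRight T i) (r i)) =
      fun i => Int.negOnePow (degRight T i * e i) • r i := funext fun i => G.tw_apply _ (h i)
  rw [this, prod_intUnits_smul, map_intUnits_smul, koszul_ofFn]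
  rfl

/-- Both sides are linear in `g`, and the Koszul sign sees only the degree `D` of the inserted tree;
so it suffices to insert a single tree. -/
theorem μ_replaceBlock {n : ℕ} (T : Fin n → PTree m) (e : Fin n → ℤ) (r : Fin n → R)
    (h : ∀ i, r i ∈ G.comp (e i)) (l s : ℕ) (c : Ar m) (hl : l + s ≤ n) (hc : c.1 + s = n + 1)
    (hlc : l < c.1) {D E : ℤ} {g : PTree m →₀ k} (hg : g ∈ Finsupp.supported k k {U | U.deg = D})
    {y : R} (hy : y ∈ G.comp E) :
    G.μ c (replaceBlock (fun i => Finsupp.single (T i) (r i)) l s c.1 hl hc (tens g y)) =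
      Int.negOnePow (koszul (List.ofFn
        (replaceBlock (fun i => ((T i).deg, e i)) l s c.1 hl hc (D, E)))) •
      tens (Finsupp.linearCombination k
        (fun U => op k c (replaceBlock T l s c.1 hl hc U)) g)
          (List.ofFn (replaceBlock r l s c.1 hl hc y)).prod := by
  set φ := (G.μ c).toLinearMap (replaceBlock (fun i => Finsupp.single (T i) (r i)) l s c.1 hl hc 0)
    ⟨l, hlc⟩ ∘ₗ tens.flip y
  set ψ := (((Int.negOnePow (koszul (List.ofFn
        (replaceBlock (fun i => ((T i).deg, e i)) l s c.1 hl hc (D, E)))) : ℤˣ) : ℤ) : k) •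
    (tens.flip (List.ofFn (replaceBlock r l s c.1 hl hc y)).prod ∘ₗ Finsupp.linearCombination k
        (fun U => op k c (replaceBlock T l s c.1 hl hc U)))
  have key : φ g = ψ g := by
    refine Finsupp.eq_of_mem_supported (fun U hU => ?_) hg
    simp only [φ, ψ, LinearMap.comp_apply, LinearMap.smul_apply, LinearMap.flip_apply,
      MultilinearMap.toLinearMap_apply, Finsupp.linearCombination_single, one_smul, tens_single]
    rw [← replaceBlock_eq_update]
    have h1 : replaceBlock (fun i => Finsupp.single (T i) (r i)) l s c.1 hl hc
        (Finsupp.single U y) = fun i => Finsupp.single (replaceBlock T l s c.1 hl hc U i)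
          (replaceBlock r l s c.1 hl hc y i) := by
      funext i
      simp only [replaceBlock]
      split_ifs <;> rfl
    have h2 : replaceBlock (fun i => ((T i).deg, e i)) l s c.1 hl hc (D, E) = fun i =>
        ((replaceBlock T l s c.1 hl hc U i).deg, replaceBlock e l s c.1 hl hc E i) := by
      funext i
      simp only [replaceBlock]
      split_ifs
      · rfl
      · rw [← hU]
      · rfl
    have h3 : ∀ i, replaceBlock r l s c.1 hl hc y i ∈ G.comp (replaceBlock e l s c.1 hl hc E i) := by
      intro i
      simp only [replaceBlock]
      split_ifs
      · exact h _
      · exact hy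
      · exact h _
    rw [h1, μ_homogeneous _ _ _ _ _ h3, h2, Int.cast_smul_eq_zsmul, Units.smul_def]
  simp only [φ, ψ, LinearMap.comp_apply, LinearMap.smul_apply, LinearMap.flip_apply,
      MultilinearMap.toLinearMap_apply, Int.cast_smul_eq_zsmul, ← Units.smul_def] at key
  rw [← replaceBlock_eq_update] at key
  exact key

/-- The left side is, up to sign, `rel k n T` tensored with the product of the `r_i`: associativity
of `R` gives the same product in each term, and `koszul_replaceBlock` accounts for the signs. Then
`rel_eq_zero` applies. -/
theorem sum_μ_single (n : Ar m) (T : Fin n.1 → PTree m) (e : Fin n.1 → ℤ) (r : Fin n.1 → R)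
    (h : ∀ i, r i ∈ G.comp (e i)) :
    relMap G.μ n (fun i => (T i).deg + e i) (fun i => Finsupp.single (T i) (r i)) = 0 := by
  have h0 : Int.negOnePow (koszul (List.ofFn fun i => ((T i).deg, e i))) •
      tens (rel k n T) (List.ofFn r).prod = 0 := by
    rw [rel_eq_zero, map_zero, LinearMap.zero_apply, smul_zero]
  rw [← h0, relMap_apply, rel]
  simp only [map_sum, LinearMap.sum_apply, Finset.smul_sum]
  refine Finset.sum_congr rfl fun l _ => Finset.sum_congr rfl fun s _ => ?_
  have hs := s.2
  rw [G.μ_homogeneous (n.lower (s.1 + 1) (by omega) (by omega))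
    (fun t : Fin (s.1 + 1) => T ⟨l.1 + t.1, by omega⟩)
    (fun t : Fin (s.1 + 1) => e ⟨l.1 + t.1, by omega⟩)
    (fun t : Fin (s.1 + 1) => r ⟨l.1 + t.1, by omega⟩) fun t => h _]
  set c := n.lower (n.1 - s.1) (by omega) (by omega) with hc
  have hsm : ∀ (u : ℤˣ) (y : PTree m →₀ R), G.μ c (replaceBlock
      (fun i => Finsupp.single (T i) (r i)) l.1 (s.1 + 1) (n.1 - s.1) (by omega) (by omega)
      (u • y)) = u • G.μ c (replaceBlock
      (fun i => Finsupp.single (T i) (r i)) l.1 (s.1 + 1) (n.1 - s.1) (by omega) (by omega) y) := by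
    intro u y
    rw [replaceBlock_eq_update _ _ _ _ _ _ (by omega) _ 0, map_update_intUnits_smul,
      ← replaceBlock_eq_update]
  have hm : op k (n.lower (s.1 + 1) (by omega) (by omega))
      (fun t : Fin (s.1 + 1) => T ⟨l.1 + t.1, by omega⟩) ∈ Finsupp.supported k k
        {U | U.deg = (∑ t : Fin (s.1 + 1), (T ⟨l.1 + t.1, by omega⟩).deg) +
          (((s.1 + 1 : ℕ) : ℤ) - 2)} :=
    Finsupp.supported_mono (fun U hU => hU.1) (op_mem _ _)
  have h1 := G.μ_replaceBlock T e r h l.1 (s.1 + 1) c (by omega) (by simp only [hc]; omega)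
    (by simp only [hc]; omega) hm
    (G.prod_mem (fun t : Fin (s.1 + 1) => e ⟨l.1 + t.1, by omega⟩)
      (fun t : Fin (s.1 + 1) => r ⟨l.1 + t.1, by omega⟩) fun t => h _)
  have h2 := koszul_replaceBlock (fun i => (T i).deg) e l.1 (s.1 + 1) c.1 (by omega)
    (by simp only [hc]; omega) (((s.1 + 1 : ℕ) : ℤ) - 2)
  have h3 : (List.ofFn (replaceBlock r l.1 (s.1 + 1) c.1 (by omega) (by simp only [hc]; omega)
      (List.ofFn fun t : Fin (s.1 + 1) => r ⟨l.1 + t.1, by omega⟩).prod)).prod =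
      (List.ofFn r).prod := by
    rw [ofFn_replaceBlock, ofFn_block r l.1 (s.1 + 1) (by omega), List.prod_append, List.prod_cons,
      ← List.prod_append, ← List.prod_append, ← list_take_block_drop]
  rw [hsm]
  refine (congrArg (fun z => amSign _ _ _ • (_ : ℤˣ) • z) h1).trans ?_
  rw [h3, map_intUnits_smul, Units.smul_def (amSign (fun i => (T i).deg) _ _), LinearMap.smul_apply,
    ← Units.smul_def, smul_smul, smul_smul, smul_smul]
  congr 1
  rw [amSign, amSign, ← Int.negOnePow_add, ← Int.negOnePow_add, ← Int.negOnePow_add,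
    Int.negOnePow_eq_iff, Finset.sum_add_distrib]
  set K1 := koszul (List.ofFn fun i => ((T i).deg, e i))
  set X := ∑ i : Fin l.1, e ⟨i.1, i.2.trans l.2⟩
  -- With `k = s + 1`, the relation contributes `k X` and the inner operation of degree `k - 2`
  -- contributes `(k - 2) X`; this witness is half of their sum.
  refine ⟨((s.1 + 1 : ℕ) : ℤ) * X - X, ?_⟩
  rw [← sub_eq_zero] at h2 ⊢
  rw [← h2]
  ring

end ParityAlgebra
end

/-! ### The model as an algebra; admissible trees are independent -/

noncomputable section

namespace PTree

variable {k : Type u} [CommRing k] {m : ℕ∞}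

/-- There is nothing to rewrite: in an admissible tree a unary root carries a bare leg, and `diff`
of that leg is the tree itself. -/
theorem op_of_admissible (j : Ar m) (c : Fin j.1 → PTree m) (h : (node j c).Admissible) :
    op k j c = Finsupp.single (node j c) 1 := by
  by_cases hj : j.1 = 1
  · have h1 : ((1 : ℕ) : ℕ∞) ≤ m := hj ▸ j.2.2
    rw [op_one j hj c ⟨0, j.2.1⟩, h.1 hj, diff, dif_pos h1]
    congr 1
    exact node_congr _ _ hj.symm fun q => (h.1 hj _).symm
  · exact op_of_ne j hj c

end PTree

namespace ParityAlgebra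

open PTree

variable {k : Type u} [CommRing k] {R : Type v} [Ring R] [Algebra k R] (G : ParityAlgebra k R)
variable {m : ℕ∞}

variable (m) in
/-- The homogeneous components of the module of `R`-valued functions on trees. -/
def grading (d : ℤ) : Submodule k (PTree m →₀ R) :=
  Submodule.span k {z | ∃ (T : PTree m) (e : ℤ) (r : R), r ∈ G.comp e ∧ T.deg + e = d ∧
    z = Finsupp.single T r}

theorem tens_mem {D E : ℤ} {g : PTree m →₀ k} (hg : g ∈ Finsupp.supported k k {U | U.deg = D})
    {r : R} (hr : r ∈ G.comp E) : tens g r ∈ G.grading m (D + E) := by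
  rw [Finsupp.supported_eq_span_single] at hg
  have : Submodule.span k ((fun i => Finsupp.single i (1 : k)) '' {U : PTree m | U.deg = D}) ≤
      (G.grading m (D + E)).comap (tens.flip r) := by
    rw [Submodule.span_le]
    rintro _ ⟨U, hU, rfl⟩
    exact Submodule.subset_span ⟨U, E, r, hr, by rw [← hU], tens_single U r⟩
  exact this hg

/-- The `A(m)`-algebra of `R`-valued functions on trees. -/
def amStructure : AmStructure k m (G.grading m) where
  μ := G.μ
  degree j d a ha := by
    refine (G.μ j).mem_of_mem_span _ _ (fun a ha => ?_) a ha
    choose T e r hr hd ha using ha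
    obtain rfl : a = fun i => Finsupp.single (T i) (r i) := funext ha
    rw [G.μ_homogeneous j T e r hr, Units.smul_def]
    refine zsmul_mem ?_ _
    have := G.tens_mem (Finsupp.supported_mono (fun U hU => hU.1) (op_mem (k := k) j T))
      (G.prod_mem e r hr)
    convert this using 2
    simp only [← hd, Finset.sum_add_distrib]
    ring
  rel n d a ha := by
    have := (relMap G.μ n d).mem_of_mem_span _ ⊥ (fun a ha => ?_) a ha
    · rw [Submodule.mem_bot, relMap_apply] at this
      exact this
    choose T e r hr hd ha using ha
    obtain rfl : a = fun i => Finsupp.single (T i) (r i) := funext ha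
    obtain rfl : d = fun i => (T i).deg + e i := funext fun i => (hd i).symm
    exact G.sum_μ_single n T e r hr

/-- All declared degrees are zero, so no signs occur, and at each vertex of an admissible tree the
operation of the model is plain grafting. -/
theorem act_single (T : PTree m) (hT : T.Admissible) :
    act G.μ T (fun _ => 0) (fun _ => Finsupp.single leaf 1) = Finsupp.single T 1 := by
  induction T with
  | leaf => rfl
  | node j c ih =>
    simp only [act, Finset.sum_const_zero, mul_zero, Int.negOnePow_zero, one_smul]
    simp only [ih _ (hT.2 _)]
    rw [G.μ_homogeneous j c (fun _ => 0) (fun _ => 1) fun _ => G.one_mem, koszul_ofFn,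
      op_of_admissible j c hT, tens_single]
    simp

end ParityAlgebra

/-- The trivial grading of the ground ring. -/
def ParityAlgebra.trivial (k : Type u) [CommRing k] : ParityAlgebra k k where
  comp d := if d = 0 then ⊤ else ⊥
  one_mem := by simp
  mul_mem {d e r s} hr hs := by
    by_cases hd : d = 0
    · by_cases he : e = 0
      · simp [hd, he]
      · simp only [he, if_false, Submodule.mem_bot] at hs
        simp [hs]
    · simp only [hd, if_false, Submodule.mem_bot] at hr
      simp [hr]
  tw _ := LinearMap.id
  tw_apply e d r hr := by
    by_cases hd : d = 0
    · simp [hd]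
    · simp only [hd, if_false, Submodule.mem_bot] at hr
      simp [hr]

namespace AmOp

variable {k : Type u} [CommRing k] {m : ℕ∞}

/-- Evaluation at `(|, …, |)` in the model with `R = k` kills the ideal of relations, so it descends
to `A_m(n)`; there it sends the class of an admissible tree to the corresponding basis vector. -/
theorem linearIndependent_admissible (n : ℕ) :
    LinearIndependent k (fun T : AdmTr m n => AmOp.ofTree k T.1) := by
  set G := ParityAlgebra.trivial k
  have hle : relIdeal k m n ≤ LinearMap.ker ((G.amStructure (m := m)).actFree (n := n) 0
      (fun _ => 0) (fun _ => Finsupp.single PTree.leaf 1)) := fun f hf =>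
    (AmStructure.mem_annihilator _).mp (AmStructure.relIdeal_le_annihilator _ n hf) _ _ _
      fun t _ => Submodule.subset_span ⟨_, 0, 1, G.one_mem, rfl, rfl⟩
  refine LinearIndependent.of_comp ((relIdeal k m n).liftQ _ hle) ?_
  have : ((relIdeal k m n).liftQ _ hle ∘ fun T : AdmTr m n => AmOp.ofTree k T.1) =
      fun T : AdmTr m n => Finsupp.single T.1.1 (1 : k) := by
    funext T
    rw [Function.comp, ofTree, Submodule.mkQ_apply, Submodule.liftQ_apply,
      AmStructure.actFree_single, zero_mul, Int.negOnePow_zero, one_smul]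
    exact G.act_single _ T.2
  rw [this]
  exact (Finsupp.linearIndependent_single_one k (PTree m)).comp _
    (Subtype.val_injective.comp Subtype.val_injective)

/-- The basis of admissible trees. -/
def basis (n : ℕ) : Module.Basis (AdmTr m n) k (AmOp k m n) :=
  Module.Basis.mk (linearIndependent_admissible n) (span_admissible n).ge

theorem basis_apply {n : ℕ} (T : AdmTr m n) : basis n T = AmOp.ofTree k T.1 :=
  Module.Basis.mk_apply _ _ _

theorem ofAdm_eq (n : ℕ) : (ofAdm k : (AdmTr m n →₀ k) →ₗ[k] _) = ((basis n).repr.symm : (AdmTr m n →₀ k) ≃ₗ[k] AmOp k m n).toLinearMap := by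
  refine LinearMap.ext fun f => ?_
  simp only [LinearEquiv.coe_coe, Module.Basis.repr_symm_apply, ofAdm]
  congr 2
  funext T
  exact (basis_apply T).symm

end AmOp
end

noncomputable section

/-! ### Internal gradings -/

section Internal

variable {k : Type*} [CommRing k] {X : Type*} [AddCommGroup X] [Module k X]

/-- The decomposition of a module with an internal grading. -/
def DirectSum.IsInternal.equiv {𝒳 : ℤ → Submodule k X} (h : DirectSum.IsInternal 𝒳) :
    X ≃ₗ[k] ⨁ d, 𝒳 d :=
  (LinearEquiv.ofBijective (DirectSum.coeLinearMap 𝒳) h).symm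

theorem DirectSum.IsInternal.equiv_apply {𝒳 : ℤ → Submodule k X} (h : DirectSum.IsInternal 𝒳)
    {d : ℤ} {x : X} (hx : x ∈ 𝒳 d) :
    h.equiv x = DirectSum.lof k ℤ (fun d => 𝒳 d) d ⟨x, hx⟩ := by
  refine (LinearEquiv.symm_apply_eq _).mpr ?_
  exact (DirectSum.coeLinearMap_lof 𝒳 d ⟨x, hx⟩).symm

theorem DirectSum.IsInternal.span_iUnion {𝒳 : ℤ → Submodule k X} (h : DirectSum.IsInternal 𝒳) :
    Submodule.span k (⋃ d, (𝒳 d : Set X)) = ⊤ := by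
  rw [← h.submodule_iSup_eq_top, Submodule.span_iUnion]
  simp

/-- The map `θ` separates the components of a sum after applying the injective `f`. Thus the
coaction is only needed on an ambient module containing `X`. -/
theorem isInternal_of_coaction {N : Type*} [AddCommGroup N] [Module k N] (𝒳 : ℤ → Submodule k X)
    (h : ⨆ d, 𝒳 d = ⊤) (f : X →ₗ[k] N) (hf : Function.Injective f) (θ : X →ₗ[k] ℤ →₀ N)
    (hθ : ∀ d, ∀ x ∈ 𝒳 d, θ x = Finsupp.single d (f x)) : DirectSum.IsInternal 𝒳 := by
  constructor
  · have key : ∀ (v : ⨁ d, 𝒳 d) (d : ℤ), θ (DirectSum.coeLinearMap 𝒳 v) d = f (v d) := by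
      intro v d
      induction v using DirectSum.induction_on with
      | zero => simp
      | of e x =>
        rw [DirectSum.coeLinearMap_of, hθ e _ x.2, Finsupp.single_apply]
        split_ifs with hd
        · subst hd; rw [DirectSum.of_eq_same]
        · rw [DirectSum.of_eq_of_ne _ _ _ (Ne.symm hd)]; simp
      | add v w hv hw => simp [hv, hw]
    intro v w hvw
    refine DFinsupp.ext fun d => Subtype.ext (hf ?_)
    have hvw' : DirectSum.coeLinearMap 𝒳 v = DirectSum.coeLinearMap 𝒳 w := hvw
    exact (key v d).symm.trans ((congrArg (fun z => θ z d) hvw').trans (key w d))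
  · have : LinearMap.range (DirectSum.coeLinearMap 𝒳) = ⊤ := by
      rw [DirectSum.range_coeLinearMap, h]
    exact LinearMap.range_eq_top.mp this

end Internal

/-! ### The grading of the tensor algebra -/

namespace TensorAlgebra

variable {k : Type u} [CommRing k] {X : Type v} [AddCommGroup X] [Module k X]
variable {𝒳 : ℤ → Submodule k X} (h𝒳 : DirectSum.IsInternal 𝒳)

/-- The coaction defining the internal grading of the tensor algebra. -/
def coaction : TensorAlgebra k X →ₐ[k] AddMonoidAlgebra (TensorAlgebra k X) ℤ :=
  TensorAlgebra.lift k (DirectSum.toModule k ℤ _ (fun d =>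
    AddMonoidAlgebra.lsingle d ∘ₗ ι k ∘ₗ (𝒳 d).subtype) ∘ₗ h𝒳.equiv.toLinearMap)

theorem coaction_ι {d : ℤ} {x : X} (hx : x ∈ 𝒳 d) :
    coaction h𝒳 (ι k x) = AddMonoidAlgebra.single d (ι k x) := by
  rw [coaction, lift_ι_apply, LinearMap.comp_apply, LinearEquiv.coe_coe, h𝒳.equiv_apply hx,
    DirectSum.toModule_lof]
  rfl

/-- The internal grading of the tensor algebra of a graded module. -/
def parityAlgebra : ParityAlgebra k (TensorAlgebra k X) where
  -- Reading `single d r` as `r t^d`, the homogeneous elements of degree `d` are those with coaction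
  -- `r t^d`.
  comp d := LinearMap.eqLocus (coaction h𝒳).toLinearMap (AddMonoidAlgebra.lsingle d)
  one_mem := by
    rw [LinearMap.mem_eqLocus, AlgHom.toLinearMap_apply, AddMonoidAlgebra.lsingle_apply, map_one,
      AddMonoidAlgebra.one_def]
  mul_mem {d e r s} hr hs := by
    rw [LinearMap.mem_eqLocus, AlgHom.toLinearMap_apply, AddMonoidAlgebra.lsingle_apply] at *
    rw [map_mul, hr, hs, AddMonoidAlgebra.single_mul_single]
  -- The coaction followed by the evaluation `t ↦ (-1)^e`.
  tw e := Finsupp.lsum k (fun d => ((Int.negOnePow (e * d) : ℤ) : k) • LinearMap.id) ∘ₗ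
    (AddMonoidAlgebra.coeffLinearEquiv k).toLinearMap ∘ₗ (coaction h𝒳).toLinearMap
  tw_apply e d r hr := by
    rw [LinearMap.mem_eqLocus] at hr
    rw [LinearMap.comp_apply, LinearMap.comp_apply, hr, AddMonoidAlgebra.lsingle_apply]
    have : (AddMonoidAlgebra.coeffLinearEquiv k).toLinearMap (AddMonoidAlgebra.single d r) =
      Finsupp.single d r := rfl
    rw [this, Finsupp.lsum_single, LinearMap.smul_apply, LinearMap.id_apply,
      Int.cast_smul_eq_zsmul, Units.smul_def]

theorem mem_parityAlgebra {d : ℤ} {r : TensorAlgebra k X} :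
    r ∈ (parityAlgebra h𝒳).comp d ↔ coaction h𝒳 r = AddMonoidAlgebra.single d r := Iff.rfl

theorem tprod_mem {n : ℕ} {e : Fin n → ℤ} {x : Fin n → X} (hx : ∀ i, x i ∈ 𝒳 (e i)) :
    tprod k X n x ∈ (parityAlgebra h𝒳).comp (∑ i, e i) := by
  rw [tprod_apply]
  exact (parityAlgebra h𝒳).prod_mem e _ fun i => coaction_ι h𝒳 (hx i)

variable (m : ℕ∞)

/-- The coaction defining the grading of the functions on trees. -/
def treeCoaction : (PTree m →₀ TensorAlgebra k X) →ₗ[k] ℤ →₀ (PTree m →₀ TensorAlgebra k X) :=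
  Finsupp.lsum k fun T => Finsupp.lmapDomain _ k (fun e => T.deg + e) ∘ₗ
    Finsupp.mapRange.linearMap (Finsupp.lsingle T) ∘ₗ
      (AddMonoidAlgebra.coeffLinearEquiv k).toLinearMap ∘ₗ (coaction h𝒳).toLinearMap

theorem treeCoaction_apply {d : ℤ} {z : PTree m →₀ TensorAlgebra k X}
    (hz : z ∈ (parityAlgebra h𝒳).grading m d) :
    treeCoaction h𝒳 m z = Finsupp.single d z := by
  refine LinearMap.eqOn_span (f := treeCoaction h𝒳 m) (g := Finsupp.lsingle d) ?_ hz
  rintro _ ⟨T, e, r, hr, rfl, rfl⟩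
  rw [mem_parityAlgebra] at hr
  rw [treeCoaction, Finsupp.lsum_single, LinearMap.comp_apply, LinearMap.comp_apply,
    LinearMap.comp_apply, AlgHom.toLinearMap_apply, hr]
  have : (AddMonoidAlgebra.coeffLinearEquiv k).toLinearMap (AddMonoidAlgebra.single e r) =
      Finsupp.single e r := rfl
  rw [this, Finsupp.mapRange.linearMap_apply, Finsupp.mapRange_single, Finsupp.lmapDomain_apply,
    Finsupp.mapDomain_single]
  rfl

end TensorAlgebra
end

noncomputable section

namespace FreeAm

variable {k : Type u} [CommRing k] {m : ℕ∞} {X : Type v} [AddCommGroup X] [Module k X]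

/-! ### Generators -/

variable (k m) in
/-- The elements `T ⊗ x_1 ⊗ ⋯ ⊗ x_n` of degree `d` with `T` admissible and `x_i` homogeneous. -/
def gens (𝒳 : ℤ → Submodule k X) (d : ℤ) : Set (FreeAm k m X) :=
  {z | ∃ (n : ℕ+) (T : AdmTr m n) (e : Fin n → ℤ) (x : Fin n → X),
    (∀ i, x i ∈ 𝒳 (e i)) ∧ T.1.1.deg + ∑ i, e i = d ∧ z = elem n (AmOp.ofTree k T.1) x}

variable (k m) in
/-- `p ↦ p ⊗ x_1 ⊗ ⋯ ⊗ x_n`. -/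
def elemL (n : ℕ+) (x : Fin n → X) : AmOp k m n →ₗ[k] FreeAm k m X :=
  DirectSum.lof k ℕ+ (fun n : ℕ+ => AmOp k m n ⊗[k] (⨂[k]^(n : ℕ) X)) n ∘ₗ
    (TensorProduct.mk k (AmOp k m n) (⨂[k]^(n : ℕ) X)).flip (PiTensorProduct.tprod k x)

/-- Normalization preserves degrees, so arbitrary trees in the definition of the grading can be
traded for admissible ones. -/
theorem grading_eq_span (𝒳 : ℤ → Submodule k X) (d : ℤ) :
    grading m 𝒳 d = Submodule.span k (gens k m 𝒳 d) := by
  refine le_antisymm (Submodule.span_le.mpr ?_) (Submodule.span_mono ?_)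
  · rintro _ ⟨n, T, e, x, hx, hd, rfl⟩
    have := AmOp.ofTree_mem_span (k := k) n T
    have h : Submodule.span k
        ((fun U : AdmTr m n => AmOp.ofTree k U.1) '' {U | U.1.1.deg = T.1.deg}) ≤
        (Submodule.span k (gens k m 𝒳 d)).comap (elemL k m n x) := by
      rw [Submodule.span_le]
      rintro _ ⟨U, hU, rfl⟩
      exact Submodule.subset_span ⟨n, U, e, x, hx, by rw [← hd, hU], rfl⟩
    exact h this
  · rintro _ ⟨n, T, e, x, hx, hd, rfl⟩
    exact ⟨n, T.1, e, x, hx, hd, rfl⟩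

theorem eq_top_of_elem_mem (P : Submodule k (FreeAm k m X))
    (h : ∀ (n : ℕ+) (T : AdmTr m n) (x : Fin n → X), elem n (AmOp.ofTree k T.1) x ∈ P) :
    P = ⊤ := by
  rw [eq_top_iff]
  rintro z -
  induction z using DirectSum.induction_on with
  | zero => exact P.zero_mem
  | add v w hv hw => exact P.add_mem hv hw
  | of n t =>
    set φ := DirectSum.lof k ℕ+ (fun n : ℕ+ => AmOp k m n ⊗[k] (⨂[k]^(n : ℕ) X)) n
    change φ t ∈ P
    induction t using TensorProduct.induction_on with
    | zero => rw [map_zero]; exact P.zero_mem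
    | add v w hv hw => rw [map_add]; exact P.add_mem hv hw
    | tmul p v =>
      have h1 : ∀ x : Fin n → X, ∀ p, elemL k m n x p ∈ P := by
        intro x p
        have h2 : Submodule.span k (Set.range fun T : AdmTr m n => AmOp.ofTree k T.1) ≤
            P.comap (elemL k m n x) := by
          rw [Submodule.span_le]
          rintro _ ⟨T, rfl⟩
          exact h n T x
        rw [AmOp.span_admissible] at h2
        exact h2 (Submodule.mem_top (x := p))
      have h3 : Submodule.span k (Set.range (PiTensorProduct.tprod k (s := fun _ : Fin n => X))) ≤
          P.comap (φ ∘ₗ TensorProduct.mk k (AmOp k m n) (⨂[k]^(n : ℕ) X) p) := by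
        rw [Submodule.span_le]
        rintro _ ⟨x, rfl⟩
        exact h1 x p
      rw [PiTensorProduct.span_tprod_eq_top] at h3
      exact h3 (Submodule.mem_top (x := v))

variable {𝒳 : ℤ → Submodule k X}

theorem span_gens (h𝒳 : DirectSum.IsInternal 𝒳) :
    Submodule.span k (⋃ d, gens k m 𝒳 d) = ⊤ := by
  refine eq_top_of_elem_mem _ fun n T x => ?_
  refine (elem n (AmOp.ofTree k T.1)).mem_of_mem_span (fun _ => ⋃ d, (𝒳 d : Set X)) _
    (fun a ha => ?_) x fun i => ?_
  · choose e he using fun i => Set.mem_iUnion.mp (ha i)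
    exact Submodule.subset_span (Set.mem_iUnion.mpr ⟨_, n, T, e, a, he, rfl, rfl⟩)
  · rw [h𝒳.span_iUnion]
    exact Submodule.mem_top

theorem hom_ext (h𝒳 : DirectSum.IsInternal 𝒳) {P : Type*} [AddCommGroup P] [Module k P]
    {f g : FreeAm k m X →ₗ[k] P}
    (h : ∀ (n : ℕ+) (T : AdmTr m n) (e : Fin n → ℤ) (x : Fin n → X), (∀ i, x i ∈ 𝒳 (e i)) →
      f (elem n (AmOp.ofTree k T.1) x) = g (elem n (AmOp.ofTree k T.1) x)) : f = g := by
  refine LinearMap.ext_on (span_gens h𝒳) ?_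
  rintro z hz
  obtain ⟨d, n, T, e, x, hx, -, rfl⟩ := Set.mem_iUnion.mp hz
  exact h n T e x hx

theorem multilinear_ext (h𝒳 : DirectSum.IsInternal 𝒳) {P : Type*} [AddCommGroup P] [Module k P]
    {j : ℕ} {f g : MultilinearMap k (fun _ : Fin j => FreeAm k m X) P}
    (h : ∀ (n : Fin j → ℕ+) (T : ∀ i, AdmTr m (n i)) (e : ∀ i, Fin (n i) → ℤ)
      (x : ∀ i, Fin (n i) → X), (∀ i l, x i l ∈ 𝒳 (e i l)) →
      f (fun i => elem (n i) (AmOp.ofTree k (T i).1) (x i)) =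
        g (fun i => elem (n i) (AmOp.ofTree k (T i).1) (x i))) : f = g := by
  refine MultilinearMap.ext fun a => f.eq_of_mem_span g (fun _ => ⋃ d, gens k m 𝒳 d)
    (fun a ha => ?_) a fun i => by rw [span_gens h𝒳]; exact Submodule.mem_top
  choose d n T e x hx hd ha using fun i => Set.mem_iUnion.mp (ha i)
  obtain rfl := funext ha
  exact h n T e x hx

/-! ### Comparison with the functions on trees -/

variable (k m X) in
/-- The embedding into the functions on trees with values in the tensor algebra. -/
def emb : FreeAm k m X →ₗ[k] (PTree m →₀ TensorAlgebra k X) :=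
  DirectSum.toModule k ℕ+ _ fun n => TensorProduct.lift ((AmOp.basis (n : ℕ)).constr k
    fun T : AdmTr m n => Finsupp.lsingle T.1.1 ∘ₗ TensorPower.toTensorAlgebra)

variable (k m X) in
/-- The left inverse of `FreeAm.emb`. -/
def proj : (PTree m →₀ TensorAlgebra k X) →ₗ[k] FreeAm k m X :=
  -- Of `r` in `T ⊗ r` only the component of tensor degree the number of legs of `T` is kept.
  -- Non-admissible `T` are not discarded but sent to their classes.
  Finsupp.lsum k fun T =>
    DirectSum.lof k ℕ+ (fun n : ℕ+ => AmOp k m n ⊗[k] (⨂[k]^(n : ℕ) X)) ⟨T.leaves, T.leaves_pos⟩ ∘ₗ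
      TensorProduct.mk k (AmOp k m T.leaves) (⨂[k]^T.leaves X) (AmOp.ofTree k ⟨T, rfl⟩) ∘ₗ
        DirectSum.component k ℕ (fun n => ⨂[k]^n X) T.leaves ∘ₗ
          TensorAlgebra.toDirectSum.toLinearMap

theorem emb_elem (n : ℕ+) (T : AdmTr m n) (x : Fin n → X) :
    emb k m X (elem n (AmOp.ofTree k T.1) x) =
      Finsupp.single T.1.1 (TensorAlgebra.tprod k X n x) := by
  have : elem n (AmOp.ofTree k T.1) x = DirectSum.lof k ℕ+
    (fun n : ℕ+ => AmOp k m n ⊗[k] (⨂[k]^(n : ℕ) X)) n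
      (AmOp.ofTree k T.1 ⊗ₜ PiTensorProduct.tprod k x) := rfl
  rw [this, emb, DirectSum.toModule_lof, TensorProduct.lift.tmul, ← AmOp.basis_apply,
    Module.Basis.constr_basis, LinearMap.comp_apply, TensorPower.toTensorAlgebra_tprod,
    Finsupp.lsingle_apply]

theorem component_toDirectSum {n : ℕ} (x : Fin n → X) :
    DirectSum.component k ℕ (fun n => ⨂[k]^n X) n
      (TensorAlgebra.toDirectSum (TensorAlgebra.tprod k X n x)) = PiTensorProduct.tprod k x := by
  rw [TensorAlgebra.toDirectSum_tensorPower_tprod]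
  exact DirectSum.of_eq_same _ _

theorem proj_single (n : ℕ+) (T : Tr m n) (x : Fin n → X) :
    proj k m X (Finsupp.single T.1 (TensorAlgebra.tprod k X n x)) =
      elem n (AmOp.ofTree k T) x := by
  obtain ⟨n, hn⟩ := n
  obtain ⟨T, hT⟩ := T
  have hT' : T.leaves = n := hT
  subst hT'
  rw [proj, Finsupp.lsum_single]
  have h1 := component_toDirectSum (k := k) (n := T.leaves) x
  exact congrArg (fun v => DirectSum.lof k ℕ+ (fun n : ℕ+ => AmOp k m n ⊗[k] (⨂[k]^(n : ℕ) X))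
    ⟨T.leaves, T.leaves_pos⟩ (TensorProduct.mk k (AmOp k m T.leaves) (⨂[k]^T.leaves X)
      (AmOp.ofTree k ⟨T, rfl⟩) v)) h1

theorem proj_emb (z : FreeAm k m X) : proj k m X (emb k m X z) = z := by
  have : LinearMap.eqLocus (proj k m X ∘ₗ emb k m X) LinearMap.id = ⊤ :=
    eq_top_of_elem_mem _ fun n T x => by
      rw [LinearMap.mem_eqLocus, LinearMap.comp_apply, emb_elem, proj_single, LinearMap.id_apply]
  exact LinearMap.congr_fun (LinearMap.eqLocus_eq_top.mp this) z

theorem emb_proj_single (n : ℕ+) (T : AdmTr m n) (x : Fin n → X) :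
    emb k m X (proj k m X (Finsupp.single T.1.1 (TensorAlgebra.tprod k X n x))) =
      Finsupp.single T.1.1 (TensorAlgebra.tprod k X n x) := by
  rw [proj_single, emb_elem]

theorem emb_mem (h𝒳 : DirectSum.IsInternal 𝒳) {d : ℤ} {z : FreeAm k m X}
    (hz : z ∈ grading m 𝒳 d) :
    emb k m X z ∈ (TensorAlgebra.parityAlgebra h𝒳).grading m d := by
  rw [grading_eq_span] at hz
  have : Submodule.span k (gens k m 𝒳 d) ≤
      ((TensorAlgebra.parityAlgebra h𝒳).grading m d).comap (emb k m X) := by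
    rw [Submodule.span_le]
    rintro _ ⟨n, T, e, x, hx, hd, rfl⟩
    rw [SetLike.mem_coe, Submodule.mem_comap, emb_elem]
    exact Submodule.subset_span ⟨T.1.1, _, _, TensorAlgebra.tprod_mem h𝒳 hx, hd, rfl⟩
  exact this hz

/-- Inherited along `emb` from the functions on trees, where the degree is recorded by the coaction
of the tensor algebra shifted by the degree of the tree. -/
theorem isInternal_grading (h𝒳 : DirectSum.IsInternal 𝒳) :
    DirectSum.IsInternal (grading m 𝒳) := by
  refine isInternal_of_coaction _ ?_ (emb k m X) (Function.LeftInverse.injective proj_emb)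
    (TensorAlgebra.treeCoaction h𝒳 m ∘ₗ emb k m X) fun d z hz =>
      TensorAlgebra.treeCoaction_apply h𝒳 m (emb_mem h𝒳 hz)
  rw [eq_top_iff, ← span_gens h𝒳, Submodule.span_le]
  intro z hz
  obtain ⟨d, hd⟩ := Set.mem_iUnion.mp hz
  have : z ∈ grading m 𝒳 d := by rw [grading_eq_span]; exact Submodule.subset_span hd
  exact Submodule.mem_iSup_of_mem d this

end FreeAm
end

noncomputable section

/-! ### Concatenation -/

theorem concat_blockStart {A : Type*} {j : ℕ} {n : Fin j → ℕ} (x : ∀ i, Fin (n i) → A) (i : Fin j)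
    (l : Fin (n i)) (q : Fin (∑ i, n i)) (hq : q.1 = blockStart n i.1 + l.1) :
    concat x q = x i l := by
  have : finSigmaFinEquiv.symm q = ⟨i, l⟩ :=
    (Equiv.symm_apply_eq _).mpr (Fin.ext (hq.trans (finSigmaFinEquiv_val n ⟨i, l⟩).symm))
  rw [concat, this]

theorem concat_finSigmaFinEquiv {A : Type*} {j : ℕ} {n : Fin j → ℕ} (x : ∀ i, Fin (n i) → A)
    (p : (i : Fin j) × Fin (n i)) : concat x (finSigmaFinEquiv p) = x p.1 p.2 := by
  rw [concat, Equiv.symm_apply_apply]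

theorem sum_concat {j : ℕ} {n : Fin j → ℕ} (e : ∀ i, Fin (n i) → ℤ) :
    ∑ q, concat e q = ∑ i, ∑ l, e i l := by
  rw [← Fintype.sum_sigma', ← Equiv.sum_comp finSigmaFinEquiv]
  simp only [concat_finSigmaFinEquiv]

theorem prod_range_sum {R : Type*} [Monoid R] {j : ℕ} (n : Fin j → ℕ) (y : ℕ → R) :
    ((List.range (∑ i, n i)).map y).prod =
      (List.ofFn fun i => ((List.range (n i)).map fun t => y (blockStart n i.1 + t)).prod).prod := by
  induction j generalizing y with
  | zero => simp
  | succ j ih =>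
    rw [Fin.sum_univ_succ, List.range_add, List.map_append, List.prod_append, List.map_map, ih,
      List.ofFn_succ, List.prod_cons]
    have h0 : blockStart n 0 = 0 := by simp [blockStart]
    have hs : ∀ i : Fin j, blockStart n i.succ.1 = n 0 + blockStart (fun i => n i.succ) i.1 := by
      intro i
      simp [blockStart, Finset.sum_filter, Fin.sum_univ_succ]
    simp only [hs, Fin.val_zero, h0, zero_add, Function.comp, add_assoc]

theorem ofFn_eq_map_range {A : Type*} {n : ℕ} (f : Fin n → A) (y : ℕ → A) (h : ∀ i, f i = y i.1) :
    List.ofFn f = (List.range n).map y := by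
  apply List.ext_getElem
  · simp
  · intro i h1 h2
    simp [h]

theorem prod_tprod {k : Type*} [CommRing k] {X : Type*} [AddCommGroup X] [Module k X] {j : ℕ}
    {n : Fin j → ℕ} (x : ∀ i, Fin (n i) → X) :
    (List.ofFn fun i => TensorAlgebra.tprod k X (n i) (x i)).prod =
      TensorAlgebra.tprod k X (∑ i, n i) (concat x) := by
  set y : ℕ → TensorAlgebra k X := fun t =>
    if h : t < ∑ i, n i then TensorAlgebra.ι k (concat x ⟨t, h⟩) else 1
  rw [TensorAlgebra.tprod_apply, ofFn_eq_map_range _ y fun q => (dif_pos q.2).symm, prod_range_sum]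
  congr 2
  funext i
  rw [TensorAlgebra.tprod_apply]
  rw [ofFn_eq_map_range _ (fun t => y (blockStart n i.1 + t)) fun l => ?_]
  have h : blockStart n i.1 + l.1 < ∑ i, n i := blockStart_add_lt_sum n l.2
  simp only [y, dif_pos h]
  rw [concat_blockStart x i l _ rfl]

/-! ### The structure operations -/

namespace FreeAm

variable {k : Type u} [CommRing k] {m : ℕ∞} {X : Type v} [AddCommGroup X] [Module k X]
variable {𝒳 : ℤ → Submodule k X} (h𝒳 : DirectSum.IsInternal 𝒳)

open ParityAlgebra (tens)

/-- The structure operations of the free `A(m)`-algebra. -/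
def μ (j : Ar m) : MultilinearMap k (fun _ : Fin j.1 => FreeAm k m X) (FreeAm k m X) :=
  (proj k m X).compMultilinearMap
    (((TensorAlgebra.parityAlgebra h𝒳).μ j).compLinearMap fun _ => emb k m X)

theorem proj_tens (n : ℕ+) (x : Fin n → X) {g : PTree m →₀ k}
    (hg : g ∈ Finsupp.supported k k {U : PTree m | U.leaves = n}) :
    proj k m X (tens g (TensorAlgebra.tprod k X n x)) = elem n (AmOp.clsL k n g) x := by
  refine Finsupp.eq_of_mem_supported (φ := proj k m X ∘ₗ tens.flip (TensorAlgebra.tprod k X n x))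
    (ψ := elemL k m n x ∘ₗ AmOp.clsL k n) (fun U hU => ?_) hg
  rw [LinearMap.comp_apply, LinearMap.comp_apply, LinearMap.flip_apply, ParityAlgebra.tens_single,
    AmOp.clsL_single, AmOp.cls_of_eq hU]
  exact proj_single n ⟨U, hU⟩ x

theorem emb_proj_tens (n : ℕ+) (x : Fin n → X) {g : PTree m →₀ k}
    (hg : g ∈ Finsupp.supported k k {U : PTree m | U.Admissible ∧ U.leaves = n}) :
    emb k m X (proj k m X (tens g (TensorAlgebra.tprod k X n x))) =
      tens g (TensorAlgebra.tprod k X n x) := by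
  refine Finsupp.eq_of_mem_supported
    (φ := emb k m X ∘ₗ proj k m X ∘ₗ tens.flip (TensorAlgebra.tprod k X n x))
    (ψ := tens.flip (TensorAlgebra.tprod k X n x)) (fun U hU => ?_) hg
  rw [LinearMap.comp_apply, LinearMap.comp_apply, LinearMap.flip_apply, ParityAlgebra.tens_single]
  exact emb_proj_single n ⟨⟨U, hU.2⟩, hU.1⟩ x

section

variable {j : Ar m} {n : Fin j.1 → ℕ+} (T : ∀ i, AdmTr m (n i)) {e : ∀ i, Fin (n i) → ℤ}
  {x : ∀ i, Fin (n i) → X} (hx : ∀ i l, x i l ∈ 𝒳 (e i l))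

include hx

theorem μ_emb_elem : (TensorAlgebra.parityAlgebra h𝒳).μ j
      (fun i => emb k m X (elem (n i) (AmOp.ofTree k (T i).1) (x i))) =
    Int.negOnePow (koszul (List.ofFn fun i => ((T i).1.1.deg, ∑ l, e i l))) •
      tens (PTree.op k j fun i => (T i).1.1)
        (TensorAlgebra.tprod k X (posSum j n : ℕ) (concat x)) := by
  simp only [emb_elem]
  rw [ParityAlgebra.μ_homogeneous _ j (fun i => (T i).1.1) (fun i => ∑ l, e i l)
    (fun i => TensorAlgebra.tprod k X (n i) (x i)) fun i => TensorAlgebra.tprod_mem h𝒳 (hx i),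
    prod_tprod]
  rfl

/-- The model produces the normal form of `ξ_j(T_1, …, T_j)`, whose class is that of the tree itself
by `AmOp.clsL_op`; hence a formula without `Ω`. -/
theorem μ_elem : μ h𝒳 j (fun i => elem (n i) (AmOp.ofTree k (T i).1) (x i)) =
    Int.negOnePow (koszul (List.ofFn fun i => ((T i).1.1.deg, ∑ l, e i l))) •
      elem (posSum j n) (AmOp.ofTree k (Tr.corollaOf j fun i => (T i).1)) (concat x) := by
  have hl : ∑ i, (T i).1.1.leaves = (posSum j n : ℕ) :=
    Finset.sum_congr rfl fun i _ => (T i).1.2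
  rw [μ, LinearMap.compMultilinearMap_apply, MultilinearMap.compLinearMap_apply,
    μ_emb_elem h𝒳 T hx, map_intUnits_smul, proj_tens (posSum j n) (concat x)
      (Finsupp.supported_mono (fun U hU => hU.2.1.trans hl) (PTree.op_mem j _)),
    AmOp.clsL_op j _ (fun i => (T i).2), AmOp.cls_of_eq (T := PTree.node j _) hl]
  rfl

end

/-- The image of `emb` is closed under the operations of the model, because `op` preserves
admissibility and the number of legs; on this image `emb ∘ proj` is the identity. -/
theorem emb_μ (j : Ar m) (a : Fin j.1 → FreeAm k m X) : emb k m X (μ h𝒳 j a) =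
    (TensorAlgebra.parityAlgebra h𝒳).μ j fun i => emb k m X (a i) := by
  refine MultilinearMap.congr_fun (f := (emb k m X).compMultilinearMap (μ h𝒳 j))
    (g := ((TensorAlgebra.parityAlgebra h𝒳).μ j).compLinearMap fun _ => emb k m X) ?_ a
  refine multilinear_ext h𝒳 fun n T e x hx => ?_
  have hl : ∑ i, (T i).1.1.leaves = (posSum j n : ℕ) :=
    Finset.sum_congr rfl fun i _ => (T i).1.2
  have hg : PTree.op k j (fun i => (T i).1.1) ∈
      Finsupp.supported k k {U : PTree m | U.Admissible ∧ U.leaves = posSum j n} := by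
    refine Finsupp.supported_mono ?_ (PTree.op_mem j _)
    rintro U ⟨-, h1, h2⟩
    exact ⟨h2 fun i => (T i).2, h1.trans hl⟩
  rw [LinearMap.compMultilinearMap_apply, μ, LinearMap.compMultilinearMap_apply,
    MultilinearMap.compLinearMap_apply, μ_emb_elem h𝒳 T hx, map_intUnits_smul, map_intUnits_smul,
    emb_proj_tens (posSum j n) (concat x) hg]

variable (m) in
/-- The free `A(m)`-algebra. -/
def amStructure : AmStructure k m (grading m 𝒳) where
  μ := μ h𝒳
  degree j d a ha := by
    simp only [grading_eq_span] at ha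
    refine (μ h𝒳 j).mem_of_mem_span _ _ (fun a ha => ?_) a ha
    choose n T e x hx hd ha using ha
    obtain rfl := funext ha
    rw [μ_elem h𝒳 T hx, Units.smul_def]
    refine zsmul_mem ?_ _
    have h1 : ∑ q, concat e q = ∑ i, ∑ l, e i l := sum_concat e
    have h2 : (Tr.corollaOf j fun i => (T i).1).1.deg + ∑ q, concat e q = ∑ i, d i + (j.1 - 2) := by
      rw [h1]
      simp only [Tr.corollaOf, PTree.deg, ← hd, Finset.sum_add_distrib]
      ring
    exact Submodule.subset_span ⟨posSum j n, Tr.corollaOf j fun i => (T i).1, concat e, concat x,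
      fun q => hx _ _, h2, rfl⟩
  rel n d a ha := by
    -- The relation is taken in the model and pulled back by `proj`; the inner operations match
    -- because `emb` commutes with them.
    have h := ((TensorAlgebra.parityAlgebra h𝒳).amStructure (m := m)).rel' n d
      (fun i => emb k m X (a i)) fun i => emb_mem h𝒳 (ha i)
    have h' := congrArg (proj k m X) h
    rw [map_zero] at h'
    simp only [map_sum, map_intUnits_smul] at h'
    refine Eq.trans (Finset.sum_congr rfl fun l _ => Finset.sum_congr rfl fun s _ => ?_) h'
    have hs := s.2
    refine congrArg (fun z => amSign d l (s.1 + 1) • proj k m X z) ?_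
    refine congrArg ((TensorAlgebra.parityAlgebra h𝒳).μ _) (funext fun i => ?_)
    refine (map_replaceBlock (emb k m X) _ _ _ _ _ _ _ i).trans ?_
    exact congrArg (fun z => replaceBlock (fun i => emb k m X (a i)) l.1 (s.1 + 1) (n.1 - s.1)
      (by omega) (by omega) z i) (emb_μ h𝒳 (n.lower (s.1 + 1) (by omega) (by omega)) _)

end FreeAm
end

noncomputable section

/-! ### The action on finite tuples -/

/-- The extension of a tuple by zero. -/
def extendZero {A : Type*} [Zero A] {n : ℕ} (x : Fin n → A) : ℕ → A := fun t =>
  if h : t < n then x ⟨t, h⟩ else 0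

theorem extendZero_apply {A : Type*} [Zero A] {n : ℕ} (x : Fin n → A) (i : Fin n) :
    extendZero x i.1 = x i := dif_pos i.2

theorem extendZero_update {A : Type*} [Zero A] {n : ℕ} (x : Fin n → A) (i : Fin n) (y : A) :
    extendZero (Function.update x i y) = Function.update (extendZero x) i.1 y := by
  funext t
  by_cases h : t < n
  · simp only [extendZero, dif_pos h, Function.update_apply, Fin.ext_iff]
  · simp only [extendZero, dif_neg h]
    rw [Function.update_of_ne (by rintro rfl; exact h i.2)]
    simp only [extendZero, dif_neg h]

theorem sum_range_extendZero {n : ℕ} (d : Fin n → ℤ) :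
    ∑ t ∈ Finset.range n, extendZero d t = ∑ i, d i := by
  rw [Finset.sum_range]
  simp only [extendZero_apply]

theorem extendZero_concat {A : Type*} [Zero A] {j : ℕ} {n : Fin j → ℕ} (x : ∀ i, Fin (n i) → A)
    (i : Fin j) {t : ℕ} (ht : t < n i) :
    extendZero (concat x) (blockStart n i.1 + t) = extendZero (x i) t := by
  have h : blockStart n i.1 + t < ∑ i, n i := blockStart_add_lt_sum n ht
  simp only [extendZero, dif_pos h, dif_pos ht]
  exact concat_blockStart x i ⟨t, ht⟩ _ rfl

namespace FreeAm

open PTree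

variable {k : Type u} [CommRing k] {m : ℕ∞} {X : Type v} [AddCommGroup X] [Module k X]
variable {𝒳 : ℤ → Submodule k X} (h𝒳 : DirectSum.IsInternal 𝒳)
variable {B : Type w} [AddCommGroup B] [Module k B] {ℬ : ℤ → Submodule k B}
variable (R : AmStructure k m ℬ) (f : X →ₗ[k] B)

/-- The action of a tree on tuples of elements of degrees `d`. -/
def actTuple {n : ℕ} (T : Tr m n) (d : Fin n → ℤ) : MultilinearMap k (fun _ : Fin n => B) B :=
  MultilinearMap.mk' (fun b => act R.μ T.1 (extendZero d) (extendZero b))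
    (fun b i x y => by
      simp only [extendZero_update]
      exact act_update_add R.μ T.1 (T.2.symm ▸ i.2) _ _ x y)
    (fun b i a x => by
      simp only [extendZero_update]
      exact act_update_smul R.μ T.1 (T.2.symm ▸ i.2) _ _ a x)

/-- The action of a tree on tuples of elements of the image of `f`. -/
def evalTree {n : ℕ} (T : Tr m n) : MultilinearMap k (fun _ : Fin n => X) B :=
  -- The action needs declared degrees, so it is prescribed on homogeneous components and assembled
  -- over all tuples of degrees.
  (MultilinearMap.fromDirectSumEquiv (R := k) (M := fun (_ : Fin n) (d : ℤ) => 𝒳 d)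
    (fun d : Fin n → ℤ => (actTuple R T d).compLinearMap
      fun i => f ∘ₗ (𝒳 (d i)).subtype)).compLinearMap fun _ => h𝒳.equiv.toLinearMap

theorem evalTree_apply {n : ℕ} (T : Tr m n) {d : Fin n → ℤ} {x : Fin n → X}
    (hx : ∀ i, x i ∈ 𝒳 (d i)) :
    evalTree h𝒳 R f T x = act R.μ T.1 (extendZero d) (extendZero fun i => f (x i)) := by
  rw [evalTree, MultilinearMap.compLinearMap_apply]
  have h := MultilinearMap.fromDirectSumEquiv_lof (R := k)
    (M := fun (_ : Fin n) (d : ℤ) => 𝒳 d)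
    (fun d : Fin n → ℤ => (actTuple R T d).compLinearMap
      fun i => f ∘ₗ (𝒳 (d i)).subtype) d (fun i => ⟨x i, hx i⟩)
  refine Eq.trans ?_ h
  congr 1
  funext i
  exact h𝒳.equiv_apply (hx i)

/-- The action of the free operad on tuples of elements of the image of `f`. -/
def evalFree (n : ℕ) : FreeOp k m n →ₗ[k] MultilinearMap k (fun _ : Fin n => X) B :=
  Finsupp.linearCombination k fun T : Tr m n => evalTree h𝒳 R f T

variable {f} (hf : ∀ d, ∀ x ∈ 𝒳 d, f x ∈ ℬ d)

include hf in
-- On homogeneous tuples this is the untwisted case `ε = 0` of the annihilation of the relations;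
-- such tuples suffice by multilinearity.
theorem relIdeal_le_ker_evalFree (n : ℕ) :
    relIdeal k m n ≤ LinearMap.ker (evalFree h𝒳 R f n) := by
  intro g hg
  rw [LinearMap.mem_ker]
  refine MultilinearMap.ext fun x => ?_
  refine MultilinearMap.eq_of_mem_span _ 0 (fun _ => ⋃ d, (𝒳 d : Set X)) (fun x hx => ?_) x
    fun i => by rw [h𝒳.span_iUnion]; exact Submodule.mem_top
  choose d hd using fun i => Set.mem_iUnion.mp (hx i)
  have h1 := (AmStructure.mem_annihilator _).mp (AmStructure.relIdeal_le_annihilator R n hg) 0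
    (extendZero d) (extendZero fun i => f (x i)) fun t ht => by
      have h1 := extendZero_apply d ⟨t, ht⟩
      have h2 := extendZero_apply (fun i => f (x i)) ⟨t, ht⟩
      simp only at h1 h2
      rw [h1, h2]
      exact hf _ _ (hd _)
  rw [_root_.zero_apply, ← h1]
  rw [evalFree, AmStructure.actFree, Finsupp.linearCombination_apply,
    Finsupp.linearCombination_apply, Finsupp.sum, Finsupp.sum, _root_.sum_apply]
  refine Finset.sum_congr rfl fun T _ => ?_
  rw [_root_.smul_apply, evalTree_apply h𝒳 R f T hd, zero_mul, Int.negOnePow_zero, one_smul]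

/-! ### The universal property -/

/-- The extension of `f` to the free `A(m)`-algebra. -/
def lift : FreeAm k m X →ₗ[k] B :=
  DirectSum.toModule k ℕ+ _ fun n => TensorProduct.lift
    ((PiTensorProduct.lift (R := k) (s := fun _ : Fin n => X) (E := B)).toLinearMap ∘ₗ
      (relIdeal k m n).liftQ (evalFree h𝒳 R f n) (relIdeal_le_ker_evalFree h𝒳 R hf n))

theorem lift_elem (n : ℕ+) (T : Tr m n) {d : Fin n → ℤ} {x : Fin n → X}
    (hx : ∀ i, x i ∈ 𝒳 (d i)) : lift h𝒳 R hf (elem n (AmOp.ofTree k T) x) =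
      act R.μ T.1 (extendZero d) (extendZero fun i => f (x i)) := by
  have : elem n (AmOp.ofTree k T) x = DirectSum.lof k ℕ+
    (fun n : ℕ+ => AmOp k m n ⊗[k] (⨂[k]^(n : ℕ) X)) n
      (AmOp.ofTree k T ⊗ₜ PiTensorProduct.tprod k x) := rfl
  rw [this, lift, DirectSum.toModule_lof, TensorProduct.lift.tmul, LinearMap.comp_apply,
    LinearEquiv.coe_coe, PiTensorProduct.lift.tprod, AmOp.ofTree, Submodule.mkQ_apply,
    Submodule.liftQ_apply, evalFree, Finsupp.linearCombination_single, one_smul,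
    evalTree_apply h𝒳 R f T hx]

theorem isHom_lift : (amStructure m h𝒳).IsHom R (lift h𝒳 R hf) where
  degree_zero d a ha := by
    have : grading m 𝒳 d ≤ (ℬ d).comap (lift h𝒳 R hf) := by
      rw [grading, Submodule.span_le]
      rintro _ ⟨n, T, e, x, hx, rfl, rfl⟩
      rw [SetLike.mem_coe, Submodule.mem_comap, lift_elem h𝒳 R hf n T hx]
      have h := act_mem (ℬ := ℬ) R.degree T.1 (d := extendZero e)
        (b := extendZero fun i => f (x i)) fun t ht => by
          rw [T.2] at ht
          have h1 := extendZero_apply e ⟨t, ht⟩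
          have h2 := extendZero_apply (fun i => f (x i)) ⟨t, ht⟩
          simp only at h1 h2
          rw [h1, h2]
          exact hf _ _ (hx _)
      rwa [T.2, sum_range_extendZero] at h
    exact this ha
  map_μ j a := by
    refine MultilinearMap.congr_fun (f := (lift h𝒳 R hf).compMultilinearMap (μ h𝒳 j))
      (g := (R.μ j).compLinearMap fun _ => lift h𝒳 R hf) ?_ a
    refine multilinear_ext h𝒳 fun n T e x hx => ?_
    rw [LinearMap.compMultilinearMap_apply, MultilinearMap.compLinearMap_apply,
      μ_elem h𝒳 T hx, map_intUnits_smul,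
      lift_elem h𝒳 R hf (posSum j n) (Tr.corollaOf j fun i => (T i).1) (d := concat e)
        (x := concat x) fun q => hx _ _]
    have hb : ∀ i : Fin j.1, start (fun i => (T i).1.1) i.1 = blockStart (fun i => (n i : ℕ)) i.1 :=
      fun i => Finset.sum_congr rfl fun q _ => (T q).1.2
    have he : ∀ i, ∀ t < (T i).1.1.leaves, extendZero (concat e)
        (start (fun i => (T i).1.1) i.1 + t) = extendZero (e i) t := fun i t ht => by
      rw [hb]
      exact extendZero_concat e i ((T i).1.2 ▸ ht)
    have hy : ∀ i, ∀ t < (T i).1.1.leaves, extendZero (fun q => f (concat x q))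
        (start (fun i => (T i).1.1) i.1 + t) = extendZero (fun l => f (x i l)) t := fun i t ht => by
      rw [hb]
      exact extendZero_concat (fun i l => f (x i l)) i ((T i).1.2 ▸ ht)
    -- The sign which `act` attaches to the root is the Koszul sign in the formula for `μ`, so the
    -- two cancel.
    have hs : ∑ i, degRight (fun i => (T i).1.1) i * ∑ t ∈ Finset.range (T i).1.1.leaves,
        extendZero (concat e) (start (fun i => (T i).1.1) i.1 + t) =
        koszul (List.ofFn fun i => ((T i).1.1.deg, ∑ l, e i l)) := by
      rw [koszul_ofFn]
      refine Finset.sum_congr rfl fun i _ => ?_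
      rw [Finset.sum_congr rfl fun t ht => he i t (Finset.mem_range.mp ht), (T i).1.2,
        sum_range_extendZero]
      rfl
    have ha : act R.μ (Tr.corollaOf j fun i => (T i).1).1 (extendZero (concat e))
        (extendZero fun q => f (concat x q)) =
        Int.negOnePow (koszul (List.ofFn fun i => ((T i).1.1.deg, ∑ l, e i l))) •
          R.μ j fun i => lift h𝒳 R hf (elem (n i) (AmOp.ofTree k (T i).1) (x i)) := by
      rw [← hs, Tr.corollaOf, act]
      congr 2
      funext i
      rw [lift_elem h𝒳 R hf (n i) (T i).1 (hx i)]
      exact act_congr R.μ _ (he i) (hy i)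
    refine (congrArg _ ha).trans ?_
    rw [smul_smul, Int.units_mul_self, one_smul]

theorem unit_apply (x : X) :
    unit k m X x = elem 1 (AmOp.ofTree k (Tr.unit m)) fun _ => x := rfl

theorem lift_comp_unit : lift h𝒳 R hf ∘ₗ unit k m X = f := by
  refine LinearMap.ext_on h𝒳.span_iUnion ?_
  intro x hx
  obtain ⟨d, hd⟩ := Set.mem_iUnion.mp hx
  rw [LinearMap.comp_apply, unit_apply, lift_elem h𝒳 R hf 1 (Tr.unit m) (d := fun _ => d)
    (x := fun _ => x) fun _ => hd]
  rfl

theorem unit_mem {d : ℤ} {x : X} (hx : x ∈ 𝒳 d) : unit k m X x ∈ grading m 𝒳 d :=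
  Submodule.subset_span ⟨1, Tr.unit m, fun _ => d, fun _ => x, fun _ => hx, by
    have : ∑ _i : Fin 1, d = d := Fin.sum_univ_one _
    exact (congrArg (fun z => (Tr.unit m).1.deg + z) this).trans (zero_add d), rfl⟩

-- An element `T ⊗ x_1 ⊗ ⋯ ⊗ x_n` with `T` admissible is, up to sign, `μ_j` of the elements given by
-- the subtrees of `T` at the root, which are again admissible. Induction on `T` ends at the
-- generators `| ⊗ x`.
variable {R} in
theorem isHom_unique {F F' : FreeAm k m X →ₗ[k] B} (hF : (amStructure m h𝒳).IsHom R F)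
    (hF' : (amStructure m h𝒳).IsHom R F') (h : F ∘ₗ unit k m X = F' ∘ₗ unit k m X) : F = F' := by
  suffices H : ∀ (U : PTree m), U.Admissible → ∀ (n : ℕ+) (hU : U.leaves = n) (e : Fin n → ℤ)
      (x : Fin n → X), (∀ i, x i ∈ 𝒳 (e i)) →
      F (elem n (AmOp.ofTree k ⟨U, hU⟩) x) = F' (elem n (AmOp.ofTree k ⟨U, hU⟩) x) from
    hom_ext h𝒳 fun n T e x hx => H T.1.1 T.2 n T.1.2 e x hx
  intro U
  induction U with
  | leaf =>
    intro _ n hU e x hx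
    obtain rfl : n = 1 := PNat.eq hU.symm
    have : x = fun _ => x (0 : Fin 1) := funext fun i => congrArg x (Subsingleton.elim (α := Fin 1) i 0)
    rw [this]
    exact LinearMap.congr_fun h (x (0 : Fin 1))
  | node j c ih =>
    intro hT n hU e x hx
    obtain rfl : n = posSum j fun i => ⟨(c i).leaves, (c i).leaves_pos⟩ := PNat.eq hU.symm
    set T : ∀ i, AdmTr m (c i).leaves := fun i => ⟨⟨c i, rfl⟩, hT.2 i⟩ with hT'
    set y : ∀ i, Fin (c i).leaves → X := fun i l => x (finSigmaFinEquiv ⟨i, l⟩) with hy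
    have hc : concat y = x := funext fun q => congrArg x (Equiv.apply_symm_apply _ _)
    have hμ := μ_elem h𝒳 (n := fun i => ⟨(c i).leaves, (c i).leaves_pos⟩) T
      (e := fun i l => e (finSigmaFinEquiv ⟨i, l⟩)) (x := y) fun i l => hx _
    have hμ' : elem (posSum j fun i => ⟨(c i).leaves, (c i).leaves_pos⟩)
        (AmOp.ofTree k ⟨node j c, hU⟩) x =
        Int.negOnePow (koszul (List.ofFn fun i => ((T i).1.1.deg,
          ∑ l, e (finSigmaFinEquiv ⟨i, l⟩)))) •
        μ h𝒳 j fun i => elem ⟨(c i).leaves, (c i).leaves_pos⟩ (AmOp.ofTree k (T i).1) (y i) := by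
      refine Eq.trans ?_ (congrArg _ hμ.symm)
      rw [smul_smul, Int.units_mul_self, one_smul, ← hc]
      rfl
    have h1 := hF.map_μ j fun i =>
      elem ⟨(c i).leaves, (c i).leaves_pos⟩ (AmOp.ofTree k (T i).1) (y i)
    have h2 := hF'.map_μ j fun i =>
      elem ⟨(c i).leaves, (c i).leaves_pos⟩ (AmOp.ofTree k (T i).1) (y i)
    rw [hμ', map_intUnits_smul, map_intUnits_smul]
    refine congrArg _ (h1.trans (Eq.trans ?_ h2.symm))
    congr 1
    funext i
    exact ih i (hT.2 i) _ rfl _ _ fun l => hx _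

theorem isFreeOn : AmStructure.IsFreeOn.{u, w} (amStructure m h𝒳) 𝒳 (unit k m X) := by
  refine ⟨fun d x hx => unit_mem hx, ?_⟩
  intro B _ _ ℬ _ R f hf
  refine ⟨lift h𝒳 R hf, ⟨isHom_lift h𝒳 R hf, lift_comp_unit h𝒳 R hf⟩, ?_⟩
  rintro F ⟨hF, hF'⟩
  exact isHom_unique h𝒳 hF (isHom_lift h𝒳 R hf) (hF'.trans (lift_comp_unit h𝒳 R hf).symm)

end FreeAm

/-! ### Normal forms -/

namespace AmOp

variable {k : Type u} [CommRing k] {m : ℕ∞}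

variable (k) in
/-- The normal form of a tree. -/
def normalForm (n : ℕ) (T : Tr m n) : AdmTr m n →₀ k := (basis n).repr (ofTree k T)

theorem isNormalization_normalForm : IsNormalization k m (normalForm k) := fun n T => by
  rw [ofAdm_eq]
  exact (basis n).repr.symm_apply_apply _

theorem eq_normalForm {Ω : ∀ n : ℕ, Tr m n → (AdmTr m n →₀ k)} (h : IsNormalization k m Ω) :
    Ω = normalForm k := by
  funext n T
  have := h n T
  rw [ofAdm_eq] at this
  exact (LinearEquiv.symm_apply_eq _).mp this

end AmOp

namespace FreeAm

variable {k : Type u} [CommRing k] {m : ℕ∞} {X : Type v} [AddCommGroup X] [Module k X]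
variable {𝒳 : ℤ → Submodule k X} (h𝒳 : DirectSum.IsInternal 𝒳)
variable {Ω : ∀ n : ℕ, Tr m n → (AdmTr m n →₀ k)}

theorem isGraftingFormula (hΩ : IsNormalization k m Ω) :
    IsGraftingFormula 𝒳 Ω (amStructure m h𝒳) := by
  intro j n T e x hx
  refine (μ_elem h𝒳 T hx).trans (congrArg₂
    (fun (s : ℤ) (p : AmOp k m (posSum j n)) => Int.negOnePow s • elem (posSum j n) p (concat x)) ?_ (hΩ _ (Tr.corollaOf j fun i => (T i).1)).symm)
  rw [koszul_ofFn]
  simp only [Finset.sum_mul, Finset.sum_filter]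
  rw [Finset.sum_comm]
  refine Finset.sum_congr rfl fun q _ => Finset.sum_congr rfl fun p _ => ?_
  split_ifs
  · rw [mul_comm, Finset.sum_mul]
  · exact zero_mul _

-- The grafting formula prescribes each `μ_j` on tuples from a spanning set, and the degree and
-- relation fields are propositions.
include h𝒳 in
theorem eq_of_isGraftingFormula {S S' : AmStructure k m (grading m 𝒳)}
    (h : IsGraftingFormula 𝒳 Ω S) (h' : IsGraftingFormula 𝒳 Ω S') : S = S' := by
  refine AmStructure.ext (funext fun j => multilinear_ext h𝒳 fun n T e x hx => ?_)
  rw [h j n T e x hx, h' j n T e x hx]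

end FreeAm

theorem mainTheorem2 {k : Type u} [CommRing k] (m : ℕ∞) {X : Type v} [AddCommGroup X]
    [Module k X] (𝒳 : ℤ → Submodule k X) (h𝒳 : DirectSum.IsInternal 𝒳) :
    (∀ n : ℕ, LinearIndependent k (fun T : AdmTr m n => AmOp.ofTree k T.1) ∧
      Submodule.span k (Set.range fun T : AdmTr m n => AmOp.ofTree k T.1) = ⊤) ∧
    DirectSum.IsInternal (FreeAm.grading m 𝒳) ∧
    ∃ Ω : ∀ n : ℕ, Tr m n → (AdmTr m n →₀ k),
      IsNormalization k m Ω ∧ (∀ Ω', IsNormalization k m Ω' → Ω' = Ω) ∧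
      ∃ S : AmStructure k m (FreeAm.grading m 𝒳),
        IsGraftingFormula 𝒳 Ω S ∧ (∀ S', IsGraftingFormula 𝒳 Ω S' → S' = S) ∧
        AmStructure.IsFreeOn.{u, w} S 𝒳 (FreeAm.unit k m X) :=
  ⟨fun n => ⟨AmOp.linearIndependent_admissible n, AmOp.span_admissible n⟩,
    FreeAm.isInternal_grading h𝒳, AmOp.normalForm k, AmOp.isNormalization_normalForm,
    fun _ h => AmOp.eq_normalForm h, FreeAm.amStructure m h𝒳,
    FreeAm.isGraftingFormula h𝒳 AmOp.isNormalization_normalForm,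
    fun _ h => FreeAm.eq_of_isGraftingFormula h𝒳 h
      (FreeAm.isGraftingFormula h𝒳 AmOp.isNormalization_normalForm),
    FreeAm.isFreeOn h𝒳⟩
end
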